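/- Let $N\ge 3$, $2^*=2N/(N-2)$, $m>1$, $\lambda>0$, $\varepsilon>0$, and let $V:\mathbb R^N\to\mathbb R$ be locally Hölder continuous and satisfy (V) there are $V_\infty>V_0>0$ with $\min_{\mathbb R^N}V=V_0$ and $\lim_{|x|\to\infty}V(x)=V_\infty$. Let $q\in(2m,2^*m)$. Let $X=\{u\in H^1(\mathbb R^N):\int_{\mathbb R^N}V u^2<\infty\}$ with $\|u\|_X^2=\int_{\mathbb R^N}|\nabla u|^2+\int_{\mathbb R^N}V u^2$. Let $f:\mathbb R\to\mathbb R$ be the odd function with $f(0)=0$ and $f'(v)=(1+m|f(v)|^{2(m-1)})^{-1/2}$ on $[0,\infty)$. Put $g(t)=\lambda|t|^{q-2}t+|t|^{2^*m-2}t$. Fix $\theta\in(2m,q]$, $k>\theta/(\theta-2)$ and $R>0$, and let $$l=\sup\{s>0:\ g(t)/t\le V_0/k\ \text{ for every } 0\le t\le s\}$$ (with $g(t)/t$ read as $0$ at $t=0$). Let $\gamma(s)=g(s)$ for $s>0$ and $\gamma(s)=0$ for $s\le0$; let $\bar\gamma(s)=\gamma(s)$ for $s\le l$ and $\bar\gamma(s)=\frac{V_0}{k}s$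 for $s>l$. With $\chi_R$ the characteristic function of the ball $B_R$ of radius $R$ centred at $0$, put $$p(x,s)=\chi_R(x)\gamma(s)+(1-\chi_R(x))\bar\gamma(s),\qquad P(x,s)=\int_0^s p(x,t)\,dt,$$ and define the modified functional on $X$ by $$\bar J(v)=\frac{\varepsilon^2}{2}\int_{\mathbb R^N}|\nabla v|^2+\frac12\int_{\mathbb R^N}V(x)f(v)^2-\int_{\mathbb R^N}P(x,f(v)).$$ Let $S=\inf\big\{\int|\nabla\varphi|^2\big/\big(\int|\varphi|^{2^*}\big)^{2/2^*}:\ 0\ne\varphi\in C_c^\infty(\mathbb R^N)\big\}$ be the best Sobolev constant. Then $\bar J$ satisfies the Palais–Smale condition at every level $c<\frac{1}{Nm}\varepsilon^N S^{N/2}$: every sequence $(v_n)\subset X$ such that $\bar J(v_n)\to c$ and the Gateaux derivatives $\bar J'(v_n)$ tend to $0$ in the dual of $X$ has a subsequence that converges in $X$. -/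

import Mathlib

open MeasureTheory Filter
open scoped Topology ContDiff

noncomputable section

namespace QuasiSchrodinger

/-- Euclidean space `ℝ^N`. -/
abbrev Euc (N : ℕ) : Type := EuclideanSpace ℝ (Fin N)

/-! ### Weak gradients, the space `X` and the Sobolev constant -/

/-- `G` is a weak gradient of `u` on `ℝ^N`: both are locally integrable and
`∫ u ∂_e φ = - ∫ ⟨G, e⟩ φ` for all test functions `φ ∈ C_c^∞` and all directions `e`. -/
def IsWeakGrad {N : ℕ} (u : Euc N → ℝ) (G : Euc N → Euc N) : Prop :=
  LocallyIntegrable u ∧ LocallyIntegrable G ∧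
    ∀ φ : Euc N → ℝ, ContDiff ℝ ∞ φ → HasCompactSupport φ → ∀ e : Euc N,
      ∫ x, u x * fderiv ℝ φ x e = -∫ x, inner ℝ (G x) e * φ x

/-- The weak gradient is unique up to null sets. -/
theorem IsWeakGrad.ae_eq {N : ℕ} {u : Euc N → ℝ} {G H : Euc N → Euc N}
    (hG : IsWeakGrad u G) (hH : IsWeakGrad u H) : G =ᵐ[volume] H := by
  have hloc : LocallyIntegrable (fun x => G x - H x) := hG.2.1.sub hH.2.1
  have key : ∀ᵐ x, G x - H x = 0 := by
    refine ae_eq_zero_of_integral_contDiff_smul_eq_zero hloc ?_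
    intro φ hφ hφc
    have hi : ∀ {K : Euc N → Euc N}, LocallyIntegrable K →
        Integrable (fun x => φ x • K x) := fun hK =>
      hK.integrable_smul_left_of_hasCompactSupport hφ.continuous hφc
    refine ext_inner_right ℝ fun e => ?_
    have h1 : ∀ {K : Euc N → Euc N}, LocallyIntegrable K →
        inner ℝ (∫ x, φ x • K x) e = ∫ x, inner ℝ (K x) e * φ x := by
      intro K hK
      rw [real_inner_comm, ← integral_inner (hi hK)]
      refine integral_congr_ae (Eventually.of_forall fun x => ?_)
      simp only [inner_smul_right, real_inner_comm e]
      ring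
    rw [h1 hloc, inner_zero_left]
    have h2 := hG.2.2 φ hφ hφc e
    have h3 := hH.2.2 φ hφ hφc e
    have h4 : ∫ x, inner ℝ (G x) e * φ x = ∫ x, inner ℝ (H x) e * φ x := by linarith
    have h5 : ∀ {K : Euc N → Euc N}, LocallyIntegrable K →
        Integrable (fun x => inner ℝ (K x) e * φ x) := by
      intro K hK
      refine ((hi hK).inner_const (𝕜 := ℝ) e).congr (Eventually.of_forall fun x => ?_)
      simp only [inner_smul_left, conj_trivial]
      ring
    rw [← sub_eq_zero, ← integral_sub (h5 hG.2.1) (h5 hH.2.1)] at h4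
    rw [← h4]
    refine integral_congr_ae (Eventually.of_forall fun x => ?_)
    simp only [inner_sub_left]
    ring
  filter_upwards [key] with x hx using sub_eq_zero.mp hx

open Classical in
/-- The weak gradient `∇u` (well defined almost everywhere; `0` if there is none). -/
def weakGrad {N : ℕ} (u : Euc N → ℝ) : Euc N → Euc N :=
  if h : ∃ G, IsWeakGrad u G then h.choose else 0

/-- `u ∈ H¹(ℝ^N)`. -/
def MemH1 {N : ℕ} (u : Euc N → ℝ) : Prop :=
  MemLp u 2 volume ∧ ∃ G, IsWeakGrad u G ∧ MemLp G 2 volume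

/-- `u ∈ X`, i.e. `u ∈ H¹(ℝ^N)` and `∫ V u² < ∞`. -/
def MemX {N : ℕ} (V : Euc N → ℝ) (u : Euc N → ℝ) : Prop :=
  MemH1 u ∧ Integrable (fun x => V x * u x ^ 2)

/-- `‖u‖_X = (∫ |∇u|² + ∫ V u²)^{1/2}`. -/
def normX {N : ℕ} (V : Euc N → ℝ) (u : Euc N → ℝ) : ℝ :=
  Real.sqrt ((∫ x, ‖weakGrad u x‖ ^ 2) + ∫ x, V x * u x ^ 2)

/-- The critical Sobolev exponent `2^* = 2N/(N-2)`. -/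
def twoStar (N : ℕ) : ℝ := 2 * N / (N - 2)

/-- The best Sobolev constant: the infimum of `∫ |∇φ|² / (∫ |φ|^{2^*})^{2/2^*}` over
`0 ≠ φ ∈ C_c^∞(ℝ^N)`. -/
def sobolevConst (N : ℕ) : ℝ :=
  sInf {r : ℝ | ∃ φ : Euc N → ℝ, ContDiff ℝ ∞ φ ∧ HasCompactSupport φ ∧ φ ≠ 0 ∧
    r = (∫ x, ‖gradient φ x‖ ^ 2) / (∫ x, |φ x| ^ twoStar N) ^ (2 / twoStar N)}

/-! ### The change of variables `f` -/

/-- The inverse `u ↦ ∫₀ᵘ (1 + m|s|^{2(m-1)})^{1/2} ds` of the change of variables. -/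
def changeVarInv (m u : ℝ) : ℝ :=
  ∫ s in (0 : ℝ)..u, Real.sqrt (1 + m * |s| ^ (2 * (m - 1)))

/-- The change of variables `f`. By `changeVar_spec` and `changeVar_unique` it is, for `m > 1`,
the unique function with `f(0) = 0`, `f' = (1 + m|f|^{2(m-1)})^{-1/2}` on `[0,∞)`, `f` odd. -/
def changeVar (m : ℝ) : ℝ → ℝ := Function.invFun (changeVarInv m)

/-- The defining properties of the change of variables. -/
def IsChangeVar (m : ℝ) (f : ℝ → ℝ) : Prop :=
  f 0 = 0 ∧
  (∀ v, 0 ≤ v → HasDerivWithinAt f ((1 + m * |f v| ^ (2 * (m - 1))) ^ (-(1 / 2) : ℝ))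
    (Set.Ici 0) v) ∧
  ∀ v, v ≤ 0 → f v = -f (-v)

theorem continuous_weight {m : ℝ} (hm : 1 < m) :
    Continuous fun s : ℝ => Real.sqrt (1 + m * |s| ^ (2 * (m - 1))) := by
  have : Continuous fun s : ℝ => |s| ^ (2 * (m - 1)) :=
    continuous_abs.rpow_const fun _ => Or.inr (by linarith)
  fun_prop

theorem one_le_weight {m : ℝ} (hm : 1 < m) (s : ℝ) :
    1 ≤ Real.sqrt (1 + m * |s| ^ (2 * (m - 1))) := by
  rw [Real.one_le_sqrt]
  have : 0 ≤ |s| ^ (2 * (m - 1)) := Real.rpow_nonneg (abs_nonneg s) _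
  nlinarith

theorem hasDerivAt_changeVarInv {m : ℝ} (hm : 1 < m) (u : ℝ) :
    HasDerivAt (changeVarInv m) (Real.sqrt (1 + m * |u| ^ (2 * (m - 1)))) u :=
  (continuous_weight hm).integral_hasStrictDerivAt 0 u |>.hasDerivAt

theorem strictMono_changeVarInv {m : ℝ} (hm : 1 < m) : StrictMono (changeVarInv m) := by
  refine strictMono_of_deriv_pos fun u => ?_
  rw [(hasDerivAt_changeVarInv hm u).deriv]
  linarith [one_le_weight hm u]

theorem surjective_changeVarInv {m : ℝ} (hm : 1 < m) :
    Function.Surjective (changeVarInv m) := by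
  have hmono : Monotone fun u => changeVarInv m u - u := by
    refine monotone_of_deriv_nonneg
      (fun u => ((hasDerivAt_changeVarInv hm u).sub (hasDerivAt_id u)).differentiableAt)
      fun u => ?_
    have h := ((hasDerivAt_changeVarInv hm u).sub (hasDerivAt_id u)).deriv
    have h' : deriv (fun u => changeVarInv m u - u) u = _ := h
    rw [h']
    linarith [one_le_weight hm u]
  have h0 : changeVarInv m 0 = 0 := by simp [changeVarInv]
  refine Continuous.surjective
    (continuous_iff_continuousAt.mpr fun u => (hasDerivAt_changeVarInv hm u).continuousAt) ?_ ?_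
  · refine tendsto_atTop_mono' _ ?_ tendsto_id
    filter_upwards [eventually_ge_atTop (0 : ℝ)] with u hu
    have := hmono hu
    simp only [h0] at this
    simp only [id]
    linarith
  · refine tendsto_atBot_mono' _ ?_ tendsto_id
    filter_upwards [eventually_le_atBot (0 : ℝ)] with u hu
    have := hmono hu
    simp only [h0] at this
    simp only [id]
    linarith

theorem changeVar_changeVarInv {m : ℝ} (hm : 1 < m) (u : ℝ) :
    changeVar m (changeVarInv m u) = u :=
  Function.leftInverse_invFun (strictMono_changeVarInv hm).injective u

theorem changeVarInv_changeVar {m : ℝ} (hm : 1 < m) (v : ℝ) :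
    changeVarInv m (changeVar m v) = v :=
  Function.rightInverse_invFun (surjective_changeVarInv hm) v

theorem changeVarInv_neg (m u : ℝ) : changeVarInv m (-u) = -changeVarInv m u := by
  have h := intervalIntegral.integral_comp_neg (a := 0) (b := u)
    (fun s : ℝ => Real.sqrt (1 + m * |s| ^ (2 * (m - 1))))
  simp only [abs_neg, neg_zero] at h
  rw [changeVarInv, changeVarInv, h, intervalIntegral.integral_symm]

theorem continuous_changeVar {m : ℝ} (hm : 1 < m) : Continuous (changeVar m) := by
  have h : changeVar m = ((strictMono_changeVarInv hm).orderIsoOfSurjective _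
      (surjective_changeVarInv hm)).symm := by
    funext v
    refine (strictMono_changeVarInv hm).injective ?_
    rw [changeVarInv_changeVar hm]
    exact (((strictMono_changeVarInv hm).orderIsoOfSurjective _
      (surjective_changeVarInv hm)).apply_symm_apply v).symm
  rw [h]
  exact OrderIso.continuous _

theorem weight_inv {m : ℝ} (hm : 1 < m) (s : ℝ) :
    (Real.sqrt (1 + m * |s| ^ (2 * (m - 1))))⁻¹ =
      (1 + m * |s| ^ (2 * (m - 1))) ^ (-(1 / 2) : ℝ) := by
  have : 0 ≤ |s| ^ (2 * (m - 1)) := Real.rpow_nonneg (abs_nonneg s) _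
  rw [Real.rpow_neg (by nlinarith), Real.sqrt_eq_rpow]

theorem hasDerivAt_changeVar {m : ℝ} (hm : 1 < m) (v : ℝ) :
    HasDerivAt (changeVar m) ((1 + m * |changeVar m v| ^ (2 * (m - 1))) ^ (-(1 / 2) : ℝ)) v := by
  rw [← weight_inv hm]
  refine HasDerivAt.of_local_left_inverse (continuous_changeVar hm).continuousAt
    (hasDerivAt_changeVarInv hm _) ?_
    (Eventually.of_forall fun v => changeVarInv_changeVar hm v)
  linarith [one_le_weight hm (changeVar m v)]

theorem changeVar_spec {m : ℝ} (hm : 1 < m) : IsChangeVar m (changeVar m) := by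
  refine ⟨?_, fun v _ => (hasDerivAt_changeVar hm v).hasDerivWithinAt, fun v _ => ?_⟩
  · have h0 : changeVarInv m 0 = 0 := by simp [changeVarInv]
    have := changeVar_changeVarInv hm 0
    rwa [h0] at this
  · refine (strictMono_changeVarInv hm).injective ?_
    rw [changeVarInv_neg, changeVarInv_changeVar hm, changeVarInv_changeVar hm, neg_neg]

theorem changeVar_unique {m : ℝ} (hm : 1 < m) {f : ℝ → ℝ} (hf : IsChangeVar m f) :
    f = changeVar m := by
  have hpos : ∀ v, 0 ≤ v → changeVarInv m (f v) = v := by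
    intro v hv
    have hd : ∀ x, 0 ≤ x → HasDerivWithinAt (fun x => changeVarInv m (f x)) 1 (Set.Ici 0) x := by
      intro x hx
      have h := (hasDerivAt_changeVarInv hm (f x)).comp_hasDerivWithinAt x (hf.2.1 x hx)
      rw [← weight_inv hm, mul_inv_cancel₀ (by linarith [one_le_weight hm (f x)])] at h
      exact h
    have h := eq_of_has_deriv_right_eq (a := 0) (b := v) (f := fun x => changeVarInv m (f x))
      (g := fun x => x) (f' := fun _ => 1)
      (fun x hx => (hd x hx.1).mono (Set.Ici_subset_Ici.mpr hx.1))
      (fun x _ => hasDerivWithinAt_id x _)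
      (fun x hx => ((hd x hx.1).continuousWithinAt).mono Set.Icc_subset_Ici_self)
      continuousOn_id (by simp [hf.1, changeVarInv])
    exact h v ⟨hv, le_rfl⟩
  funext v
  refine (strictMono_changeVarInv hm).injective ?_
  rw [changeVarInv_changeVar hm]
  rcases le_total 0 v with hv | hv
  · exact hpos v hv
  · rw [hf.2.2 v hv, changeVarInv_neg, hpos (-v) (by linarith), neg_neg]

/-! ### The penalized nonlinearity and the modified functional -/

/-- `g(t) = λ|t|^{q-2} t + |t|^{2^* m - 2} t`. -/
def gFun (N : ℕ) (m q lam t : ℝ) : ℝ :=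
  lam * |t| ^ (q - 2) * t + |t| ^ (twoStar N * m - 2) * t

/-- `l = sup {s > 0 : g(t)/t ≤ V₀/κ for every 0 ≤ t ≤ s}` (at `t = 0` the quotient is read
as its limit `0`, which is also the value of `0 / 0` here). -/
def cutLevel (N : ℕ) (m q lam V₀ κ : ℝ) : ℝ :=
  sSup {s : ℝ | 0 < s ∧ ∀ t, 0 ≤ t → t ≤ s → gFun N m q lam t / t ≤ V₀ / κ}

/-- `γ(s) = g(s)` for `s > 0` and `γ(s) = 0` for `s ≤ 0`. -/
def gammaFun (N : ℕ) (m q lam s : ℝ) : ℝ :=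
  if 0 < s then gFun N m q lam s else 0

/-- `γ̄(s) = γ(s)` for `s ≤ l` and `γ̄(s) = (V₀/κ) s` for `s > l`. -/
def gammaBar (N : ℕ) (m q lam V₀ κ s : ℝ) : ℝ :=
  if s ≤ cutLevel N m q lam V₀ κ then gammaFun N m q lam s else V₀ / κ * s

open Classical in
/-- `p(x,s) = χ_R(x) γ(s) + (1 - χ_R(x)) γ̄(s)`, `χ_R` the characteristic function of `B_R`. -/
def pFun {N : ℕ} (m q lam V₀ κ R : ℝ) (x : Euc N) (s : ℝ) : ℝ :=
  if x ∈ Metric.ball (0 : Euc N) R then gammaFun N m q lam s else gammaBar N m q lam V₀ κ s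

/-- `P(x,s) = ∫₀ˢ p(x,t) dt`. -/
def PFun {N : ℕ} (m q lam V₀ κ R : ℝ) (x : Euc N) (s : ℝ) : ℝ :=
  ∫ t in (0 : ℝ)..s, pFun m q lam V₀ κ R x t

/-- The modified functional
`J̄(v) = (ε²/2) ∫ |∇v|² + (1/2) ∫ V f(v)² - ∫ P(x, f(v))`. -/
def Jbar {N : ℕ} (V : Euc N → ℝ) (ε m q lam V₀ κ R : ℝ) (v : Euc N → ℝ) : ℝ :=
  ε ^ 2 / 2 * (∫ x, ‖weakGrad v x‖ ^ 2) + 1 / 2 * (∫ x, V x * changeVar m (v x) ^ 2)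
    - ∫ x, PFun m q lam V₀ κ R x (changeVar m (v x))

/-! ### The Palais–Smale condition -/

/-- `(v_n) ⊂ X` is a Palais–Smale sequence of `J` at level `c`: `J(v_n) → c` and the Gateaux
derivatives `L_n = J'(v_n)` tend to `0` in the dual of `X`, i.e. `|⟨J'(v_n), φ⟩| ≤ δ_n ‖φ‖_X`
for all `φ ∈ X`, with `δ_n → 0`. -/
def IsPSSeq {N : ℕ} (V : Euc N → ℝ) (J : (Euc N → ℝ) → ℝ) (c : ℝ) (v : ℕ → Euc N → ℝ) : Prop :=
  (∀ n, MemX V (v n)) ∧ Tendsto (fun n => J (v n)) atTop (𝓝 c) ∧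
    ∃ (L : ℕ → (Euc N → ℝ) → ℝ) (δ : ℕ → ℝ), Tendsto δ atTop (𝓝 0) ∧
      ∀ n φ, MemX V φ →
        HasDerivAt (fun t : ℝ => J (v n + t • φ)) (L n φ) 0 ∧ |L n φ| ≤ δ n * normX V φ

/-- `J` satisfies the Palais–Smale condition at level `c`: every Palais–Smale sequence at level
`c` has a subsequence that converges in the norm of `X` to an element of `X`. -/
def SatisfiesPS {N : ℕ} (V : Euc N → ℝ) (J : (Euc N → ℝ) → ℝ) (c : ℝ) : Prop :=
  ∀ v : ℕ → Euc N → ℝ, IsPSSeq V J c v →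
    ∃ (w : Euc N → ℝ) (σ : ℕ → ℕ), MemX V w ∧ StrictMono σ ∧
      Tendsto (fun n => normX V (v (σ n) - w)) atTop (𝓝 0)

/-- `V` is locally Hölder continuous. -/
def LocallyHolder {N : ℕ} (V : Euc N → ℝ) : Prop :=
  ∀ x, ∃ (C a : NNReal) (U : Set (Euc N)), 0 < a ∧ a ≤ 1 ∧ U ∈ 𝓝 x ∧ HolderOnWith C a V U

/-- Condition (V): `min V = V₀`, `lim_{|x| → ∞} V = V_∞` and `V_∞ > V₀ > 0`. -/
def CondV {N : ℕ} (V : Euc N → ℝ) (V₀ Vinf : ℝ) : Prop :=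
  0 < V₀ ∧ V₀ < Vinf ∧ IsLeast (Set.range V) V₀ ∧ Tendsto V (cocompact (Euc N)) (𝓝 Vinf)

end QuasiSchrodinger

end

open MeasureTheory Filter
open scoped Topology ContDiff

noncomputable section

namespace QuasiSchrodinger

/-! Write f for `changeVar m`, 2* for `twoStar N`, k for `κ`. Since f(v)^(2*m) grows like |v|^(2*),
a Palais–Smale sequence may lose compactness by concentration inside the ball or by loss of mass
outside it. Both are excluded together, using only two test directions, with no concentration
measures and no cut-off at infinity.

Boundedness. The direction φ = f(v)/f'(v) satisfies f'(v)φ = f(v), and f/f' has derivative in [1,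
m]. Hence J̄(v) − (1/θ) J̄'(v)φ dominates positive multiples of ∫|∇v|² and ∫V f(v)²
(`energy_estimate`); positivity of the coefficients is θ > 2m and k > θ/(θ−2). As f grows
sublinearly, ∫v² is recovered from min(|v|, 1) ≤ 2|f(v)| where v is small and from the Sobolev
inequality where it is large (`integral_sq_le`). The norm is then at most linear in the energy, so
the o(1)‖v_n‖ remainder is absorbed (`eventually_bounded`). Weak compactness and Rellich give w with
v_n → w almost everywhere and ∇v_n ⇀ ∇w (`exists_boundedConv_subseq`).

Measuring the loss. Put z_n = v_n − w and, along a subsequence, let a be the limit of ∫|∇z_n|², X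
the limit of the integral of `outTerm`(v_n) v_n outside the ball, Y its value at w, and Z the limit
of the integral over the ball of γ(f(v_n)) f'(v_n) z_n. Testing J̄'(v_n) with z_n gives Z = ε²a + X
− Y (`BoundedConv.tendsto_critTerm_sub`). Outside the ball the penalization makes `outTerm`(s) s
nonnegative, so Fatou gives Y ≤ X and hence ε²a ≤ Z. Two more relations close the argument. The
sharp growth f^(2*m−1) f' ≤ m^(2*/2−1) v^(2*−1) and the Sobolev inequality give Z ≤ m^(2*/2−1)
(a/S)^(2*/2) (`BoundedConv.exists_critTerm_sub_le`). The energy gives (1/2 − m/θ) ε²a + (1/θ −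
1/(2*m)) m Z ≤ c (`BoundedConv.energy_limit`).

If a > 0, the first two force m ε²a ≥ ε^N S^(N/2); in the third θ cancels, since m/θ occurs with
both signs, and c ≥ ε²a/N ≥ ε^N S^(N/2)/(Nm), a contradiction (`gradient_loss_eq_zero`). So a = 0,
whence Z ≤ 0 and X = Y. Convergence of the coercive outside integral then gives convergence of v_n
in L² (`tendsto_normX_sub`).

Nearly every passage to the limit is Fatou or one Vitali type lemma,
`tendsto_integral_abs_of_almost_dominated`. It needs only domination up to a small multiple of an L¹
bounded sequence, which is what critical growth allows. -/

/-! ### Convergence of integrals -/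

section Convergence

variable {α : Type*} [MeasurableSpace α] {μ : Measure α}

/-- A Vitali type convergence theorem: a sequence tending to `0` almost everywhere which, up to an
arbitrarily small multiple of a sequence bounded in `L¹`, is dominated, tends to `0` in `L¹`. -/
theorem tendsto_integral_abs_of_almost_dominated {F D : ℕ → α → ℝ} {M : ℝ}
    (hF : ∀ n, AEStronglyMeasurable (F n) μ) (hD : ∀ n, Integrable (D n) μ)
    (hD0 : ∀ n x, 0 ≤ D n x) (hM : ∀ n, ∫ x, D n x ∂μ ≤ M)
    (hlim : ∀ᵐ x ∂μ, Tendsto (fun n => F n x) atTop (𝓝 0))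
    (hdom : ∀ η > 0, ∃ G : α → ℝ, Integrable G μ ∧
      ∀ n, ∀ᵐ x ∂μ, |F n x| ≤ G x + η * D n x) :
    Tendsto (fun n => ∫ x, |F n x| ∂μ) atTop (𝓝 0) := by
  have hFi : ∀ n, Integrable (F n) μ := by
    intro n
    obtain ⟨G, hG, h⟩ := hdom 1 one_pos
    refine Integrable.mono' (hG.add ((hD n).const_mul 1)) (hF n) ?_
    filter_upwards [h n] with x hx using by simpa using hx
  rw [Metric.tendsto_atTop]
  intro δ hδ
  set η := δ / (2 * (|M| + 1)) with hη
  have hη0 : 0 < η := by positivity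
  obtain ⟨G, hG, h⟩ := hdom η hη0
  -- The excess of |F n| over η D n is dominated by |G|, so dominated convergence applies to it.
  -- What remains has integral at most η|M|, and η was chosen to make this less than δ/2.
  have hK : Tendsto (fun n => ∫ x, max (|F n x| - η * D n x) 0 ∂μ) atTop (𝓝 (∫ _, (0 : ℝ) ∂μ)) := by
    refine tendsto_integral_of_dominated_convergence (fun x => |G x|) ?_ hG.abs ?_ ?_
    · intro n
      exact ((hFi n).abs.sub ((hD n).const_mul η)).pos_part.aestronglyMeasurable
    · intro n
      filter_upwards [h n] with x hx
      rw [Real.norm_eq_abs, abs_of_nonneg (le_max_right _ _)]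
      exact max_le (by linarith [le_abs_self (G x)]) (abs_nonneg _)
    · filter_upwards [hlim] with x hx
      have h1 : Tendsto (fun n => |F n x|) atTop (𝓝 0) := by simpa using hx.abs
      refine squeeze_zero (fun n => le_max_right _ _) (fun n => ?_) h1
      exact max_le (by linarith [mul_nonneg hη0.le (hD0 n x)]) (abs_nonneg _)
  rw [integral_zero, Metric.tendsto_atTop] at hK
  obtain ⟨n₀, hn₀⟩ := hK (δ / 2) (by positivity)
  refine ⟨n₀, fun n hn => ?_⟩
  have h1 := hn₀ n hn
  rw [Real.dist_eq, sub_zero] at h1 ⊢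
  rw [abs_of_nonneg (integral_nonneg fun x => abs_nonneg _)]
  have h2 : ∫ x, |F n x| ∂μ ≤ (∫ x, max (|F n x| - η * D n x) 0 ∂μ) + η * ∫ x, D n x ∂μ := by
    rw [← integral_const_mul, ← integral_add _ ((hD n).const_mul η)]
    · refine integral_mono (hFi n).abs
        (((hFi n).abs.sub ((hD n).const_mul η)).pos_part.add ((hD n).const_mul η)) fun x => ?_
      have := le_max_left (|F n x| - η * D n x) 0
      linarith
    · exact ((hFi n).abs.sub ((hD n).const_mul η)).pos_part
  have h3 : η * ∫ x, D n x ∂μ < δ / 2 := by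
    have : η * ∫ x, D n x ∂μ ≤ η * |M| :=
      mul_le_mul_of_nonneg_left ((hM n).trans (le_abs_self M)) hη0.le
    refine this.trans_lt ?_
    rw [hη, div_mul_eq_mul_div, div_lt_div_iff₀ (by positivity) two_pos]
    nlinarith [abs_nonneg M]
  linarith [le_abs_self (∫ x, max (|F n x| - η * D n x) 0 ∂μ)]

theorem tendsto_integral_of_almost_dominated {F D : ℕ → α → ℝ} {f : α → ℝ} {M : ℝ}
    (hF : ∀ n, AEStronglyMeasurable (F n) μ) (hf : Integrable f μ) (hD : ∀ n, Integrable (D n) μ)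
    (hD0 : ∀ n x, 0 ≤ D n x) (hM : ∀ n, ∫ x, D n x ∂μ ≤ M)
    (hlim : ∀ᵐ x ∂μ, Tendsto (fun n => F n x) atTop (𝓝 (f x)))
    (hdom : ∀ η > 0, ∃ G : α → ℝ, Integrable G μ ∧
      ∀ n, ∀ᵐ x ∂μ, |F n x| ≤ G x + η * D n x) :
    Tendsto (fun n => ∫ x, F n x ∂μ) atTop (𝓝 (∫ x, f x ∂μ)) := by
  have hFi : ∀ n, Integrable (F n) μ := by
    intro n
    obtain ⟨G, hG, h⟩ := hdom 1 one_pos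
    refine Integrable.mono' (hG.add ((hD n).const_mul 1)) (hF n) ?_
    filter_upwards [h n] with x hx using by simpa using hx
  have h := tendsto_integral_abs_of_almost_dominated (F := fun n x => F n x - f x) (D := D) (M := M)
    (μ := μ) (fun n => (hF n).sub hf.aestronglyMeasurable) hD hD0 hM ?_ ?_
  · rw [tendsto_iff_norm_sub_tendsto_zero]
    refine squeeze_zero (fun n => norm_nonneg _) (fun n => ?_) h
    rw [← integral_sub (hFi n) hf]
    exact norm_integral_le_integral_norm _
  · filter_upwards [hlim] with x hx
    simpa using hx.sub_const (f x)
  · intro η hη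
    obtain ⟨G, hG, h⟩ := hdom η hη
    refine ⟨fun x => G x + |f x|, hG.add hf.abs, fun n => ?_⟩
    filter_upwards [h n] with x hx
    have := abs_sub (F n x) (f x)
    linarith

/-- Fatou's lemma for Bochner integrals of nonnegative functions. -/
theorem integrable_and_integral_le_of_tendsto {F : ℕ → α → ℝ} {f : α → ℝ} {a : ℕ → ℝ} {A : ℝ}
    (hF : ∀ n, Integrable (F n) μ) (h0 : ∀ n, ∀ᵐ x ∂μ, 0 ≤ F n x)
    (hlim : ∀ᵐ x ∂μ, Tendsto (fun n => F n x) atTop (𝓝 (f x)))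
    (ha : ∀ n, ∫ x, F n x ∂μ ≤ a n) (haA : Tendsto a atTop (𝓝 A)) :
    Integrable f μ ∧ ∫ x, f x ∂μ ≤ A := by
  have hfm : AEStronglyMeasurable f μ :=
    aestronglyMeasurable_of_tendsto_ae atTop (fun n => (hF n).aestronglyMeasurable) hlim
  have hf0 : ∀ᵐ x ∂μ, 0 ≤ f x := by
    filter_upwards [hlim, ae_all_iff.2 h0] with x hx hx0
    exact ge_of_tendsto' hx hx0
  have hA : 0 ≤ A := ge_of_tendsto' haA fun n => (integral_nonneg_of_ae (h0 n)).trans (ha n)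
  have key : ∫⁻ x, ENNReal.ofReal (f x) ∂μ ≤ ENNReal.ofReal A := by
    calc ∫⁻ x, ENNReal.ofReal (f x) ∂μ
        = ∫⁻ x, liminf (fun n => ENNReal.ofReal (F n x)) atTop ∂μ := by
          refine lintegral_congr_ae ?_
          filter_upwards [hlim] with x hx
          exact ((ENNReal.continuous_ofReal.tendsto _).comp hx).liminf_eq.symm
      _ ≤ liminf (fun n => ∫⁻ x, ENNReal.ofReal (F n x) ∂μ) atTop :=
          lintegral_liminf_le' fun n => (hF n).aestronglyMeasurable.aemeasurable.ennreal_ofReal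
      _ ≤ liminf (fun n => ENNReal.ofReal (a n)) atTop := by
          refine liminf_le_liminf (Eventually.of_forall fun n => ?_)
          rw [← ofReal_integral_eq_lintegral_ofReal (hF n) (h0 n)]
          exact ENNReal.ofReal_le_ofReal (ha n)
      _ = ENNReal.ofReal A := ((ENNReal.continuous_ofReal.tendsto _).comp haA).liminf_eq
  refine ⟨⟨hfm, ?_⟩, ?_⟩
  · rw [hasFiniteIntegral_iff_ofReal hf0]
    exact key.trans_lt ENNReal.ofReal_lt_top
  · rw [integral_eq_lintegral_of_nonneg_ae hf0 hfm]
    exact ENNReal.toReal_le_of_le_ofReal hA key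

/-- Dominated convergence to `0` with a convergent sequence of dominating functions. -/
theorem tendsto_integral_zero_of_tendsto_dominating {F D : ℕ → α → ℝ} {d : α → ℝ}
    (hF : ∀ n, AEStronglyMeasurable (F n) μ) (hF0 : ∀ n, ∀ᵐ x ∂μ, 0 ≤ F n x)
    (hFD : ∀ n, ∀ᵐ x ∂μ, F n x ≤ D n x)
    (hD : ∀ n, Integrable (D n) μ) (hd : Integrable d μ)
    (hFlim : ∀ᵐ x ∂μ, Tendsto (fun n => F n x) atTop (𝓝 0))
    (hDlim : ∀ᵐ x ∂μ, Tendsto (fun n => D n x) atTop (𝓝 (d x)))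
    (hint : Tendsto (fun n => ∫ x, D n x ∂μ) atTop (𝓝 (∫ x, d x ∂μ))) :
    Tendsto (fun n => ∫ x, F n x ∂μ) atTop (𝓝 0) := by
  have hFi : ∀ n, Integrable (F n) μ := by
    intro n
    refine Integrable.mono' (hD n) (hF n) ?_
    filter_upwards [hF0 n, hFD n] with x h0 h1
    rwa [Real.norm_eq_abs, abs_of_nonneg h0]
  have hd0 : ∀ᵐ x ∂μ, 0 ≤ d x := by
    filter_upwards [ae_all_iff.2 hF0, ae_all_iff.2 hFD, hDlim] with x h0 h1 h2
    exact ge_of_tendsto' h2 fun n => (h0 n).trans (h1 n)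
  have h1 : Tendsto (fun n => ∫ x, max (d x - D n x) 0 ∂μ) atTop (𝓝 (∫ _, (0 : ℝ) ∂μ)) := by
    refine tendsto_integral_of_dominated_convergence d
      (fun n => (hd.sub (hD n)).pos_part.aestronglyMeasurable) hd ?_ ?_
    · intro n
      filter_upwards [hd0, hF0 n, hFD n] with x h0 h1 h2
      rw [Real.norm_eq_abs, abs_of_nonneg (le_max_right _ _)]
      exact max_le (by linarith) h0
    · filter_upwards [hDlim] with x hx
      have : Tendsto (fun n => max (d x - D n x) 0) atTop (𝓝 (max (d x - d x) 0)) :=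
        (hx.const_sub (d x)).max tendsto_const_nhds
      simpa using this
  have h2 : Tendsto (fun n => ∫ x, min (F n x) (d x) ∂μ) atTop (𝓝 (∫ _, (0 : ℝ) ∂μ)) := by
    refine tendsto_integral_of_dominated_convergence d
      (fun n => ((hFi n).inf hd).aestronglyMeasurable) hd ?_ ?_
    · intro n
      filter_upwards [hd0, hF0 n] with x h0 h1
      rw [Real.norm_eq_abs, abs_of_nonneg (le_min h1 h0)]
      exact min_le_right _ _
    · filter_upwards [hFlim, hd0, ae_all_iff.2 hF0] with x hx h0 h1
      exact squeeze_zero (fun n => le_min (h1 n) h0) (fun n => min_le_left _ _) hx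
  -- Pointwise F n ≤ min (F n) d + (D n − d) + (d − D n)⁺: the last two terms add up to (D n − d)⁺,
  -- which covers both F n ≤ d and d ≤ F n ≤ D n. The integrals of all three tend to 0, the middle
  -- one by hypothesis.
  have h3 : Tendsto (fun n => (∫ x, min (F n x) (d x) ∂μ) + ((∫ x, D n x ∂μ) - (∫ x, d x ∂μ)
      + ∫ x, max (d x - D n x) 0 ∂μ)) atTop (𝓝 0) := by
    have := h2.add ((hint.sub_const (∫ x, d x ∂μ)).add h1)
    simpa using this
  refine squeeze_zero (fun n => integral_nonneg_of_ae (hF0 n)) (fun n => ?_) h3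
  have hmin : Integrable (fun x => min (F n x) (d x)) μ := (hFi n).inf hd
  have hmax : Integrable (fun x => max (d x - D n x) 0) μ := (hd.sub (hD n)).pos_part
  have hsub : Integrable (fun x => D n x - d x) μ := (hD n).sub hd
  have hsum : Integrable (fun x => D n x - d x + max (d x - D n x) 0) μ := hsub.add hmax
  rw [← integral_sub (hD n) hd, ← integral_add hsub hmax, ← integral_add hmin hsum]
  refine integral_mono_ae (hFi n) (hmin.add hsum) ?_
  filter_upwards [hFD n] with x hx
  rcases le_total (F n x) (d x) with h | h
  · rw [min_eq_left h]
    linarith [le_max_left (d x - D n x) 0]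
  · rw [min_eq_right h]
    linarith [le_max_right (d x - D n x) 0]

end Convergence

/-! ### Mollification -/

section Mollify

open scoped Convolution

variable {N : ℕ} {F : Type*} [NormedAddCommGroup F] [NormedSpace ℝ F]

/-- A bump function supported in the ball of radius `2 / (k + 1)`. -/
def mollBump (N k : ℕ) : ContDiffBump (0 : Euc N) where
  rIn := 1 / (k + 1)
  rOut := 2 / (k + 1)
  rIn_pos := by positivity
  rIn_lt_rOut := by
    have : (0 : ℝ) < k + 1 := by positivity
    gcongr
    norm_num

/-- The mollifier of scale `2 / (k + 1)`. -/
def mollifier (N k : ℕ) : Euc N → ℝ := (mollBump N k).normed volume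

/-- The mollification `η_k * u`. -/
def mollify (k : ℕ) (u : Euc N → F) : Euc N → F :=
  mollifier N k ⋆[ContinuousLinearMap.lsmul ℝ ℝ, volume] u

/-- The probability measure with density the mollifier. -/
def mollMeasure (N k : ℕ) : Measure (Euc N) :=
  volume.withDensity fun x => ENNReal.ofReal (mollifier N k x)

theorem mollifier_nonneg (k : ℕ) (x : Euc N) : 0 ≤ mollifier N k x :=
  (mollBump N k).nonneg_normed x

theorem contDiff_mollifier (k : ℕ) : ContDiff ℝ ∞ (mollifier N k) :=
  (mollBump N k).contDiff_normed (n := ⊤)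

theorem hasCompactSupport_mollifier (k : ℕ) : HasCompactSupport (mollifier N k) :=
  (mollBump N k).hasCompactSupport_normed

theorem mollifier_eq_zero {k : ℕ} {x : Euc N} (hx : 2 / ((k : ℝ) + 1) ≤ ‖x‖) :
    mollifier N k x = 0 := by
  have h : x ∉ Function.support (mollifier N k) := by
    rw [mollifier, (mollBump N k).support_normed_eq]
    simpa [mollBump] using hx
  simpa using h

instance (k : ℕ) : IsProbabilityMeasure (mollMeasure N k) := by
  constructor
  rw [mollMeasure, withDensity_apply _ MeasurableSet.univ, Measure.restrict_univ,
    ← ofReal_integral_eq_lintegral_ofReal (f := mollifier N k) (mollBump N k).integrable_normed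
      (Eventually.of_forall (mollifier_nonneg k))]
  have : ∫ x, mollifier N k x = 1 := (mollBump N k).integral_normed
  rw [this, ENNReal.ofReal_one]

theorem ae_mollMeasure_norm_lt (k : ℕ) : ∀ᵐ t ∂(mollMeasure N k), ‖t‖ < 2 / ((k : ℝ) + 1) := by
  rw [mollMeasure, ae_withDensity_iff (contDiff_mollifier k).continuous.measurable.ennreal_ofReal]
  refine Eventually.of_forall fun x hx => ?_
  by_contra h
  exact hx (by rw [mollifier_eq_zero (not_lt.1 h), ENNReal.ofReal_zero])

theorem mollify_eq_integral (k : ℕ) (u : Euc N → F) (x : Euc N) :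
    mollify k u x = ∫ t, u (x - t) ∂(mollMeasure N k) := by
  have : mollMeasure N k = volume.withDensity fun x => ((mollifier N k x).toNNReal : ENNReal) := rfl
  rw [this, integral_withDensity_eq_integral_smul
    (contDiff_mollifier k).continuous.measurable.real_toNNReal]
  rw [mollify, convolution_lsmul]
  refine integral_congr_ae (Eventually.of_forall fun t => ?_)
  simp only [NNReal.smul_def, Real.coe_toNNReal _ (mollifier_nonneg k t)]

theorem integrable_mollMeasure (k : ℕ) {u : Euc N → F} (hu : LocallyIntegrable u) (x : Euc N) :
    Integrable (fun t => u (x - t)) (mollMeasure N k) := by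
  have : mollMeasure N k = volume.withDensity fun x => ((mollifier N k x).toNNReal : ENNReal) := rfl
  rw [this, integrable_withDensity_iff_integrable_smul
    (contDiff_mollifier k).continuous.measurable.real_toNNReal]
  have h := (hasCompactSupport_mollifier (N := N) k).convolutionExists_left
    (ContinuousLinearMap.lsmul ℝ ℝ) (contDiff_mollifier k).continuous hu x
  refine h.integrable.congr (Eventually.of_forall fun t => ?_)
  simp [NNReal.smul_def, Real.coe_toNNReal _ (mollifier_nonneg k t)]

/-- Jensen on a probability space (the L¹ norm is at most the L² norm), then Tonelli. It is applied
with ν the mollifying measure and with ν uniform on (0, 1]. Tonelli requires joint measurability, so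
callers first pass to strongly measurable representatives where needed. -/
theorem lintegral_enorm_integral_sq_le {β : Type*} [MeasurableSpace β] {ν : Measure β}
    [IsProbabilityMeasure ν] {h : Euc N → β → F} (hh : StronglyMeasurable (Function.uncurry h)) :
    ∫⁻ x, ‖∫ t, h x t ∂ν‖ₑ ^ 2 ≤ ∫⁻ t, ∫⁻ x, ‖h x t‖ₑ ^ 2 ∂volume ∂ν := by
  rw [← lintegral_lintegral_swap (f := fun x t => ‖h x t‖ₑ ^ 2)
    ((hh.enorm.pow_const 2).aemeasurable)]
  refine lintegral_mono fun x => ?_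
  have h1 : ‖∫ t, h x t ∂ν‖ₑ ≤ eLpNorm (h x) 1 ν := by
    rw [eLpNorm_one_eq_lintegral_enorm]
    exact enorm_integral_le_lintegral_enorm _
  have h2 : eLpNorm (h x) 1 ν ≤ eLpNorm (h x) 2 ν :=
    eLpNorm_le_eLpNorm_of_exponent_le (by norm_num)
      (hh.comp_measurable measurable_prodMk_left).aestronglyMeasurable
  have h3 : eLpNorm (h x) 2 ν ^ 2 = ∫⁻ t, ‖h x t‖ₑ ^ 2 ∂ν := by
    rw [eLpNorm_eq_lintegral_rpow_enorm_toReal (by norm_num) (by norm_num)]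
    simp only [ENNReal.toReal_ofNat, ENNReal.rpow_ofNat, one_div]
    rw [← ENNReal.rpow_natCast, ← ENNReal.rpow_mul]
    norm_num
  rw [← h3]
  exact pow_le_pow_left' (h1.trans h2) 2

theorem mollify_congr (k : ℕ) {u u' : Euc N → F} (h : u =ᵐ[volume] u') :
    mollify k u = mollify k u' :=
  convolution_congr _ EventuallyEq.rfl h

theorem lintegral_mollify_sq_le (k : ℕ) {u : Euc N → F} (hu : AEStronglyMeasurable u) :
    ∫⁻ x, ‖mollify k u x‖ₑ ^ 2 ≤ ∫⁻ x, ‖u x‖ₑ ^ 2 := by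
  have key : ∀ u : Euc N → F, StronglyMeasurable u →
      ∫⁻ x, ‖mollify k u x‖ₑ ^ 2 ≤ ∫⁻ x, ‖u x‖ₑ ^ 2 := by
    intro u hu
    simp only [mollify_eq_integral]
    refine (lintegral_enorm_integral_sq_le (h := fun x t => u (x - t))
      (hu.comp_measurable measurable_sub)).trans ?_
    refine le_of_eq ?_
    simp only [lintegral_sub_right_eq_self (fun x => ‖u x‖ₑ ^ 2)]
    simp
  rw [mollify_congr k hu.ae_eq_mk]
  refine (key _ hu.stronglyMeasurable_mk).trans (le_of_eq (lintegral_congr_ae ?_))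
  filter_upwards [hu.ae_eq_mk] with x hx
  rw [hx]

/-- A mollification is an average of translates by vectors shorter than 2/(k+1), so its L² distance
from u is at most the largest distance of such a translate. For H¹ functions this becomes an error
controlled by the gradient alone. -/
theorem lintegral_mollify_sub_sq_le [CompleteSpace F] (k : ℕ) {u : Euc N → F} (hu : LocallyIntegrable u)
    {C : ENNReal} (hC : ∀ t : Euc N, ‖t‖ < 2 / ((k : ℝ) + 1) →
      ∫⁻ x, ‖u (x - t) - u x‖ₑ ^ 2 ≤ C) :
    ∫⁻ x, ‖mollify k u x - u x‖ₑ ^ 2 ≤ C := by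
  have key : ∀ u : Euc N → F, LocallyIntegrable u → StronglyMeasurable u →
      (∀ t : Euc N, ‖t‖ < 2 / ((k : ℝ) + 1) → ∫⁻ x, ‖u (x - t) - u x‖ₑ ^ 2 ≤ C) →
      ∫⁻ x, ‖mollify k u x - u x‖ₑ ^ 2 ≤ C := by
    intro u hul hu hC
    have h1 : ∀ x, mollify k u x - u x = ∫ t, (u (x - t) - u x) ∂(mollMeasure N k) := by
      intro x
      rw [integral_sub (integrable_mollMeasure k hul x) (integrable_const _), mollify_eq_integral]
      simp
    simp only [h1]
    refine (lintegral_enorm_integral_sq_le (h := fun x t => u (x - t) - u x)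
      ((hu.comp_measurable measurable_sub).sub (hu.comp_measurable measurable_fst))).trans ?_
    calc _ ≤ ∫⁻ _, C ∂(mollMeasure N k) := by
          refine lintegral_mono_ae ?_
          filter_upwards [ae_mollMeasure_norm_lt k] with t ht using hC t ht
      _ = C := by simp
  have hm := hu.aestronglyMeasurable
  have heq := hm.ae_eq_mk
  rw [mollify_congr k heq]
  have h2 : ∫⁻ x, ‖mollify k (hm.mk u) x - u x‖ₑ ^ 2
      = ∫⁻ x, ‖mollify k (hm.mk u) x - hm.mk u x‖ₑ ^ 2 := by
    refine lintegral_congr_ae ?_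
    filter_upwards [heq] with x hx
    rw [hx]
  rw [h2]
  refine key _ (hu.congr heq) hm.stronglyMeasurable_mk fun t ht => ?_
  refine le_trans (le_of_eq ?_) (hC t ht)
  refine lintegral_congr_ae ?_
  have h3 : ∀ᵐ x : Euc N, u (x - t) = hm.mk u (x - t) :=
    (measurePreserving_sub_right volume t).quasiMeasurePreserving.ae heq
  filter_upwards [heq, h3] with x hx hx3
  rw [hx, hx3]

theorem contDiff_mollify (k : ℕ) {u : Euc N → F} (hu : LocallyIntegrable u) :
    ContDiff ℝ ∞ (mollify k u) :=
  (hasCompactSupport_mollifier k).contDiff_convolution_left (n := ⊤) _ (contDiff_mollifier k) hu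

theorem ae_tendsto_mollify [CompleteSpace F] {u : Euc N → F} (hu : LocallyIntegrable u) :
    ∀ᵐ x, Tendsto (fun k => mollify k u x) atTop (𝓝 (u x)) := by
  refine ContDiffBump.ae_convolution_tendsto_right_of_locallyIntegrable (K := 2) ?_ ?_ hu
  · have := (tendsto_one_div_add_atTop_nhds_zero_nat (𝕜 := ℝ)).const_mul 2
    simpa [mollBump, div_eq_mul_inv] using this
  · refine Eventually.of_forall fun k => ?_
    simp [mollBump, div_eq_mul_inv]

/-- The gradient of a mollification is the mollification of the weak gradient. -/
theorem IsWeakGrad.hasGradientAt_mollify {u : Euc N → ℝ} {G : Euc N → Euc N}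
    (h : IsWeakGrad u G) (k : ℕ) (x : Euc N) :
    HasGradientAt (mollify k u) (mollify k G x) x := by
  have hd := (hasCompactSupport_mollifier k).hasFDerivAt_convolution_left
    (ContinuousLinearMap.lsmul ℝ ℝ) ((contDiff_mollifier k).of_le (by simp)) h.1 x
  rw [hasGradientAt_iff_hasFDerivAt]
  convert! hd using 1
  ext e
  -- The weak formulation is tested with the reflected mollifier y ↦ η(x − y). Its derivative
  -- carries a minus sign, which cancels the one from integration by parts.
  have hφ : ContDiff ℝ ∞ fun y => mollifier N k (x - y) :=
    (contDiff_mollifier k).comp (contDiff_const.sub contDiff_id)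
  have hφc : HasCompactSupport fun y => mollifier N k (x - y) :=
    (hasCompactSupport_mollifier k).comp_homeomorph (Homeomorph.subLeft x)
  have hw := h.2.2 _ hφ hφc e
  have hfd : ∀ y, fderiv ℝ (fun y => mollifier N k (x - y)) y e
      = - fderiv ℝ (mollifier N k) (x - y) e := by
    intro y
    have h1 : HasFDerivAt (fun y : Euc N => x - y) (-ContinuousLinearMap.id ℝ (Euc N)) y := by
      exact (hasFDerivAt_id y).const_sub x
    have h2 := (((contDiff_mollifier (N := N) k).differentiable (by simp)) (x - y)).hasFDerivAt.comp
      y h1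
    rw [show (fun y => mollifier N k (x - y)) = mollifier N k ∘ fun y => x - y from rfl, h2.fderiv]
    simp
  have hint : Integrable fun y => mollifier N k (x - y) • G y :=
    h.2.1.integrable_smul_left_of_hasCompactSupport hφ.continuous hφc
  have hL : (InnerProductSpace.toDual ℝ (Euc N)) (mollify k G x) e
      = ∫ y, inner ℝ (G y) e * mollifier N k (x - y) := by
    rw [InnerProductSpace.toDual_apply_apply, mollify, convolution_lsmul_swap, real_inner_comm,
      ← integral_inner hint]
    refine integral_congr_ae (Eventually.of_forall fun y => ?_)
    simp only [inner_smul_right, real_inner_comm e]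
    ring
  have hR : (convolution (fderiv ℝ (mollifier N k)) u
      ((ContinuousLinearMap.lsmul ℝ ℝ).precompL (Euc N)) volume x) e
      = ∫ y, u y * fderiv ℝ (mollifier N k) (x - y) e := by
    rw [convolution_eq_swap]
    have hex := ((hasCompactSupport_mollifier (N := N) k).fderiv ℝ).convolutionExists_left
      ((ContinuousLinearMap.lsmul ℝ ℝ).precompL (Euc N))
      ((contDiff_mollifier k).continuous_fderiv (by simp)) h.1 x
    rw [ContinuousLinearMap.integral_apply hex.integrable_swap]
    refine integral_congr_ae (Eventually.of_forall fun y => ?_)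
    simp [ContinuousLinearMap.precompL_apply, mul_comm]
  rw [hL]
  refine Eq.trans ?_ hR.symm
  simp only [hfd, mul_neg, integral_neg, neg_inj] at hw
  exact hw.symm

end Mollify

/-! ### Approximation by test functions -/

section Approx

variable {N : ℕ} {F : Type*} [NormedAddCommGroup F]

theorem integrable_norm_sq {α : Type*} [MeasurableSpace α] {μ : Measure α} {u : α → F}
    (hu : MemLp u 2 μ) : Integrable (fun x => ‖u x‖ ^ 2) μ := by
  simpa using hu.integrable_norm_rpow (by norm_num) (by norm_num)

theorem ofReal_integral_norm_sq {α : Type*} [MeasurableSpace α] {μ : Measure α} {u : α → F}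
    (hu : MemLp u 2 μ) : ENNReal.ofReal (∫ x, ‖u x‖ ^ 2 ∂μ) = ∫⁻ x, ‖u x‖ₑ ^ 2 ∂μ := by
  rw [ofReal_integral_eq_lintegral_ofReal (integrable_norm_sq hu)
    (Eventually.of_forall fun x => by positivity)]
  refine lintegral_congr fun x => ?_
  rw [ENNReal.ofReal_pow (norm_nonneg _), ofReal_norm]

theorem memLp_two_of_lintegral_le {α : Type*} [MeasurableSpace α] {μ : Measure α} {u : α → F}
    (hu : AEStronglyMeasurable u μ) {C : ℝ} (hC : 0 ≤ C)
    (h : ∫⁻ x, ‖u x‖ₑ ^ 2 ∂μ ≤ ENNReal.ofReal C) :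
    MemLp u 2 μ ∧ ∫ x, ‖u x‖ ^ 2 ∂μ ≤ C := by
  have h1 : MemLp u 2 μ := by
    refine ⟨hu, ?_⟩
    rw [eLpNorm_lt_top_iff_lintegral_rpow_enorm_lt_top (by norm_num) (by norm_num)]
    simpa using h.trans_lt ENNReal.ofReal_lt_top
  refine ⟨h1, ?_⟩
  rw [← ofReal_integral_norm_sq h1] at h
  exact (ENNReal.ofReal_le_ofReal_iff hC).1 h

theorem memLp_mollify [NormedSpace ℝ F] (k : ℕ) {u : Euc N → F} (hu : MemLp u 2 volume) :
    MemLp (mollify k u) 2 volume ∧ ∫ x, ‖mollify k u x‖ ^ 2 ≤ ∫ x, ‖u x‖ ^ 2 := by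
  refine memLp_two_of_lintegral_le
    (contDiff_mollify k (hu.locallyIntegrable (by norm_num))).continuous.aestronglyMeasurable
    (integral_nonneg fun x => by positivity) ?_
  rw [ofReal_integral_norm_sq hu]
  exact lintegral_mollify_sq_le k hu.aestronglyMeasurable

/-- A fixed smooth cutoff function, equal to `1` on the unit ball. -/
def cutBump (N : ℕ) : ContDiffBump (0 : Euc N) := ⟨1, 2, one_pos, one_lt_two⟩

/-- The cutoff function at scale `k + 1`. -/
def cutoff (N k : ℕ) (x : Euc N) : ℝ := cutBump N (((k : ℝ) + 1)⁻¹ • x)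

theorem contDiff_cutoff (k : ℕ) : ContDiff ℝ ∞ (cutoff N k) :=
  ((cutBump N).contDiff (n := ⊤)).comp (contDiff_const_smul _)

theorem hasCompactSupport_cutoff (k : ℕ) : HasCompactSupport (cutoff N k) := by
  have h : ((k : ℝ) + 1)⁻¹ ≠ 0 := by positivity
  exact (cutBump N).hasCompactSupport.comp_homeomorph (Homeomorph.smulOfNeZero _ h)

theorem abs_cutoff_le_one (k : ℕ) (x : Euc N) : |cutoff N k x| ≤ 1 := by
  rw [abs_of_nonneg (show 0 ≤ cutoff N k x from (cutBump N).nonneg)]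
  exact (cutBump N).le_one

theorem eventually_cutoff_eq_one (x : Euc N) : ∀ᶠ k in atTop, ∀ᶠ y in 𝓝 x, cutoff N k y = 1 := by
  obtain ⟨n, hn⟩ := exists_nat_gt ‖x‖
  filter_upwards [eventually_ge_atTop n] with k hk
  have h1 : ∀ᶠ y in 𝓝 x, ‖y‖ < n := continuous_norm.continuousAt.eventually_lt_const hn
  filter_upwards [h1] with y hy
  refine (cutBump N).one_of_mem_closedBall ?_
  have : (n : ℝ) ≤ k := by exact_mod_cast hk
  rw [mem_closedBall_zero_iff, norm_smul, norm_inv, Real.norm_of_nonneg (by positivity)]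
  change _ ≤ (1 : ℝ)
  rw [inv_mul_le_iff₀ (by positivity)]
  linarith

theorem exists_norm_fderiv_cutoff_le (N : ℕ) :
    ∃ C : ℝ, 0 ≤ C ∧ ∀ k (x : Euc N), ‖fderiv ℝ (cutoff N k) x‖ ≤ C / (k + 1) := by
  have hc : ContDiff ℝ ∞ (cutBump N) := (cutBump N).contDiff (n := ⊤)
  obtain ⟨C, hC⟩ := ((cutBump N).hasCompactSupport.fderiv ℝ).exists_bound_of_continuous
    (hc.continuous_fderiv (by simp))
  refine ⟨C, (norm_nonneg _).trans (hC 0), fun k x => ?_⟩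
  have h : fderiv ℝ (cutoff N k) x
      = ((k : ℝ) + 1)⁻¹ • fderiv ℝ (cutBump N) (((k : ℝ) + 1)⁻¹ • x) :=
    fderiv_comp_smul ..
  rw [h, norm_smul, norm_inv, Real.norm_of_nonneg (by positivity), div_eq_inv_mul]
  exact mul_le_mul_of_nonneg_left (hC _) (by positivity)

theorem norm_gradient (φ : Euc N → ℝ) (x : Euc N) : ‖gradient φ x‖ = ‖fderiv ℝ φ x‖ := by
  rw [gradient, LinearIsometryEquiv.norm_map]

theorem inner_gradient (φ : Euc N → ℝ) (x e : Euc N) :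
    inner ℝ (gradient φ x) e = fderiv ℝ φ x e := by
  rw [gradient, InnerProductSpace.toDual_symm_apply]

theorem continuous_gradient {φ : Euc N → ℝ} (hφ : ContDiff ℝ ∞ φ) : Continuous (gradient φ) :=
  (InnerProductSpace.toDual ℝ (Euc N)).symm.continuous.comp (hφ.continuous_fderiv (by simp))

theorem memLp_of_testFunction {φ : Euc N → ℝ} (hφ : ContDiff ℝ ∞ φ) (hc : HasCompactSupport φ)
    (p : ENNReal) : MemLp φ p volume :=
  hφ.continuous.memLp_of_hasCompactSupport hc

theorem memLp_gradient_of_testFunction {φ : Euc N → ℝ} (hφ : ContDiff ℝ ∞ φ)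
    (hc : HasCompactSupport φ) (p : ENNReal) : MemLp (gradient φ) p volume :=
  (continuous_gradient hφ).memLp_of_hasCompactSupport
    ((hc.fderiv ℝ).comp_left (map_zero (InnerProductSpace.toDual ℝ (Euc N)).symm))

/-- `H¹` functions are almost everywhere limits of test functions with control of the norms. -/
theorem IsWeakGrad.exists_approx {u : Euc N → ℝ} {G : Euc N → Euc N} (h : IsWeakGrad u G)
    (hu : MemLp u 2 volume) (hG : MemLp G 2 volume) :
    ∃ (φ : ℕ → Euc N → ℝ) (a : ℕ → ℝ), (∀ k, ContDiff ℝ ∞ (φ k)) ∧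
      (∀ k, HasCompactSupport (φ k)) ∧
      (∀ᵐ x, Tendsto (fun k => φ k x) atTop (𝓝 (u x))) ∧
      (∀ᵐ x, Tendsto (fun k => gradient (φ k) x) atTop (𝓝 (G x))) ∧
      (∀ k, ∫ x, φ k x ^ 2 ≤ ∫ x, u x ^ 2) ∧
      (∀ k, ∫ x, ‖gradient (φ k) x‖ ^ 2 ≤ a k) ∧ Tendsto a atTop (𝓝 (∫ x, ‖G x‖ ^ 2)) := by
  obtain ⟨C, hC0, hC⟩ := exists_norm_fderiv_cutoff_le N
  -- Mollify, then cut off. Almost everywhere convergence and bounds on the norms suffice, because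
  -- every later use passes to the limit by Fatou or by almost domination.
  set φ : ℕ → Euc N → ℝ := fun k x => cutoff N k x * mollify k u x with hφ
  set t : ℕ → ℝ := fun k => 1 / ((k : ℝ) + 1) with ht
  have ht0 : ∀ k, 0 < t k := fun k => by positivity
  have hm : ∀ k, ContDiff ℝ ∞ (mollify k u) := fun k => contDiff_mollify k h.1
  have hmG : ∀ k x, fderiv ℝ (mollify k u) x = InnerProductSpace.toDual ℝ (Euc N) (mollify k G x) :=
    fun k x => (hasGradientAt_iff_hasFDerivAt.1 (h.hasGradientAt_mollify k x)).fderiv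
  have hφs : ∀ k, ContDiff ℝ ∞ (φ k) := fun k => (contDiff_cutoff k).mul (hm k)
  have hφc : ∀ k, HasCompactSupport (φ k) := fun k => (hasCompactSupport_cutoff k).mul_right
  have hgrad : ∀ k x, fderiv ℝ (φ k) x = cutoff N k x • fderiv ℝ (mollify k u) x
      + mollify k u x • fderiv ℝ (cutoff N k) x := fun k x =>
    fderiv_mul ((contDiff_cutoff k).differentiable (by simp) x) ((hm k).differentiable (by simp) x)
  refine ⟨φ, fun k => (1 + t k) * (∫ x, ‖G x‖ ^ 2) + ((1 + t k) * C ^ 2 * t k) * ∫ x, ‖u x‖ ^ 2,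
    hφs, hφc, ?_, ?_, ?_, ?_, ?_⟩
  · filter_upwards [ae_tendsto_mollify h.1] with x hx
    refine hx.congr' ?_
    filter_upwards [eventually_cutoff_eq_one x] with k hk
    simp [hφ, hk.self_of_nhds]
  · filter_upwards [ae_tendsto_mollify h.2.1] with x hx
    refine hx.congr' ?_
    filter_upwards [eventually_cutoff_eq_one x] with k hk
    have h1 : φ k =ᶠ[𝓝 x] mollify k u := by
      filter_upwards [hk] with y hy
      simp [hφ, hy]
    rw [gradient, h1.fderiv_eq, hmG]
    simp
  · intro k
    have h1 := (memLp_mollify k hu).2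
    simp only [Real.norm_eq_abs, sq_abs] at h1
    refine le_trans (integral_mono_of_nonneg (Eventually.of_forall fun x => by positivity)
      (by simpa using integrable_norm_sq (memLp_mollify k hu).1)
      (Eventually.of_forall fun x => ?_)) h1
    have h2 := abs_cutoff_le_one k x
    simp only [hφ, mul_pow]
    have : cutoff N k x ^ 2 ≤ 1 := by rw [← sq_abs]; exact pow_le_one₀ (abs_nonneg _) h2
    nlinarith [sq_nonneg (mollify k u x)]
  · intro k
    have h1 := memLp_mollify k hu
    have h2 := memLp_mollify k hG
    calc ∫ x, ‖gradient (φ k) x‖ ^ 2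
        ≤ ∫ x, ((1 + t k) * ‖mollify k G x‖ ^ 2
          + ((1 + t k) * C ^ 2 * t k) * ‖mollify k u x‖ ^ 2) := by
          refine integral_mono
            (integrable_norm_sq (memLp_gradient_of_testFunction (hφs k) (hφc k) 2))
            (((integrable_norm_sq h2.1).const_mul _).add ((integrable_norm_sq h1.1).const_mul _))
            fun x => ?_
          have h3 : ‖gradient (φ k) x‖ ≤ ‖mollify k G x‖ + (C * t k) * ‖mollify k u x‖ := by
            rw [norm_gradient, hgrad, hmG]
            refine (norm_add_le _ _).trans ?_
            rw [norm_smul, norm_smul, LinearIsometryEquiv.norm_map]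
            refine add_le_add ?_ ?_
            · exact mul_le_of_le_one_left (norm_nonneg _) (abs_cutoff_le_one k x)
            · rw [mul_comm]
              refine mul_le_mul_of_nonneg_right ((hC k x).trans (le_of_eq ?_)) (norm_nonneg _)
              simp [ht, div_eq_mul_inv]
          have h4 : ‖gradient (φ k) x‖ ^ 2
              ≤ (‖mollify k G x‖ + (C * t k) * ‖mollify k u x‖) ^ 2 :=
            pow_le_pow_left₀ (norm_nonneg _) h3 2
          refine h4.trans ?_
          have h5 := ht0 k
          -- Young's inequality with weight t k = 1/(k+1) on the cross term; this produces the
          -- factors 1 + t and (1 + t) C² t of the bounding sequence, whose limit is exactly ∫|G|².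
          have h6 : 0 ≤ t k * (‖mollify k G x‖ - C * ‖mollify k u x‖) ^ 2 := by positivity
          nlinarith [h6]
      _ = (1 + t k) * (∫ x, ‖mollify k G x‖ ^ 2)
          + ((1 + t k) * C ^ 2 * t k) * ∫ x, ‖mollify k u x‖ ^ 2 := by
          rw [integral_add ((integrable_norm_sq h2.1).const_mul _)
            ((integrable_norm_sq h1.1).const_mul _), integral_const_mul, integral_const_mul]
      _ ≤ _ := by
          have h5 := ht0 k
          refine add_le_add (mul_le_mul_of_nonneg_left h2.2 (by positivity))
            (mul_le_mul_of_nonneg_left h1.2 (by positivity))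
  · have h1 : Tendsto t atTop (𝓝 0) := tendsto_one_div_add_atTop_nhds_zero_nat
    have h2 := ((h1.const_add 1).mul_const (∫ x, ‖G x‖ ^ 2)).add
      ((((h1.const_add 1).mul_const (C ^ 2)).mul h1).mul_const (∫ x, ‖u x‖ ^ 2))
    simpa using h2

end Approx

/-! ### The Sobolev inequality -/

section Sobolev

variable {N : ℕ}

theorem twoStar_eq (hN : 3 ≤ N) : (twoStar N)⁻¹ = 1 / 2 - 1 / N ∧ 2 < twoStar N := by
  have h3 : (3 : ℝ) ≤ N := by exact_mod_cast hN
  constructor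
  · rw [twoStar]
    have : (N : ℝ) - 2 ≠ 0 := by linarith
    field_simp
  · rw [twoStar, lt_div_iff₀ (by linarith)]
    linarith

theorem exists_testFunction (N : ℕ) : ∃ φ : Euc N → ℝ,
    ContDiff ℝ ∞ φ ∧ HasCompactSupport φ ∧ φ ≠ 0 := by
  refine ⟨cutBump N, (cutBump N).contDiff (n := ⊤), (cutBump N).hasCompactSupport, fun h => ?_⟩
  have h1 : cutBump N (0 : Euc N) = 1 :=
    (cutBump N).one_of_mem_closedBall (Metric.mem_closedBall_self (cutBump N).rIn_pos.le)
  rw [h] at h1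
  simp at h1

theorem integrable_rpow_testFunction {φ : Euc N → ℝ} (hφ : ContDiff ℝ ∞ φ)
    (hc : HasCompactSupport φ) {p : ℝ} (hp : 0 < p) : Integrable fun x => |φ x| ^ p := by
  have h := (memLp_of_testFunction hφ hc (ENNReal.ofReal p)).integrable_norm_rpow
    (by simpa using hp) ENNReal.ofReal_ne_top
  simpa [ENNReal.toReal_ofReal hp.le] using h

theorem integral_rpow_testFunction_pos {φ : Euc N → ℝ} (hφ : ContDiff ℝ ∞ φ)
    (hc : HasCompactSupport φ) (h0 : φ ≠ 0) {p : ℝ} (hp : 0 < p) : 0 < ∫ x, |φ x| ^ p := by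
  obtain ⟨x₀, hx₀⟩ := Function.ne_iff.1 h0
  refine Continuous.integral_pos_of_hasCompactSupport_nonneg_nonzero (x := x₀)
    (hφ.continuous.abs.rpow_const fun x => Or.inr hp.le) ?_
    (fun x => Real.rpow_nonneg (abs_nonneg _) _) ?_
  · exact hc.comp_left (g := fun t => |t| ^ p) (by simp [hp.ne'])
  · exact (Real.rpow_pos_of_pos (abs_pos.2 hx₀) _).ne'

theorem sobolevConst_mul_le {φ : Euc N → ℝ} (hN : 3 ≤ N) (hφ : ContDiff ℝ ∞ φ)
    (hc : HasCompactSupport φ) :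
    sobolevConst N * (∫ x, |φ x| ^ twoStar N) ^ (2 / twoStar N) ≤ ∫ x, ‖gradient φ x‖ ^ 2 := by
  have hp : 0 < twoStar N := by linarith [(twoStar_eq hN).2]
  by_cases h0 : φ = 0
  · subst h0
    have : (∫ x : Euc N, |(0 : Euc N → ℝ) x| ^ twoStar N) = 0 := by simp [hp.ne']
    rw [this, Real.zero_rpow (by positivity), mul_zero]
    exact integral_nonneg fun x => by positivity
  have hpos := Real.rpow_pos_of_pos (integral_rpow_testFunction_pos hφ hc h0 hp) (2 / twoStar N)
  rw [← le_div_iff₀ hpos]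
  refine csInf_le ⟨0, ?_⟩ ⟨φ, hφ, hc, h0, rfl⟩
  rintro r ⟨ψ, hψ, hψc, hψ0, rfl⟩
  have := integral_rpow_testFunction_pos hψ hψc hψ0 hp
  exact div_nonneg (integral_nonneg fun x => by positivity) (Real.rpow_nonneg this.le _)

/-- The Gagliardo–Nirenberg–Sobolev inequality with some constant K bounds every quotient below by
K⁻². A nonzero test function is used twice: it forces K ≠ 0, and it makes the set of quotients
nonempty, the value of `sInf ∅` being 0. -/
theorem sobolevConst_pos (hN : 3 ≤ N) : 0 < sobolevConst N := by
  obtain ⟨h2inv, h2⟩ := twoStar_eq hN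
  have hp : 0 < twoStar N := by linarith
  set K : ℝ := (eLpNormLESNormFDerivOfEqInnerConst (volume : Measure (Euc N)) 2).toReal with hK
  have key : ∀ φ : Euc N → ℝ, ContDiff ℝ ∞ φ → HasCompactSupport φ →
      (∫ x, |φ x| ^ twoStar N) ^ (2 / twoStar N) ≤ K ^ 2 * ∫ x, ‖gradient φ x‖ ^ 2 := by
    intro φ hφ hc
    have h := eLpNorm_le_eLpNorm_fderiv_of_eq_inner (volume : Measure (Euc N))
      (hφ.of_le (by simp)) hc (p := 2) (p' := (twoStar N).toNNReal) (by norm_num)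
      (by rw [finrank_euclideanSpace_fin]; lia)
      (by rw [finrank_euclideanSpace_fin, Real.coe_toNNReal _ hp.le, h2inv]; simp)
    have h1 := (memLp_of_testFunction hφ hc ((twoStar N).toNNReal : ENNReal)).eLpNorm_eq_integral_rpow_norm
      (by simpa using hp) ENNReal.coe_ne_top
    have h3 : MemLp (fderiv ℝ φ) 2 (volume : Measure (Euc N)) :=
      (hφ.continuous_fderiv (by simp)).memLp_of_hasCompactSupport (hc.fderiv ℝ)
    have h4 := h3.eLpNorm_eq_integral_rpow_norm (by norm_num) (by norm_num)
    simp only [ENNReal.coe_ofNat, NNReal.coe_ofNat] at h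
    rw [h1, h4, ← ENNReal.ofReal_coe_nnreal (p := eLpNormLESNormFDerivOfEqInnerConst _ _),
      ← ENNReal.ofReal_mul NNReal.zero_le_coe,
      ENNReal.ofReal_le_ofReal_iff (by positivity)] at h
    simp only [ENNReal.coe_toReal, Real.coe_toNNReal _ hp.le, ENNReal.toReal_ofNat,
      Real.norm_eq_abs, Real.rpow_ofNat] at h
    have hI : 0 ≤ ∫ x, |φ x| ^ twoStar N := integral_nonneg fun x => Real.rpow_nonneg (abs_nonneg _) _
    have hJ : 0 ≤ ∫ x, ‖fderiv ℝ φ x‖ ^ 2 := integral_nonneg fun x => by positivity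
    have h5 := pow_le_pow_left₀ (Real.rpow_nonneg hI _) h 2
    rw [mul_pow, ← Real.rpow_natCast, ← Real.rpow_mul hI, ← Real.rpow_natCast (_ ^ (2⁻¹ : ℝ)),
      ← Real.rpow_mul hJ] at h5
    simp only [norm_gradient]
    convert! h5 using 2
    · rw [div_eq_inv_mul]; norm_num
    · norm_num
  obtain ⟨φ₀, h₀, hc₀, hn₀⟩ := exists_testFunction N
  have hKpos : 0 < K ^ 2 := by
    have h := key φ₀ h₀ hc₀
    have h' := Real.rpow_pos_of_pos (integral_rpow_testFunction_pos h₀ hc₀ hn₀ hp) (2 / twoStar N)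
    by_contra hneg
    have : K ^ 2 = 0 := le_antisymm (not_lt.1 hneg) (sq_nonneg _)
    rw [this, zero_mul] at h
    linarith
  refine lt_of_lt_of_le (inv_pos.2 hKpos) (le_csInf ⟨_, φ₀, h₀, hc₀, hn₀, rfl⟩ ?_)
  rintro r ⟨φ, hφ, hc, h0, rfl⟩
  have h' := Real.rpow_pos_of_pos (integral_rpow_testFunction_pos hφ hc h0 hp) (2 / twoStar N)
  rw [le_div_iff₀ h', inv_mul_le_iff₀ hKpos]
  exact key φ hφ hc

/-- The Sobolev inequality on `H¹`. -/
theorem IsWeakGrad.sobolev (hN : 3 ≤ N) {u : Euc N → ℝ} {G : Euc N → Euc N}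
    (h : IsWeakGrad u G) (hu : MemLp u 2 volume) (hG : MemLp G 2 volume) :
    Integrable (fun x => |u x| ^ twoStar N) ∧
      ∫ x, |u x| ^ twoStar N ≤ ((∫ x, ‖G x‖ ^ 2) / sobolevConst N) ^ (twoStar N / 2) := by
  obtain ⟨φ, a, hφ, hc, hlim, -, -, ha, haG⟩ := h.exists_approx hu hG
  have hp : 0 < twoStar N := by linarith [(twoStar_eq hN).2]
  have hS := sobolevConst_pos hN
  -- Fatou along the approximation preserves the best constant S, on which the threshold for c
  -- depends.
  refine integrable_and_integral_le_of_tendsto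
    (F := fun k x => |φ k x| ^ twoStar N) (a := fun k => (a k / sobolevConst N) ^ (twoStar N / 2))
    (fun k => integrable_rpow_testFunction (hφ k) (hc k) hp)
    (fun k => Eventually.of_forall fun x => Real.rpow_nonneg (abs_nonneg _) _) ?_ ?_ ?_
  · filter_upwards [hlim] with x hx
    exact hx.abs.rpow_const (Or.inr hp.le)
  · intro k
    have h1 := sobolevConst_mul_le hN (hφ k) (hc k)
    rw [mul_comm, ← le_div_iff₀ hS] at h1
    have hI : 0 ≤ ∫ x, |φ k x| ^ twoStar N :=
      integral_nonneg fun x => Real.rpow_nonneg (abs_nonneg _) _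
    have h2 := Real.rpow_le_rpow (Real.rpow_nonneg hI _)
      (h1.trans (div_le_div_of_nonneg_right (ha k) hS.le)) (by positivity : 0 ≤ twoStar N / 2)
    rw [← Real.rpow_mul hI] at h2
    have : 2 / twoStar N * (twoStar N / 2) = 1 := by field_simp
    rwa [this, Real.rpow_one] at h2
  · exact (haG.div_const _).rpow_const (Or.inr (by positivity))

end Sobolev

/-! ### Calculus of weak gradients -/

section WeakGrad

variable {N : ℕ} {u v : Euc N → ℝ} {G H : Euc N → Euc N}

theorem IsWeakGrad.integrable_left (h : IsWeakGrad u G) {φ : Euc N → ℝ} (hφ : ContDiff ℝ ∞ φ)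
    (hc : HasCompactSupport φ) (e : Euc N) : Integrable fun x => u x * fderiv ℝ φ x e := by
  have h1 : Continuous fun x => fderiv ℝ φ x e := (hφ.continuous_fderiv (by simp)).clm_apply
    continuous_const
  have h2 : HasCompactSupport fun x => fderiv ℝ φ x e := hc.fderiv_apply ℝ e
  exact h.1.integrable_smul_right_of_hasCompactSupport h1 h2

theorem integrable_inner_mul_of_testFunction (hG : LocallyIntegrable G) {φ : Euc N → ℝ}
    (hφ : ContDiff ℝ ∞ φ) (hc : HasCompactSupport φ) (e : Euc N) :
    Integrable fun x => inner ℝ (G x) e * φ x := by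
  refine ((hG.integrable_smul_left_of_hasCompactSupport hφ.continuous hc).inner_const (𝕜 := ℝ)
    e).congr (Eventually.of_forall fun x => ?_)
  simp only [inner_smul_left, conj_trivial]
  ring

theorem IsWeakGrad.add (h : IsWeakGrad u G) (h' : IsWeakGrad v H) :
    IsWeakGrad (u + v) (G + H) := by
  refine ⟨h.1.add h'.1, h.2.1.add h'.2.1, fun φ hφ hc e => ?_⟩
  simp only [Pi.add_apply, add_mul, inner_add_left]
  rw [integral_add (h.integrable_left hφ hc e) (h'.integrable_left hφ hc e),
    integral_add (integrable_inner_mul_of_testFunction h.2.1 hφ hc e)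
      (integrable_inner_mul_of_testFunction h'.2.1 hφ hc e), h.2.2 φ hφ hc e, h'.2.2 φ hφ hc e]
  ring

theorem IsWeakGrad.const_smul (h : IsWeakGrad u G) (t : ℝ) : IsWeakGrad (t • u) (t • G) := by
  refine ⟨h.1.smul t, h.2.1.smul t, fun φ hφ hc e => ?_⟩
  simp only [Pi.smul_apply, smul_eq_mul, inner_smul_left, conj_trivial, mul_assoc]
  rw [integral_const_mul, integral_const_mul, h.2.2 φ hφ hc e]
  ring

theorem IsWeakGrad.sub (h : IsWeakGrad u G) (h' : IsWeakGrad v H) :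
    IsWeakGrad (u - v) (G - H) := by
  have := h.add (h'.const_smul (-1))
  simpa [sub_eq_add_neg] using this

/-- Integration by parts for smooth functions. -/
theorem isWeakGrad_of_testFunction_comp {φ : Euc N → ℝ} (hφ : ContDiff ℝ ∞ φ) {ψ ψ' : ℝ → ℝ}
    (hψ : ∀ t, HasDerivAt ψ (ψ' t) t) (hψ' : Continuous ψ') :
    IsWeakGrad (fun x => ψ (φ x)) fun x => ψ' (φ x) • gradient φ x := by
  have hψc : Continuous ψ := continuous_iff_continuousAt.2 fun t => (hψ t).continuousAt
  have hd : ∀ x, HasFDerivAt (fun x => ψ (φ x)) (ψ' (φ x) • fderiv ℝ φ x) x := fun x =>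
    (hψ (φ x)).comp_hasFDerivAt x ((hφ.differentiable (by simp)) x).hasFDerivAt
  have hc1 : Continuous fun x => ψ (φ x) := hψc.comp hφ.continuous
  have hc2 : Continuous fun x => ψ' (φ x) • gradient φ x :=
    (hψ'.comp hφ.continuous).smul (continuous_gradient hφ)
  refine ⟨hc1.locallyIntegrable, hc2.locallyIntegrable, fun χ hχ hχc e => ?_⟩
  have e1 : Integrable fun x => fderiv ℝ (fun x => ψ (φ x)) x e * χ x := by
    refine (integrable_inner_mul_of_testFunction hc2.locallyIntegrable hχ hχc e).congr
      (Eventually.of_forall fun x => ?_)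
    simp only [(hd x).fderiv, inner_smul_left, inner_gradient, conj_trivial,
      smul_apply, smul_eq_mul]
  rw [integral_mul_fderiv_eq_neg_fderiv_mul_of_integrable e1
    (hc1.locallyIntegrable.integrable_smul_right_of_hasCompactSupport
      ((hχ.continuous_fderiv (by simp)).clm_apply continuous_const) (hχc.fderiv_apply ℝ e))
    (hc1.locallyIntegrable.integrable_smul_right_of_hasCompactSupport hχ.continuous hχc)
    (fun x _ => (hd x).differentiableAt) (fun x _ => hχ.differentiable (by simp) x)]
  congr 1
  refine integral_congr_ae (Eventually.of_forall fun x => ?_)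
  simp only [(hd x).fderiv, inner_smul_left, inner_gradient, conj_trivial,
    smul_apply, smul_eq_mul]

theorem young_mul_le (a b : ℝ) {η : ℝ} (hη : 0 < η) : |a * b| ≤ η⁻¹ * b ^ 2 + η * a ^ 2 := by
  rw [abs_mul]
  have h1 : 0 ≤ η * (|a| - η⁻¹ * |b|) ^ 2 := by positivity
  have h2 : η * (|a| - η⁻¹ * |b|) ^ 2 = η * a ^ 2 - 2 * (|a| * |b|) + η⁻¹ * b ^ 2 := by
    rw [sub_sq, mul_pow, sq_abs, sq_abs]
    field_simp
  nlinarith [mul_nonneg (abs_nonneg a) (abs_nonneg b)]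

/-- Products of a sequence bounded in `L²` and converging almost everywhere with a fixed `L²`
function converge in the mean. -/
theorem tendsto_integral_mul_of_bounded {α : Type*} [MeasurableSpace α] {μ : Measure α}
    {a : ℕ → α → ℝ} {a₀ b : α → ℝ} {M : ℝ}
    (ha : ∀ n, MemLp (a n) 2 μ) (ha₀ : MemLp a₀ 2 μ) (hb : MemLp b 2 μ)
    (hM : ∀ n, ∫ x, a n x ^ 2 ∂μ ≤ M)
    (hlim : ∀ᵐ x ∂μ, Tendsto (fun n => a n x) atTop (𝓝 (a₀ x))) :
    Tendsto (fun n => ∫ x, a n x * b x ∂μ) atTop (𝓝 (∫ x, a₀ x * b x ∂μ)) := by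
  refine tendsto_integral_of_almost_dominated (D := fun n x => a n x ^ 2) (M := M)
    (fun n => (ha n).aestronglyMeasurable.mul hb.aestronglyMeasurable) ?_
    (fun n => by simpa using integrable_norm_sq (ha n)) (fun n x => sq_nonneg _) hM ?_ ?_
  · exact ha₀.integrable_mul hb
  · filter_upwards [hlim] with x hx using hx.mul_const _
  · intro η hη
    exact ⟨fun x => η⁻¹ * b x ^ 2, by simpa using (integrable_norm_sq hb).const_mul η⁻¹,
      fun n => Eventually.of_forall fun x => young_mul_le _ _ hη⟩

theorem abs_le_of_deriv_bound {ψ ψ' : ℝ → ℝ} (hψ : ∀ t, HasDerivAt ψ (ψ' t) t) {C : ℝ}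
    (hC : ∀ t, |ψ' t| ≤ C) (h0 : ψ 0 = 0) (t : ℝ) : |ψ t| ≤ C * |t| := by
  have := Convex.norm_image_sub_le_of_norm_hasDerivWithin_le (s := Set.univ) (f := ψ) (f' := ψ')
    (C := C) (x := 0) (y := t) (fun x _ => (hψ x).hasDerivWithinAt) (fun x _ => hC x) convex_univ
    (Set.mem_univ _) (Set.mem_univ _)
  simpa [h0] using this

theorem MemLp.two_of_abs_le {α : Type*} [MeasurableSpace α] {μ : Measure α} {F F' : Type*}
    [NormedAddCommGroup F] [NormedAddCommGroup F'] {a : α → F} {b : α → F'} {C : ℝ}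
    (hb : MemLp b 2 μ) (ha : AEStronglyMeasurable a μ) (h : ∀ x, ‖a x‖ ≤ C * ‖b x‖) :
    MemLp a 2 μ :=
  hb.of_le_mul ha (Eventually.of_forall h)

/-- The chain rule in `H¹`. -/
theorem IsWeakGrad.comp (h : IsWeakGrad u G) (hu : MemLp u 2 volume) (hG : MemLp G 2 volume)
    {ψ ψ' : ℝ → ℝ} (hψ : ∀ t, HasDerivAt ψ (ψ' t) t) (hψ' : Continuous ψ') {C : ℝ}
    (hC : ∀ t, |ψ' t| ≤ C) (h0 : ψ 0 = 0) :
    IsWeakGrad (fun x => ψ (u x)) (fun x => ψ' (u x) • G x) ∧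
      MemLp (fun x => ψ (u x)) 2 volume ∧ MemLp (fun x => ψ' (u x) • G x) 2 volume := by
  have hψc : Continuous ψ := continuous_iff_continuousAt.2 fun t => (hψ t).continuousAt
  have hLip := abs_le_of_deriv_bound hψ hC h0
  have m1 : MemLp (fun x => ψ (u x)) 2 volume :=
    MemLp.two_of_abs_le hu (hψc.comp_aestronglyMeasurable hu.aestronglyMeasurable)
      fun x => hLip (u x)
  have m2 : MemLp (fun x => ψ' (u x) • G x) 2 volume := by
    refine MemLp.two_of_abs_le (C := C) hG
      ((hψ'.comp_aestronglyMeasurable hu.aestronglyMeasurable).smul hG.aestronglyMeasurable)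
      fun x => ?_
    rw [norm_smul]
    exact mul_le_mul_of_nonneg_right (hC _) (norm_nonneg _)
  refine ⟨⟨m1.locallyIntegrable (by norm_num), m2.locallyIntegrable (by norm_num),
    fun χ hχ hχc e => ?_⟩, m1, m2⟩
  obtain ⟨φ, a, hφ, hc, hlim, hglim, hφu, ha, haG⟩ := h.exists_approx hu hG
  obtain ⟨A, hA⟩ := haG.bddAbove_range
  have mφ : ∀ k, MemLp (φ k) 2 volume := fun k => memLp_of_testFunction (hφ k) (hc k) 2
  have mg : ∀ k, MemLp (gradient (φ k)) 2 volume := fun k =>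
    memLp_gradient_of_testFunction (hφ k) (hc k) 2
  have mχ : MemLp (fun x => fderiv ℝ χ x e) 2 (volume : Measure (Euc N)) :=
    ((hχ.continuous_fderiv (by simp)).clm_apply continuous_const).memLp_of_hasCompactSupport
      (hχc.fderiv_apply ℝ e)
  have hC0 : 0 ≤ C := (abs_nonneg _).trans (hC 0)
  -- Integration by parts is classical for ψ ∘ φ k. Both sides pair a sequence that is bounded in L²
  -- and convergent almost everywhere with a function fixed by χ, so both pass to the limit.
  have lim1 : Tendsto (fun k => ∫ x, ψ (φ k x) * fderiv ℝ χ x e) atTop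
      (𝓝 (∫ x, ψ (u x) * fderiv ℝ χ x e)) := by
    refine tendsto_integral_mul_of_bounded (M := C ^ 2 * ∫ x, u x ^ 2) (fun k =>
      MemLp.two_of_abs_le (mφ k) (hψc.comp_aestronglyMeasurable (mφ k).aestronglyMeasurable)
      fun x => hLip (φ k x)) m1 mχ (fun k => ?_) ?_
    · refine le_trans ?_ (mul_le_mul_of_nonneg_left (hφu k) (sq_nonneg C))
      rw [← integral_const_mul]
      refine integral_mono_of_nonneg (Eventually.of_forall fun x => sq_nonneg _)
        (by simpa using (integrable_norm_sq (mφ k)).const_mul (C ^ 2))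
        (Eventually.of_forall fun x => ?_)
      have := pow_le_pow_left₀ (abs_nonneg _) (hLip (φ k x)) 2
      simpa only [mul_pow, sq_abs] using this
    · filter_upwards [hlim] with x hx using (hψc.tendsto _).comp hx
  have hle : ∀ (s : ℝ) (g : Euc N), |inner ℝ (ψ' s • g) e| ≤ C * ‖e‖ * ‖g‖ := by
    intro s g
    rw [inner_smul_left, conj_trivial, abs_mul]
    have h1 := abs_real_inner_le_norm g e
    calc |ψ' s| * |inner ℝ g e| ≤ C * (‖g‖ * ‖e‖) :=
          mul_le_mul (hC s) h1 (abs_nonneg _) hC0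
      _ = _ := by ring
  have lim2 : Tendsto (fun k => ∫ x, inner ℝ (ψ' (φ k x) • gradient (φ k) x) e * χ x) atTop
      (𝓝 (∫ x, inner ℝ (ψ' (u x) • G x) e * χ x)) := by
    refine tendsto_integral_mul_of_bounded (M := (C * ‖e‖) ^ 2 * A) (fun k => ?_) ?_
      (memLp_of_testFunction hχ hχc 2) (fun k => ?_) ?_
    · refine MemLp.two_of_abs_le (C := C * ‖e‖) (mg k) ?_ fun x => ?_
      · exact (((hψ'.comp (hφ k).continuous).smul (continuous_gradient (hφ k))).inner
          continuous_const).aestronglyMeasurable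
      · exact hle _ _
    · refine MemLp.two_of_abs_le (C := C * ‖e‖) hG ?_ fun x => ?_
      · exact m2.aestronglyMeasurable.inner aestronglyMeasurable_const
      · exact hle _ _
    · refine le_trans ?_ (mul_le_mul_of_nonneg_left ((ha k).trans (hA ⟨k, rfl⟩)) (sq_nonneg _))
      rw [← integral_const_mul]
      refine integral_mono_of_nonneg (Eventually.of_forall fun x => sq_nonneg _)
        ((integrable_norm_sq (mg k)).const_mul _)
        (Eventually.of_forall fun x => ?_)
      have := pow_le_pow_left₀ (abs_nonneg _) (hle (φ k x) (gradient (φ k) x)) 2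
      simpa only [mul_pow, sq_abs] using this
    · filter_upwards [hlim, hglim] with x hx hgx
      exact (((hψ'.tendsto _).comp hx).smul hgx).inner tendsto_const_nhds
  refine tendsto_nhds_unique lim1 (lim2.neg.congr fun k => ?_)
  exact ((isWeakGrad_of_testFunction_comp (hφ k) hψ hψ').2.2 χ hχ hχc e).symm

end WeakGrad

/-! ### Weak compactness in `L²` -/

section WeakCompactness

variable {N : ℕ} {F : Type*} [NormedAddCommGroup F] [InnerProductSpace ℝ F]

theorem norm_toLp_sq {u : Euc N → F} (hu : MemLp u 2 volume) :
    ‖hu.toLp u‖ ^ 2 = ∫ x, ‖u x‖ ^ 2 := by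
  rw [← real_inner_self_eq_norm_sq, L2.inner_def]
  refine integral_congr_ae ?_
  filter_upwards [hu.coeFn_toLp] with x hx
  rw [hx, real_inner_self_eq_norm_sq]

theorem inner_toLp {u v : Euc N → F} (hu : MemLp u 2 volume) (hv : MemLp v 2 volume) :
    inner ℝ (hu.toLp u) (hv.toLp v) = ∫ x, inner ℝ (u x) (v x) := by
  rw [L2.inner_def]
  refine integral_congr_ae ?_
  filter_upwards [hu.coeFn_toLp, hv.coeFn_toLp] with x hx hx'
  rw [hx, hx']

/-- Bounded sequences in `L²` have weakly convergent subsequences. -/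
theorem exists_weakly_convergent_subseq [CompleteSpace F] [SecondCountableTopology F]
    {u : ℕ → Euc N → F} {M : ℝ}
    (hu : ∀ n, MemLp (u n) 2 volume) (hM : ∀ n, ∫ x, ‖u n x‖ ^ 2 ≤ M) :
    ∃ (w : Euc N → F) (σ : ℕ → ℕ), StrictMono σ ∧ MemLp w 2 volume ∧
      ∀ K : Euc N → F, MemLp K 2 volume →
        Tendsto (fun n => ∫ x, inner ℝ (u (σ n) x) (K x)) atTop (𝓝 (∫ x, inner ℝ (w x) (K x))) := by
  -- Finiteness of the exponent gives separability of L² by instance, as needed for the sequential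
  -- Banach–Alaoglu theorem. The Riesz isometry carries the sequence into the dual and the limit
  -- back.
  have : Fact ((2 : ENNReal) ≠ ⊤) := ⟨by norm_num⟩
  have hsc := WeakDual.isSeqCompact_closedBall ℝ (Lp F 2 (volume : Measure (Euc N))) 0 (√M)
  have hmem : ∀ n, StrongDual.toWeakDual (InnerProductSpace.toDual ℝ _ ((hu n).toLp (u n))) ∈
      (WeakDual.toStrongDual ⁻¹' Metric.closedBall 0 (√M) :
        Set (WeakDual ℝ (Lp F 2 (volume : Measure (Euc N))))) := by
    intro n
    change dist (InnerProductSpace.toDual ℝ _ ((hu n).toLp (u n))) 0 ≤ _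
    rw [dist_zero_right, LinearIsometryEquiv.norm_map]
    refine Real.le_sqrt_of_sq_le ?_
    rw [norm_toLp_sq]
    exact hM n
  obtain ⟨ℓ, -, σ, hσ, hlim⟩ := hsc hmem
  set w := (InnerProductSpace.toDual ℝ (Lp F 2 (volume : Measure (Euc N)))).symm
    (WeakDual.toStrongDual ℓ) with hw
  refine ⟨w, σ, hσ, Lp.memLp w, fun K hK => ?_⟩
  have h1 := ((WeakDual.eval_continuous (hK.toLp K)).tendsto ℓ).comp hlim
  have h2 : ℓ (hK.toLp K) = ∫ x, inner ℝ (w x) (K x) := by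
    have h3 : inner ℝ w (hK.toLp K) = ℓ (hK.toLp K) := InnerProductSpace.toDual_symm_apply
    rw [← h3, ← inner_toLp (Lp.memLp w) hK, Lp.toLp_coeFn]
  rw [h2] at h1
  refine h1.congr fun n => ?_
  exact inner_toLp (hu (σ n)) hK

end WeakCompactness

/-! ### The Rellich theorem -/

section Rellich

variable {N : ℕ}

/-- The increment φ(x − t) − φ(x) is the average over s in (0, 1] of −Dφ(x − st)t. Jensen applies to
this average, and every translate of the gradient has the same L² norm. -/
theorem lintegral_translate_sub_le_of_testFunction {φ : Euc N → ℝ} (hφ : ContDiff ℝ ∞ φ)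
    (hc : HasCompactSupport φ) (t : Euc N) :
    ∫⁻ x, ‖φ (x - t) - φ x‖ₑ ^ 2 ≤ ENNReal.ofReal (‖t‖ ^ 2 * ∫ x, ‖gradient φ x‖ ^ 2) := by
  have hcf : Continuous (fderiv ℝ φ) := hφ.continuous_fderiv (by simp)
  have hcont : Continuous fun p : Euc N × ℝ => -(fderiv ℝ φ (p.1 - p.2 • t) t) :=
    ((hcf.comp (by fun_prop)).clm_apply continuous_const).neg
  have h1 : ∀ x, φ (x - t) - φ x = ∫ s, -(fderiv ℝ φ (x - s • t) t) ∂(volume.restrict (Set.Ioc (0 : ℝ) 1)) := by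
    intro x
    rw [← intervalIntegral.integral_of_le zero_le_one,
      intervalIntegral.integral_eq_sub_of_hasDerivAt (f := fun s : ℝ => φ (x - s • t))]
    · simp
    · intro s _
      have h2 : HasDerivAt (fun s : ℝ => x - s • t) (-t) s := by
        simpa using ((hasDerivAt_id s).smul_const t).const_sub x
      have h3 := ((hφ.differentiable (by simp)) (x - s • t)).hasFDerivAt.comp_hasDerivAt s h2
      convert! h3 using 1
      simp
    · exact (hcont.comp (by fun_prop : Continuous fun s : ℝ => (x, s))).intervalIntegrable _ _
  have : IsProbabilityMeasure (volume.restrict (Set.Ioc (0 : ℝ) 1)) := ⟨by simp⟩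
  simp only [h1]
  refine (lintegral_enorm_integral_sq_le (h := fun x s => -(fderiv ℝ φ (x - s • t) t))
    hcont.stronglyMeasurable).trans ?_
  have hg := memLp_gradient_of_testFunction hφ hc 2
  calc _ ≤ ∫⁻ _ in Set.Ioc (0 : ℝ) 1, ENNReal.ofReal (‖t‖ ^ 2 * ∫ x, ‖gradient φ x‖ ^ 2) := by
        refine lintegral_mono fun s => ?_
        have h4 : ∀ x : Euc N, ‖-(fderiv ℝ φ (x - s • t) t)‖ₑ ^ 2
            ≤ ENNReal.ofReal (‖t‖ ^ 2) * ‖gradient φ (x - s • t)‖ₑ ^ 2 := by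
          intro x
          rw [enorm_neg, ← ofReal_norm, ← ofReal_norm, ← ENNReal.ofReal_pow (norm_nonneg _),
            ← ENNReal.ofReal_pow (norm_nonneg _), ← ENNReal.ofReal_mul (sq_nonneg _), ← mul_pow]
          refine ENNReal.ofReal_le_ofReal (pow_le_pow_left₀ (norm_nonneg _) ?_ 2)
          rw [norm_gradient, mul_comm]
          exact ContinuousLinearMap.le_opNorm _ _
        refine (lintegral_mono h4).trans (le_of_eq ?_)
        rw [lintegral_const_mul' _ _ ENNReal.ofReal_ne_top,
          lintegral_sub_right_eq_self (fun x => ‖gradient φ x‖ₑ ^ 2), ← ofReal_integral_norm_sq hg,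
          ENNReal.ofReal_mul (sq_nonneg _)]
    _ = _ := by simp

theorem IsWeakGrad.lintegral_translate_sub_le {u : Euc N → ℝ} {G : Euc N → Euc N}
    (h : IsWeakGrad u G) (hu : MemLp u 2 volume) (hG : MemLp G 2 volume) (t : Euc N) :
    ∫⁻ x, ‖u (x - t) - u x‖ₑ ^ 2 ≤ ENNReal.ofReal (‖t‖ ^ 2 * ∫ x, ‖G x‖ ^ 2) := by
  obtain ⟨φ, a, hφ, hc, hlim, -, -, ha, haG⟩ := h.exists_approx hu hG
  have hlim' : ∀ᵐ x, Tendsto (fun k => φ k (x - t)) atTop (𝓝 (u (x - t))) :=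
    (measurePreserving_sub_right volume t).quasiMeasurePreserving.ae hlim
  calc ∫⁻ x, ‖u (x - t) - u x‖ₑ ^ 2
      = ∫⁻ x, liminf (fun k => ‖φ k (x - t) - φ k x‖ₑ ^ 2) atTop := by
        refine lintegral_congr_ae ?_
        filter_upwards [hlim, hlim'] with x hx hx'
        exact ((ENNReal.continuous_pow 2).tendsto _ |>.comp
          ((continuous_enorm.tendsto _).comp (hx'.sub hx))).liminf_eq.symm
    _ ≤ liminf (fun k => ∫⁻ x, ‖φ k (x - t) - φ k x‖ₑ ^ 2) atTop :=
        lintegral_liminf_le fun k => (((hφ k).continuous.comp (by fun_prop)).sub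
          (hφ k).continuous).measurable.enorm.pow_const 2
    _ ≤ liminf (fun k => ENNReal.ofReal (‖t‖ ^ 2 * a k)) atTop := by
        refine liminf_le_liminf (Eventually.of_forall fun k => ?_)
        refine (lintegral_translate_sub_le_of_testFunction (hφ k) (hc k) t).trans ?_
        exact ENNReal.ofReal_le_ofReal (mul_le_mul_of_nonneg_left (ha k) (sq_nonneg _))
    _ = _ := ((ENNReal.continuous_ofReal.tendsto _).comp (haG.const_mul _)).liminf_eq

theorem IsWeakGrad.integral_mollify_sub_sq_le {u : Euc N → ℝ} {G : Euc N → Euc N}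
    (h : IsWeakGrad u G) (hu : MemLp u 2 volume) (hG : MemLp G 2 volume) (k : ℕ) :
    ∫ x, (mollify k u x - u x) ^ 2 ≤ (2 / ((k : ℝ) + 1)) ^ 2 * ∫ x, ‖G x‖ ^ 2 := by
  have hI : 0 ≤ ∫ x, ‖G x‖ ^ 2 := integral_nonneg fun x => by positivity
  have h1 := lintegral_mollify_sub_sq_le (u := u) k h.1
    (C := ENNReal.ofReal ((2 / ((k : ℝ) + 1)) ^ 2 * ∫ x, ‖G x‖ ^ 2)) fun t ht => by
      refine (h.lintegral_translate_sub_le hu hG t).trans (ENNReal.ofReal_le_ofReal ?_)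
      exact mul_le_mul_of_nonneg_right (pow_le_pow_left₀ (norm_nonneg _) ht.le 2) hI
  have h2 := (memLp_two_of_lintegral_le
    (((memLp_mollify k hu).1.sub hu).aestronglyMeasurable) (by positivity) h1).2
  simpa using h2

/-- An integrable weight bounded by `1`. -/
def decayWeight (N : ℕ) (x : Euc N) : ℝ := (1 + ‖x‖) ^ (-((N : ℝ) + 1))

theorem decayWeight_pos (x : Euc N) : 0 < decayWeight N x :=
  Real.rpow_pos_of_pos (by positivity) _

theorem decayWeight_le_one (x : Euc N) : decayWeight N x ≤ 1 :=
  Real.rpow_le_one_of_one_le_of_nonpos (by linarith [norm_nonneg x])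
    (by have : (0 : ℝ) ≤ N := by positivity
        linarith)

theorem integrable_decayWeight : Integrable (decayWeight N) :=
  integrable_one_add_norm (by simp)

theorem mollify_eq_integral_mul (k : ℕ) (u : Euc N → ℝ) (x : Euc N) :
    mollify k u x = ∫ y, u y * mollifier N k (x - y) := by
  rw [mollify, convolution_lsmul_swap]
  simp [mul_comm]

/-- Rellich: bounded sequences in `H¹` converging weakly in `L²` have subsequences converging
almost everywhere. -/
theorem exists_ae_convergent_subseq {u : ℕ → Euc N → ℝ} {G : ℕ → Euc N → Euc N}
    {w : Euc N → ℝ} {H : Euc N → Euc N} {M : ℝ}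
    (h : ∀ n, IsWeakGrad (u n) (G n)) (hu : ∀ n, MemLp (u n) 2 volume)
    (hG : ∀ n, MemLp (G n) 2 volume) (hw : IsWeakGrad w H) (hw2 : MemLp w 2 volume)
    (hH : MemLp H 2 volume) (huM : ∀ n, ∫ x, u n x ^ 2 ≤ M) (hGM : ∀ n, ∫ x, ‖G n x‖ ^ 2 ≤ M)
    (hweak : ∀ K : Euc N → ℝ, MemLp K 2 volume →
      Tendsto (fun n => ∫ x, u n x * K x) atTop (𝓝 (∫ x, w x * K x))) :
    ∃ σ : ℕ → ℕ, StrictMono σ ∧ ∀ᵐ x, Tendsto (fun n => u (σ n) x) atTop (𝓝 (w x)) := by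
  have isq : ∀ {a : Euc N → ℝ}, MemLp a 2 volume → Integrable fun x => a x ^ 2 := fun ha => by
    simpa using integrable_norm_sq ha
  have iw : ∀ {a : Euc N → ℝ}, MemLp a 2 volume →
      Integrable fun x => a x ^ 2 * decayWeight N x := fun ha => by
    refine (isq ha).mul_bdd (c := 1) integrable_decayWeight.aestronglyMeasurable
      (Eventually.of_forall fun x => ?_)
    rw [Real.norm_of_nonneg (decayWeight_pos x).le]
    exact decayWeight_le_one x
  -- For fixed k the mollification at x is an integral against a fixed L² function, so weak
  -- convergence gives pointwise convergence, with a bound uniform in x and n. The integrable weight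
  -- then permits dominated convergence on the whole space, with no exhaustion by balls.
  have hmid : ∀ k, Tendsto (fun n => ∫ x, (mollify k (u n) x - mollify k w x) ^ 2 * decayWeight N x)
      atTop (𝓝 0) := by
    intro k
    have hηc : ∀ x, HasCompactSupport fun y => mollifier N k (x - y) := fun x =>
      (hasCompactSupport_mollifier k).comp_homeomorph (Homeomorph.subLeft x)
    have hη : ∀ x, MemLp (fun y => mollifier N k (x - y)) 2 (volume : Measure (Euc N)) := fun x =>
      ((contDiff_mollifier k).continuous.comp (by fun_prop)).memLp_of_hasCompactSupport (hηc x)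
    set B : ℝ := ∫ y, mollifier N k y ^ 2 with hB
    have hBx : ∀ x, ∫ y, mollifier N k (x - y) ^ 2 = B := fun x =>
      integral_sub_left_eq_self (fun y => mollifier N k y ^ 2) volume x
    have hbd : ∀ (a : Euc N → ℝ) (A : ℝ), MemLp a 2 volume → (∫ x, a x ^ 2 ≤ A) →
        ∀ x, |mollify k a x| ≤ A + B := by
      intro a A ha hA x
      rw [mollify_eq_integral_mul, ← Real.norm_eq_abs]
      refine (norm_integral_le_integral_norm _).trans ?_
      calc ∫ y, ‖a y * mollifier N k (x - y)‖ ≤ ∫ y, (a y ^ 2 + mollifier N k (x - y) ^ 2) := by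
            refine integral_mono (ha.integrable_mul (hη x)).norm ((isq ha).add (isq (hη x))) fun y => ?_
            have := young_mul_le (a y) (mollifier N k (x - y)) one_pos
            rw [inv_one, one_mul, one_mul] at this
            rw [Real.norm_eq_abs]
            linarith
        _ = (∫ y, a y ^ 2) + B := by rw [integral_add (isq ha) (isq (hη x)), hBx]
        _ ≤ A + B := by linarith
    set A := max M (∫ x, w x ^ 2) with hA
    have key : Tendsto (fun n => ∫ x, (mollify k (u n) x - mollify k w x) ^ 2 * decayWeight N x)
        atTop (𝓝 (∫ _ : Euc N, (0 : ℝ))) := by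
      refine tendsto_integral_of_dominated_convergence
        (fun x => (2 * (A + B)) ^ 2 * decayWeight N x) (fun n => ?_)
        (integrable_decayWeight.const_mul _) (fun n => ?_) ?_
      · exact (iw ((memLp_mollify k (hu n)).1.sub (memLp_mollify k hw2).1)).aestronglyMeasurable
      · refine Eventually.of_forall fun x => ?_
        rw [norm_mul, Real.norm_of_nonneg (decayWeight_pos x).le, Real.norm_of_nonneg (sq_nonneg _)]
        refine mul_le_mul_of_nonneg_right ?_ (decayWeight_pos x).le
        rw [← sq_abs]
        refine pow_le_pow_left₀ (abs_nonneg _) ?_ 2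
        have h1 := hbd (u n) A (hu n) ((huM n).trans (le_max_left _ _)) x
        have h2 := hbd w A hw2 (le_max_right _ _) x
        exact (abs_sub _ _).trans (by linarith)
      · refine Eventually.of_forall fun x => ?_
        have h1 := hweak _ (hη x)
        simp only [← mollify_eq_integral_mul] at h1
        simpa using ((h1.sub_const (mollify k w x)).pow 2).mul_const (decayWeight N x)
    simpa using key
  have hlim : Tendsto (fun n => ∫ x, (u n x - w x) ^ 2 * decayWeight N x) atTop (𝓝 0) := by
    rw [Metric.tendsto_atTop]
    intro δ hδ
    set A := max M (∫ x, ‖H x‖ ^ 2) with hA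
    -- The mollification error is small uniformly in n, so k is fixed first and n chosen afterwards.
    -- The 6 is a factor 3, from splitting the square of a sum of three terms, for each of the two
    -- error terms.
    have hk : Tendsto (fun k : ℕ => 6 * ((2 / ((k : ℝ) + 1)) ^ 2 * A)) atTop (𝓝 0) := by
      have := (((tendsto_one_div_add_atTop_nhds_zero_nat (𝕜 := ℝ)).const_mul 2).pow 2).mul_const A
      simpa [div_eq_mul_inv] using this.const_mul 6
    obtain ⟨k, hk⟩ := (hk.eventually_lt_const (half_pos hδ)).exists
    obtain ⟨n₀, hn₀⟩ := eventually_atTop.1 ((hmid k).eventually_lt_const (show 0 < δ / 6 by positivity))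
    refine ⟨n₀, fun n hn => ?_⟩
    have m1 : MemLp (fun x => mollify k (u n) x - u n x) 2 volume :=
      (memLp_mollify k (hu n)).1.sub (hu n)
    have m2 : MemLp (fun x => mollify k (u n) x - mollify k w x) 2 volume :=
      (memLp_mollify k (hu n)).1.sub (memLp_mollify k hw2).1
    have m3 : MemLp (fun x => mollify k w x - w x) 2 volume := (memLp_mollify k hw2).1.sub hw2
    have b1 := ((h n).integral_mollify_sub_sq_le (hu n) (hG n) k).trans
      (mul_le_mul_of_nonneg_left ((hGM n).trans (le_max_left M (∫ x, ‖H x‖ ^ 2))) (sq_nonneg _))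
    have b3 := (hw.integral_mollify_sub_sq_le hw2 hH k).trans
      (mul_le_mul_of_nonneg_left (le_max_right M _) (sq_nonneg _))
    rw [Real.dist_eq, sub_zero, abs_of_nonneg
      (integral_nonneg fun x => mul_nonneg (sq_nonneg _) (decayWeight_pos x).le)]
    calc ∫ x, (u n x - w x) ^ 2 * decayWeight N x
        ≤ ∫ x, (3 * (mollify k (u n) x - u n x) ^ 2
          + 3 * ((mollify k (u n) x - mollify k w x) ^ 2 * decayWeight N x)
          + 3 * (mollify k w x - w x) ^ 2) := by
          refine integral_mono (iw ((hu n).sub hw2))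
            ((((isq m1).const_mul 3).add ((iw m2).const_mul 3)).add ((isq m3).const_mul 3))
            fun x => ?_
          have hp := decayWeight_pos x
          have h1 := decayWeight_le_one x
          have e1 : (u n x - w x) ^ 2 ≤ 3 * (mollify k (u n) x - u n x) ^ 2
              + 3 * (mollify k (u n) x - mollify k w x) ^ 2 + 3 * (mollify k w x - w x) ^ 2 := by
            nlinarith [sq_nonneg ((mollify k (u n) x - u n x) + (mollify k (u n) x - mollify k w x)),
              sq_nonneg ((mollify k (u n) x - u n x) + (mollify k w x - w x)),
              sq_nonneg ((mollify k (u n) x - mollify k w x) - (mollify k w x - w x))]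
          have e2 := mul_le_mul_of_nonneg_right e1 hp.le
          refine e2.trans ?_
          have e3 := mul_le_of_le_one_right (sq_nonneg (mollify k (u n) x - u n x)) h1
          have e4 := mul_le_of_le_one_right (sq_nonneg (mollify k w x - w x)) h1
          linarith
      _ = 3 * (∫ x, (mollify k (u n) x - u n x) ^ 2)
          + 3 * (∫ x, (mollify k (u n) x - mollify k w x) ^ 2 * decayWeight N x)
          + 3 * ∫ x, (mollify k w x - w x) ^ 2 := by
          have i12 : Integrable fun x => 3 * (mollify k (u n) x - u n x) ^ 2
              + 3 * ((mollify k (u n) x - mollify k w x) ^ 2 * decayWeight N x) :=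
            ((isq m1).const_mul 3).add ((iw m2).const_mul 3)
          rw [integral_add i12 ((isq m3).const_mul 3),
            integral_add ((isq m1).const_mul 3) ((iw m2).const_mul 3),
            integral_const_mul, integral_const_mul, integral_const_mul]
      _ < δ := by
          have := hn₀ n hn
          linarith
  have hint : ∀ n, Integrable fun x => (u n x - w x) ^ 2 * decayWeight N x := fun n =>
    iw ((hu n).sub hw2)
  have hmeas : TendstoInMeasure volume (fun n x => (u n x - w x) ^ 2 * decayWeight N x) atTop
      (fun _ => (0 : ℝ)) := by
    refine tendstoInMeasure_of_tendsto_eLpNorm (p := 1) one_ne_zero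
      (fun n => (hint n).aestronglyMeasurable) aestronglyMeasurable_const ?_
    have : ∀ n, eLpNorm ((fun x => (u n x - w x) ^ 2 * decayWeight N x) - fun _ => (0 : ℝ)) 1 volume
        = ENNReal.ofReal (∫ x, (u n x - w x) ^ 2 * decayWeight N x) := by
      intro n
      rw [show ((fun x => (u n x - w x) ^ 2 * decayWeight N x) - fun _ => (0 : ℝ))
        = fun x => (u n x - w x) ^ 2 * decayWeight N x from by ext; simp,
        eLpNorm_one_eq_lintegral_enorm, ← ofReal_integral_norm_eq_lintegral_enorm (hint n)]
      congr 1
      refine integral_congr_ae (Eventually.of_forall fun x => ?_)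
      exact Real.norm_of_nonneg (mul_nonneg (sq_nonneg _) (decayWeight_pos x).le)
    simp only [this]
    simpa [Function.comp_def] using (ENNReal.continuous_ofReal.tendsto _).comp hlim
  obtain ⟨σ, hσ, hae⟩ := hmeas.exists_seq_tendsto_ae
  refine ⟨σ, hσ, ?_⟩
  filter_upwards [hae] with x hx
  have h1 : Tendsto (fun n => (u (σ n) x - w x) ^ 2) atTop (𝓝 0) := by
    have := hx.div_const (decayWeight N x)
    simpa [mul_div_assoc, div_self (decayWeight_pos x).ne'] using this
  have h2 : Tendsto (fun n => |u (σ n) x - w x|) atTop (𝓝 0) := by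
    simpa [Real.sqrt_sq_eq_abs, Function.comp_def] using (Real.continuous_sqrt.tendsto _).comp h1
  exact tendsto_iff_norm_sub_tendsto_zero.2 h2

/-- Bounded sequences in `H¹` have subsequences that converge almost everywhere and whose
gradients converge weakly in `L²`. -/
theorem exists_H1_convergent_subseq {u : ℕ → Euc N → ℝ} {G : ℕ → Euc N → Euc N} {M : ℝ}
    (h : ∀ n, IsWeakGrad (u n) (G n)) (hu : ∀ n, MemLp (u n) 2 volume)
    (hG : ∀ n, MemLp (G n) 2 volume) (huM : ∀ n, ∫ x, u n x ^ 2 ≤ M)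
    (hGM : ∀ n, ∫ x, ‖G n x‖ ^ 2 ≤ M) :
    ∃ (w : Euc N → ℝ) (H : Euc N → Euc N) (σ : ℕ → ℕ), StrictMono σ ∧ IsWeakGrad w H ∧
      MemLp w 2 volume ∧ MemLp H 2 volume ∧
      (∀ᵐ x, Tendsto (fun n => u (σ n) x) atTop (𝓝 (w x))) ∧
      ∀ K : Euc N → Euc N, MemLp K 2 volume →
        Tendsto (fun n => ∫ x, inner ℝ (G (σ n) x) (K x)) atTop (𝓝 (∫ x, inner ℝ (H x) (K x))) := by
  obtain ⟨w, σ₁, hσ₁, hw2, hw⟩ := exists_weakly_convergent_subseq (M := M) hu (by simpa using huM)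
  obtain ⟨H, σ₂, hσ₂, hH2, hH⟩ := exists_weakly_convergent_subseq (u := fun n => G (σ₁ n))
    (M := M) (fun n => hG _) (fun n => hGM _)
  have hw' : ∀ K : Euc N → ℝ, MemLp K 2 volume →
      Tendsto (fun n => ∫ x, u (σ₁ (σ₂ n)) x * K x) atTop (𝓝 (∫ x, w x * K x)) := by
    intro K hK
    simpa [mul_comm, Function.comp_def] using (hw K hK).comp hσ₂.tendsto_atTop
  have hwH : IsWeakGrad w H := by
    refine ⟨hw2.locallyIntegrable (by norm_num), hH2.locallyIntegrable (by norm_num),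
      fun φ hφ hc e => ?_⟩
    have l1 := hw' (fun x => fderiv ℝ φ x e)
      (((hφ.continuous_fderiv (by simp)).clm_apply continuous_const).memLp_of_hasCompactSupport
        (hc.fderiv_apply ℝ e))
    have l2 := hH (fun x => φ x • e)
      ((hφ.continuous.smul continuous_const).memLp_of_hasCompactSupport hc.smul_right)
    simp only [inner_smul_right, mul_comm (φ _)] at l2
    exact tendsto_nhds_unique l1 (l2.neg.congr fun n => ((h _).2.2 φ hφ hc e).symm)
  obtain ⟨σ₃, hσ₃, hae⟩ := exists_ae_convergent_subseq (fun n => h (σ₁ (σ₂ n))) (fun n => hu _)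
    (fun n => hG _) hwH hw2 hH2 (fun n => huM _) (fun n => hGM _) hw'
  exact ⟨w, H, fun n => σ₁ (σ₂ (σ₃ n)), hσ₁.comp (hσ₂.comp hσ₃), hwH, hw2, hH2, hae,
    fun K hK => (hH K hK).comp hσ₃.tendsto_atTop⟩

end Rellich

/-! ### Estimates for the change of variables -/

section ChangeVar

variable {m : ℝ}

/-- The derivative of `changeVarInv`. -/
def weight (m u : ℝ) : ℝ := Real.sqrt (1 + m * |u| ^ (2 * (m - 1)))

/-- The derivative of the change of variables. -/
def changeVarDeriv (m t : ℝ) : ℝ := (weight m (changeVar m t))⁻¹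

/-- The function `f / f'`. -/
def changeVarQuot (m t : ℝ) : ℝ := changeVar m t * weight m (changeVar m t)

/-- The derivative of `f / f'`. -/
def changeVarQuotDeriv (m t : ℝ) : ℝ :=
  1 + m * (m - 1) * |changeVar m t| ^ (2 * (m - 1)) / weight m (changeVar m t) ^ 2

theorem one_le_weight' (hm : 1 < m) (u : ℝ) : 1 ≤ weight m u := one_le_weight hm u

theorem weight_pos (hm : 1 < m) (u : ℝ) : 0 < weight m u :=
  one_pos.trans_le (one_le_weight hm u)

theorem weight_sq (hm : 1 < m) (u : ℝ) : weight m u ^ 2 = 1 + m * |u| ^ (2 * (m - 1)) :=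
  Real.sq_sqrt (by have := Real.rpow_nonneg (abs_nonneg u) (2 * (m - 1)); nlinarith)

theorem rpow_two_mul_sub {u : ℝ} (hu : 0 ≤ u) (m : ℝ) : |u| ^ (2 * (m - 1)) = (u ^ (m - 1)) ^ 2 := by
  rw [abs_of_nonneg hu, ← Real.rpow_natCast, ← Real.rpow_mul hu]
  congr 1
  push_cast
  ring

theorem sqrt_mul_rpow_le_weight (hm : 1 < m) {u : ℝ} (hu : 0 ≤ u) :
    √m * u ^ (m - 1) ≤ weight m u := by
  refine Real.le_sqrt_of_sq_le ?_
  rw [mul_pow, Real.sq_sqrt (by linarith), rpow_two_mul_sub hu]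
  linarith

theorem weight_le (hm : 1 < m) {u : ℝ} (hu : 0 ≤ u) : weight m u ≤ 1 + √m * u ^ (m - 1) := by
  have h1 : 0 ≤ √m * u ^ (m - 1) := mul_nonneg (Real.sqrt_nonneg _) (Real.rpow_nonneg hu _)
  refine Real.sqrt_le_iff.2 ⟨by linarith, ?_⟩
  rw [rpow_two_mul_sub hu, add_sq, mul_pow, Real.sq_sqrt (by linarith)]
  linarith

/-- At 0 the chain rule is not available, since |u|^(2(m−1)) is not differentiable there when 2(m−1)
≤ 1. The difference quotient of u ↦ u · `weight m u` at 0 is the weight itself, which is continuous.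
-/
theorem hasDerivAt_mul_weight (hm : 1 < m) (u : ℝ) : HasDerivAt (fun u => u * weight m u)
    (weight m u + m * (m - 1) * |u| ^ (2 * (m - 1)) / weight m u) u := by
  rcases eq_or_ne u 0 with rfl | hu
  · have h0 : (0 : ℝ) ^ (2 * (m - 1)) = 0 := Real.zero_rpow (by linarith)
    have h : HasDerivAt (fun u => u * weight m u) (weight m 0) 0 := by
      rw [hasDerivAt_iff_tendsto_slope]
      have hc : Tendsto (weight m) (𝓝[≠] 0) (𝓝 (weight m 0)) :=
        ((continuous_weight hm).tendsto 0).mono_left nhdsWithin_le_nhds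
      refine hc.congr' ?_
      filter_upwards [self_mem_nhdsWithin] with x hx
      rw [slope_def_field]
      simp only [zero_mul, sub_zero]
      rw [mul_div_cancel_left₀ _ hx]
    simpa [h0] using h
  · have hW := weight_pos hm u
    have h1 : HasDerivAt (fun u : ℝ => |u| ^ (2 * (m - 1)))
        (SignType.sign u * (2 * (m - 1)) * |u| ^ (2 * (m - 1) - 1)) u :=
      (hasDerivAt_abs hu).rpow_const (Or.inl (abs_ne_zero.2 hu))
    have h2 := ((h1.const_mul m).const_add 1).sqrt
      (by have := Real.rpow_nonneg (abs_nonneg u) (2 * (m - 1)); nlinarith)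
    have h3 := (hasDerivAt_id u).mul h2
    convert! h3 using 1
    change _ = 1 * weight m u + u * (_ / (2 * weight m u))
    have h4 : u * (SignType.sign u : ℝ) = |u| := self_mul_sign u
    have h5 : |u| ^ (2 * (m - 1) - 1) * |u| = |u| ^ (2 * (m - 1)) := by
      rw [← Real.rpow_add_one (abs_ne_zero.2 hu)]
      congr 1
      ring
    rw [one_mul, ← h5, ← h4]
    field_simp

/-! ### Comparison of the change of variables with powers -/

theorem changeVarInv_zero (m : ℝ) : changeVarInv m 0 = 0 := by simp [changeVarInv]

theorem nonneg_of_deriv_nonneg {D D' : ℝ → ℝ} (hD : ∀ u, 0 ≤ u → HasDerivAt D (D' u) u)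
    (h0 : D 0 = 0) (h : ∀ u, 0 ≤ u → 0 ≤ D' u) {u : ℝ} (hu : 0 ≤ u) : 0 ≤ D u := by
  have hmono : MonotoneOn D (Set.Ici 0) := by
    refine monotoneOn_of_deriv_nonneg (convex_Ici 0)
      (fun x hx => (hD x hx).continuousAt.continuousWithinAt)
      (fun x hx => (hD x (interior_subset hx)).differentiableAt.differentiableWithinAt)
      fun x hx => ?_
    rw [(hD x (interior_subset hx)).deriv]
    exact h x (interior_subset hx)
  rw [← h0]
  exact hmono (Set.mem_Ici.2 le_rfl) hu hu

theorem hasDerivAt_rpow_div_sqrt (hm : 1 < m) (u : ℝ) :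
    HasDerivAt (fun u => u ^ m / √m) (√m * u ^ (m - 1)) u := by
  have h := (Real.hasDerivAt_rpow_const (x := u) (Or.inr hm.le)).div_const (√m)
  have hs : √m ≠ 0 := (Real.sqrt_pos.2 (by linarith)).ne'
  have he : √m * u ^ (m - 1) = m * u ^ (m - 1) / √m := by
    rw [eq_div_iff hs, mul_right_comm, Real.mul_self_sqrt (by linarith)]
  rwa [he]

/-- Integrate √m u^(m−1) ≤ `weight m u`; the companion upper bound integrates 1 + √m u^(m−1). Read
through the inverse, the two say f^m ≤ √m t and t ≤ f + f^m/√m for t ≥ 0. -/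
theorem rpow_div_sqrt_le_changeVarInv (hm : 1 < m) {u : ℝ} (hu : 0 ≤ u) :
    u ^ m / √m ≤ changeVarInv m u := by
  have := nonneg_of_deriv_nonneg (D := fun u => changeVarInv m u - u ^ m / √m)
    (fun u _ => (hasDerivAt_changeVarInv hm u).sub (hasDerivAt_rpow_div_sqrt hm u))
    (by simp [changeVarInv_zero, Real.zero_rpow (by linarith : m ≠ 0)])
    (fun u hu => sub_nonneg.2 (sqrt_mul_rpow_le_weight hm hu)) hu
  linarith

theorem changeVarInv_le_add (hm : 1 < m) {u : ℝ} (hu : 0 ≤ u) :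
    changeVarInv m u ≤ u + u ^ m / √m := by
  have := nonneg_of_deriv_nonneg (D := fun u => u + u ^ m / √m - changeVarInv m u)
    (fun u _ => ((hasDerivAt_id u).add (hasDerivAt_rpow_div_sqrt hm u)).sub
      (hasDerivAt_changeVarInv hm u))
    (by simp [changeVarInv_zero, Real.zero_rpow (by linarith : m ≠ 0)])
    (fun u hu => sub_nonneg.2 (weight_le hm hu)) hu
  linarith

theorem changeVar_zero (m : ℝ) (hm : 1 < m) : changeVar m 0 = 0 := (changeVar_spec hm).1

theorem changeVar_neg (hm : 1 < m) (t : ℝ) : changeVar m (-t) = -changeVar m t := by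
  refine (strictMono_changeVarInv hm).injective ?_
  rw [changeVarInv_neg, changeVarInv_changeVar hm, changeVarInv_changeVar hm]

theorem strictMono_changeVar (hm : 1 < m) : StrictMono (changeVar m) := by
  intro s t hst
  rw [← (strictMono_changeVarInv hm).lt_iff_lt, changeVarInv_changeVar hm,
    changeVarInv_changeVar hm]
  exact hst

theorem changeVar_pos (hm : 1 < m) {t : ℝ} (ht : 0 < t) : 0 < changeVar m t := by
  have := strictMono_changeVar hm ht
  rwa [changeVar_zero m hm] at this

theorem changeVar_nonneg (hm : 1 < m) {t : ℝ} (ht : 0 ≤ t) : 0 ≤ changeVar m t := by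
  have := (strictMono_changeVar hm).monotone ht
  rwa [changeVar_zero m hm] at this

theorem changeVar_nonpos (hm : 1 < m) {t : ℝ} (ht : t ≤ 0) : changeVar m t ≤ 0 := by
  have := (strictMono_changeVar hm).monotone ht
  rwa [changeVar_zero m hm] at this

theorem abs_changeVar (hm : 1 < m) (t : ℝ) : |changeVar m t| = changeVar m |t| := by
  rcases le_total 0 t with h | h
  · rw [abs_of_nonneg h, abs_of_nonneg (changeVar_nonneg hm h)]
  · rw [abs_of_nonpos h, abs_of_nonpos (changeVar_nonpos hm h), changeVar_neg hm]

theorem changeVarDeriv_pos (hm : 1 < m) (t : ℝ) : 0 < changeVarDeriv m t :=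
  inv_pos.2 (weight_pos hm _)

theorem changeVarDeriv_le_one (hm : 1 < m) (t : ℝ) : changeVarDeriv m t ≤ 1 :=
  inv_le_one_of_one_le₀ (one_le_weight' hm _)

theorem continuous_changeVarDeriv (hm : 1 < m) : Continuous (changeVarDeriv m) :=
  ((continuous_weight hm).comp (continuous_changeVar hm)).inv₀ fun _ => (weight_pos hm _).ne'

theorem hasDerivAt_changeVar' (hm : 1 < m) (t : ℝ) :
    HasDerivAt (changeVar m) (changeVarDeriv m t) t := by
  have := hasDerivAt_changeVar hm t
  rwa [← weight_inv hm] at this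

theorem abs_changeVar_le (hm : 1 < m) (t : ℝ) : |changeVar m t| ≤ |t| := by
  have := abs_le_of_deriv_bound (hasDerivAt_changeVar' hm) (C := 1) (fun s => by
    rw [abs_of_pos (changeVarDeriv_pos hm s)]
    exact changeVarDeriv_le_one hm s) (changeVar_zero m hm) t
  simpa using this

theorem changeVar_le_self (hm : 1 < m) {t : ℝ} (ht : 0 ≤ t) : changeVar m t ≤ t := by
  have := abs_changeVar_le hm t
  rwa [abs_of_nonneg ht, abs_of_nonneg (changeVar_nonneg hm ht)] at this

theorem changeVar_rpow_le (hm : 1 < m) {t : ℝ} (ht : 0 ≤ t) : changeVar m t ^ m ≤ √m * t := by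
  have h := rpow_div_sqrt_le_changeVarInv hm (changeVar_nonneg hm ht)
  rw [changeVarInv_changeVar hm, div_le_iff₀ (Real.sqrt_pos.2 (by linarith))] at h
  linarith

theorem le_changeVar_add (hm : 1 < m) {t : ℝ} (ht : 0 ≤ t) :
    t ≤ changeVar m t + changeVar m t ^ m / √m := by
  have h := changeVarInv_le_add hm (changeVar_nonneg hm ht)
  rwa [changeVarInv_changeVar hm] at h

theorem changeVar_rpow_mul_deriv_le (hm : 1 < m) {t : ℝ} (ht : 0 ≤ t) :
    √m * changeVar m t ^ (m - 1) * changeVarDeriv m t ≤ 1 := by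
  rw [changeVarDeriv, ← div_eq_mul_inv, div_le_one (weight_pos hm _)]
  exact sqrt_mul_rpow_le_weight hm (changeVar_nonneg hm ht)

theorem changeVarQuotDeriv_eq_add (hm : 1 < m) (t : ℝ) : changeVarQuotDeriv m t =
    1 + m * (m - 1) * |changeVar m t| ^ (2 * (m - 1)) / (1 + m * |changeVar m t| ^ (2 * (m - 1))) := by
  rw [changeVarQuotDeriv, weight_sq hm]

theorem hasDerivAt_changeVarQuot (hm : 1 < m) (t : ℝ) :
    HasDerivAt (changeVarQuot m) (changeVarQuotDeriv m t) t := by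
  have h := (hasDerivAt_mul_weight hm (changeVar m t)).comp t (hasDerivAt_changeVar' hm t)
  convert! h using 1
  have := weight_pos hm (changeVar m t)
  rw [changeVarQuotDeriv, changeVarDeriv]
  field_simp

theorem one_le_changeVarQuotDeriv (hm : 1 < m) (t : ℝ) : 1 ≤ changeVarQuotDeriv m t := by
  have h2 := Real.rpow_nonneg (abs_nonneg (changeVar m t)) (2 * (m - 1))
  have h3 : 0 ≤ m * (m - 1) * |changeVar m t| ^ (2 * (m - 1)) / weight m (changeVar m t) ^ 2 :=
    div_nonneg (mul_nonneg (mul_nonneg (by linarith) (by linarith)) h2) (sq_nonneg _)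
  rw [changeVarQuotDeriv]
  linarith

/-- With x = |f|^(2(m−1)), this is m(m−1)x/(1+mx) ≤ m − 1. The bound m is why the gradient
coefficient in the energy estimate is 1/2 − m/θ. -/
theorem changeVarQuotDeriv_le (hm : 1 < m) (t : ℝ) : changeVarQuotDeriv m t ≤ m := by
  have h2 := Real.rpow_nonneg (abs_nonneg (changeVar m t)) (2 * (m - 1))
  rw [changeVarQuotDeriv_eq_add hm, ← le_sub_iff_add_le', div_le_iff₀ (by nlinarith)]
  nlinarith

theorem continuous_changeVarQuotDeriv (hm : 1 < m) : Continuous (changeVarQuotDeriv m) := by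
  have hf := continuous_changeVar hm
  have h1 : Continuous fun t => |changeVar m t| ^ (2 * (m - 1)) :=
    hf.abs.rpow_const fun _ => Or.inr (by linarith)
  exact continuous_const.add ((continuous_const.mul h1).div
    (((continuous_weight hm).comp hf).pow 2) fun t => (pow_pos (weight_pos hm _) 2).ne')

theorem changeVarQuot_zero (hm : 1 < m) : changeVarQuot m 0 = 0 := by
  rw [changeVarQuot, changeVar_zero m hm, zero_mul]

theorem changeVarDeriv_mul_quot (hm : 1 < m) (t : ℝ) :
    changeVarDeriv m t * changeVarQuot m t = changeVar m t := by
  rw [changeVarDeriv, changeVarQuot, mul_comm, mul_assoc, mul_inv_cancel₀ (weight_pos hm _).ne',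
    mul_one]

theorem abs_changeVarQuot_le (hm : 1 < m) (t : ℝ) : |changeVarQuot m t| ≤ m * |t| := by
  refine abs_le_of_deriv_bound (hasDerivAt_changeVarQuot hm) (fun t => ?_)
    (changeVarQuot_zero hm) t
  rw [abs_of_nonneg (zero_le_one.trans (one_le_changeVarQuotDeriv hm t))]
  exact changeVarQuotDeriv_le hm t

theorem changeVar_le_mul_deriv (hm : 1 < m) {t : ℝ} (ht : 0 ≤ t) :
    changeVar m t ≤ m * t * changeVarDeriv m t := by
  have h1 := (le_abs_self _).trans (abs_changeVarQuot_le hm t)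
  rw [abs_of_nonneg ht] at h1
  rw [← changeVarDeriv_mul_quot hm, mul_comm]
  exact mul_le_mul_of_nonneg_right h1 (changeVarDeriv_pos hm t).le

/-- As long as f(|s|) ≤ 1, one has |s| ≤ f + f^m/√m ≤ 2f; otherwise 1 ≤ f already. Thus f(v)
controls v in the quadratic sense wherever v is small, in spite of its sublinear growth. -/
theorem min_abs_one_le (hm : 1 < m) (s : ℝ) : min |s| 1 ≤ 2 * |changeVar m s| := by
  rw [abs_changeVar hm]
  have hs := abs_nonneg s
  have hu := changeVar_nonneg hm hs
  rcases le_total 1 (changeVar m |s|) with h | h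
  · exact (min_le_right _ _).trans (by linarith)
  · refine (min_le_left _ _).trans ((le_changeVar_add hm hs).trans ?_)
    have h1 : changeVar m |s| ^ m ≤ changeVar m |s| := by
      calc _ ≤ changeVar m |s| ^ (1 : ℝ) := Real.rpow_le_rpow_of_exponent_ge' hu h zero_le_one hm.le
        _ = _ := Real.rpow_one _
    have h2 : changeVar m |s| ^ m / √m ≤ changeVar m |s| ^ m :=
      div_le_self (Real.rpow_nonneg hu _) (Real.one_le_sqrt.2 hm.le)
    linarith

/-- Split f^(pm−1) = (f^m)^(p−1) f^(m−1) and use f^m ≤ √m t with √m f^(m−1) f' ≤ 1; the powers of m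
combine to (p−1)/2 − 1/2. The exact constant is essential: it produces the factor 1/m in the
critical level. -/
theorem changeVar_critical_le (hm : 1 < m) {p : ℝ} (hp : 2 < p) {t : ℝ} (ht : 0 ≤ t) :
    changeVar m t ^ (p * m - 1) * changeVarDeriv m t ≤ m ^ (p / 2 - 1) * t ^ (p - 1) := by
  have hu := changeVar_nonneg hm ht
  have hm0 : 0 < m := by linarith
  have hs : 0 < √m := Real.sqrt_pos.2 hm0
  have h1 : changeVar m t ^ (p * m - 1) = (changeVar m t ^ m) ^ (p - 1) * changeVar m t ^ (m - 1) := by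
    rw [← Real.rpow_mul hu, ← Real.rpow_add_of_nonneg hu (by nlinarith) (by linarith)]
    congr 1
    ring
  have h2 : (changeVar m t ^ m) ^ (p - 1) ≤ (√m * t) ^ (p - 1) :=
    Real.rpow_le_rpow (Real.rpow_nonneg hu _) (changeVar_rpow_le hm ht) (by linarith)
  have h3 : changeVar m t ^ (m - 1) * changeVarDeriv m t ≤ (√m)⁻¹ := by
    rw [← one_div, le_div_iff₀ hs]
    linarith [changeVar_rpow_mul_deriv_le hm ht]
  have h4 : (√m * t) ^ (p - 1) * (√m)⁻¹ = m ^ (p / 2 - 1) * t ^ (p - 1) := by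
    rw [Real.mul_rpow hs.le ht, Real.sqrt_eq_rpow, ← Real.rpow_mul hm0.le, ← Real.rpow_neg hm0.le,
      mul_right_comm, ← Real.rpow_add hm0]
    congr 2
    ring
  rw [h1, mul_assoc, ← h4]
  exact mul_le_mul h2 h3 (mul_nonneg (Real.rpow_nonneg hu _) (changeVarDeriv_pos hm t).le)
    (Real.rpow_nonneg (by positivity) _)

/-- Insert t ≤ f + f^m/√m; each resulting product contains √m f^(m−1) f' ≤ 1. The energy contains
f^(pm) while testing with v yields f^(pm−1) f' v, and this compares the two. The error has exponent
below pm because m > 1, so it is a lower order term. -/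
theorem changeVar_critical_defect (hm : 1 < m) (p : ℝ) {t : ℝ} (ht : 0 ≤ t) :
    m * (changeVar m t ^ (p * m - 1) * changeVarDeriv m t * t) ≤
      changeVar m t ^ (p * m) + √m * changeVar m t ^ (p * m - m + 1) := by
  have hm0 : 0 < m := by linarith
  have hs : 0 < √m := Real.sqrt_pos.2 hm0
  have hss : √m * √m = m := Real.mul_self_sqrt hm0.le
  rcases ht.eq_or_lt with rfl | ht'
  · rw [changeVar_zero m hm, mul_zero, mul_zero]
    exact add_nonneg (Real.rpow_nonneg le_rfl _) (mul_nonneg hs.le (Real.rpow_nonneg le_rfl _))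
  have hu := changeVar_pos hm ht'
  set u := changeVar m t with hudef
  set d := changeVarDeriv m t with hd
  have hd0 : 0 < d := changeVarDeriv_pos hm t
  have h1 : √m * u ^ (m - 1) * d ≤ 1 := changeVar_rpow_mul_deriv_le hm ht
  have h2 : t ≤ u + u ^ m / √m := le_changeVar_add hm ht
  have h3 : m * (d * t) ≤ m * d * u + √m * u ^ m * d := by
    have h4 : m * d * t ≤ m * d * (u + u ^ m / √m) :=
      mul_le_mul_of_nonneg_left h2 (by positivity)
    have h5 : m * d * (u ^ m / √m) = √m * u ^ m * d := by
      field_simp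
      rw [sq, hss]
    linarith
  have e1 : u ^ (p * m - 1) * u = u ^ (p * m) := by
    rw [← Real.rpow_add_one hu.ne']
    congr 1
    ring
  have e2 : u ^ (p * m - 1) * u = u ^ (p * m - m + 1) * u ^ (m - 1) := by
    rw [← Real.rpow_add_one hu.ne', ← Real.rpow_add hu]
    congr 1
    ring
  have e3 : u ^ m = u ^ (m - 1) * u := by
    rw [← Real.rpow_add_one hu.ne']
    congr 1
    ring
  have hA := Real.rpow_pos_of_pos hu (p * m - m + 1)
  have hB := Real.rpow_pos_of_pos hu (p * m)
  calc m * (u ^ (p * m - 1) * d * t) = u ^ (p * m - 1) * (m * (d * t)) := by ring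
    _ ≤ u ^ (p * m - 1) * (m * d * u + √m * u ^ m * d) :=
        mul_le_mul_of_nonneg_left h3 (Real.rpow_nonneg hu.le _)
    _ = (u ^ (p * m - 1) * u) * (√m * √m * d) + (u ^ (p * m - 1) * u) * (√m * u ^ (m - 1) * d) := by
        rw [e3, hss]
        ring
    _ = √m * u ^ (p * m - m + 1) * (√m * u ^ (m - 1) * d)
        + u ^ (p * m) * (√m * u ^ (m - 1) * d) := by
        rw [e1, ← e1, e2]
        ring
    _ ≤ √m * u ^ (p * m - m + 1) * 1 + u ^ (p * m) * 1 := by gcongr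
    _ = _ := by ring

/-- Interpolation between powers. -/
theorem exists_rpow_le_add {a r b η : ℝ} (ha : 0 ≤ a) (har : a ≤ r) (hrb : r < b) (hη : 0 < η) :
    ∃ C, 0 ≤ C ∧ ∀ u : ℝ, 0 ≤ u → u ^ r ≤ C * u ^ a + η * u ^ b := by
  -- K is where η u^(b−r) = 1: beyond it u^r ≤ η u^b, and below it u^(r−a) ≤ K^(r−a).
  set K : ℝ := (η⁻¹) ^ (b - r)⁻¹ with hK
  have hK0 : 0 < K := Real.rpow_pos_of_pos (inv_pos.2 hη) _
  refine ⟨K ^ (r - a), Real.rpow_nonneg hK0.le _, fun u hu => ?_⟩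
  have n1 : 0 ≤ K ^ (r - a) * u ^ a := mul_nonneg (Real.rpow_nonneg hK0.le _) (Real.rpow_nonneg hu _)
  have n2 : 0 ≤ η * u ^ b := mul_nonneg hη.le (Real.rpow_nonneg hu _)
  rcases le_total u K with h | h
  · have : u ^ r = u ^ (r - a) * u ^ a := by
      rw [← Real.rpow_add_of_nonneg hu (by linarith) ha, sub_add_cancel]
    have h2 : u ^ r ≤ K ^ (r - a) * u ^ a := by
      rw [this]
      exact mul_le_mul_of_nonneg_right (Real.rpow_le_rpow hu h (by linarith)) (Real.rpow_nonneg hu _)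
    linarith
  · have h1 : η⁻¹ ≤ u ^ (b - r) := by
      have := Real.rpow_le_rpow hK0.le h (by linarith : 0 ≤ b - r)
      rwa [hK, ← Real.rpow_mul (inv_pos.2 hη).le, inv_mul_cancel₀ (by linarith), Real.rpow_one] at this
    have : u ^ b = u ^ (b - r) * u ^ r := by
      rw [← Real.rpow_add_of_nonneg hu (by linarith) (by linarith), sub_add_cancel]
    have h2 : u ^ r ≤ η * u ^ b := by
      rw [this, ← mul_assoc]
      refine le_mul_of_one_le_left (Real.rpow_nonneg hu _) ?_
      rwa [inv_le_iff_one_le_mul₀' hη] at h1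
    linarith

end ChangeVar

/-! ### The penalized nonlinearity -/

/-- The standing assumptions on the parameters of the nonlinearity. -/
structure Admissible (N : ℕ) (m q lam V₀ κ : ℝ) : Prop where
  three_le : 3 ≤ N
  one_lt : 1 < m
  lam_pos : 0 < lam
  lt_q : 2 * m < q
  q_lt : q < twoStar N * m
  slope_pos : 0 < V₀ / κ

section Nonlinearity

variable {N : ℕ} {m q lam V₀ κ : ℝ}

namespace Admissible

theorem two_lt (h : Admissible N m q lam V₀ κ) : 2 < twoStar N := (twoStar_eq h.three_le).2

theorem two_lt_q (h : Admissible N m q lam V₀ κ) : 2 < q := by linarith [h.one_lt, h.lt_q]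

theorem two_lt_crit (h : Admissible N m q lam V₀ κ) : 2 < twoStar N * m := by
  linarith [h.two_lt_q, h.q_lt]

end Admissible

theorem gammaFun_of_nonneg (h : Admissible N m q lam V₀ κ) {s : ℝ} (hs : 0 ≤ s) :
    gammaFun N m q lam s = lam * s ^ (q - 1) + s ^ (twoStar N * m - 1) := by
  have h1 := h.two_lt_q
  have h2 := h.two_lt_crit
  rcases hs.eq_or_lt with rfl | hs'
  · rw [gammaFun, if_neg (lt_irrefl _), Real.zero_rpow (by linarith), Real.zero_rpow (by linarith)]
    simp
  · rw [gammaFun, if_pos hs', gFun, abs_of_pos hs', mul_assoc, ← Real.rpow_add_one hs'.ne',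
      ← Real.rpow_add_one hs'.ne']
    ring_nf

theorem gammaFun_of_nonpos {s : ℝ} (hs : s ≤ 0) : gammaFun N m q lam s = 0 :=
  if_neg (not_lt.2 hs)

theorem gammaFun_eq_max (h : Admissible N m q lam V₀ κ) (s : ℝ) : gammaFun N m q lam s =
    lam * (max s 0) ^ (q - 1) + (max s 0) ^ (twoStar N * m - 1) := by
  rw [← gammaFun_of_nonneg h (le_max_right s 0)]
  rcases le_total s 0 with hs | hs
  · rw [max_eq_right hs, gammaFun_of_nonpos hs, gammaFun_of_nonpos le_rfl]
  · rw [max_eq_left hs]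

theorem continuous_gammaFun (h : Admissible N m q lam V₀ κ) : Continuous (gammaFun N m q lam) := by
  have h1 := h.two_lt_q
  have h2 := h.two_lt_crit
  rw [funext (gammaFun_eq_max h)]
  have hc : Continuous fun s : ℝ => max s 0 := continuous_id.max continuous_const
  exact (continuous_const.mul (hc.rpow_const fun _ => Or.inr (by linarith))).add
    (hc.rpow_const fun _ => Or.inr (by linarith))

theorem gammaFun_nonneg (h : Admissible N m q lam V₀ κ) (s : ℝ) : 0 ≤ gammaFun N m q lam s := by
  rw [gammaFun_eq_max h]
  have := h.lam_pos
  have h0 := le_max_right s 0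
  exact add_nonneg (mul_nonneg this.le (Real.rpow_nonneg h0 _)) (Real.rpow_nonneg h0 _)

/-- The cut-off level is the positive solution of `g(l) = (V₀/κ) l`. -/
theorem cutLevel_spec (h : Admissible N m q lam V₀ κ) : 0 < cutLevel N m q lam V₀ κ ∧
    gammaFun N m q lam (cutLevel N m q lam V₀ κ) = V₀ / κ * cutLevel N m q lam V₀ κ ∧
    ∀ s, 0 ≤ s → s ≤ cutLevel N m q lam V₀ κ → gammaFun N m q lam s ≤ V₀ / κ * s := by
  have h1 := h.two_lt_q
  have h2 := h.two_lt_crit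
  have hlam := h.lam_pos
  have hν := h.slope_pos
  -- This is g(t)/t for t ≥ 0, with value 0 at 0. It increases strictly from 0 to infinity, so the
  -- set defining the cut-off level is `Set.Ioc 0 l` with r l = V₀/κ. The equality at l is what
  -- makes γ̄ continuous.
  set r : ℝ → ℝ := fun t => lam * t ^ (q - 2) + t ^ (twoStar N * m - 2) with hr
  have hr0 : r 0 = 0 := by
    simp only [hr]
    rw [Real.zero_rpow (by linarith), Real.zero_rpow (by linarith)]
    simp
  have hrc : Continuous r := (continuous_const.mul (continuous_id.rpow_const fun _ =>
    Or.inr (by linarith))).add (continuous_id.rpow_const fun _ => Or.inr (by linarith))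
  have hrm : ∀ s t, 0 ≤ s → s < t → r s < r t := fun s t hs hst =>
    add_lt_add (mul_lt_mul_of_pos_left (Real.rpow_lt_rpow hs hst (by linarith)) hlam)
      (Real.rpow_lt_rpow hs hst (by linarith))
  have hquot : ∀ t, 0 ≤ t → gFun N m q lam t / t = r t := by
    intro t ht
    rcases ht.eq_or_lt with rfl | ht'
    · rw [div_zero, hr0]
    · rw [div_eq_iff ht'.ne', gFun, abs_of_pos ht']
      simp only [hr]
      ring
  have hγ : ∀ t, 0 ≤ t → gammaFun N m q lam t = r t * t := by
    intro t ht
    rcases ht.eq_or_lt with rfl | ht'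
    · rw [gammaFun_of_nonpos le_rfl, mul_zero]
    · rw [← hquot t ht, div_mul_cancel₀ _ ht'.ne', gammaFun, if_pos ht']
  obtain ⟨b, hb0, hb⟩ : ∃ b, 0 ≤ b ∧ V₀ / κ ≤ r b := by
    have ht : Tendsto (fun t : ℝ => lam * t ^ (q - 2)) atTop atTop :=
      (tendsto_rpow_atTop (by linarith)).const_mul_atTop hlam
    obtain ⟨b, hb1, hb2⟩ := ((ht.eventually_ge_atTop (V₀ / κ)).and (eventually_ge_atTop 0)).exists
    refine ⟨b, hb2, hb1.trans ?_⟩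
    have := Real.rpow_nonneg hb2 (twoStar N * m - 2)
    simp only [hr]
    linarith
  obtain ⟨l, ⟨hl0, -⟩, hl⟩ := intermediate_value_Icc hb0 hrc.continuousOn
    (show V₀ / κ ∈ Set.Icc (r 0) (r b) from ⟨by rw [hr0]; exact hν.le, hb⟩)
  have hlpos : 0 < l := by
    rcases hl0.eq_or_lt with rfl | h'
    · rw [hr0] at hl
      linarith
    · exact h'
  have hset : {s : ℝ | 0 < s ∧ ∀ t, 0 ≤ t → t ≤ s → gFun N m q lam t / t ≤ V₀ / κ}
      = Set.Ioc 0 l := by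
    ext s
    constructor
    · rintro ⟨hs, hs'⟩
      refine ⟨hs, not_lt.1 fun hls => ?_⟩
      have h3 := hs' s hs.le le_rfl
      rw [hquot s hs.le, ← hl] at h3
      linarith [hrm l s hl0 hls]
    · rintro ⟨hs, hsl⟩
      refine ⟨hs, fun t ht hts => ?_⟩
      rw [hquot t ht, ← hl]
      rcases (hts.trans hsl).eq_or_lt with rfl | h'
      · exact le_rfl
      · exact (hrm t l ht h').le
  have hcut : cutLevel N m q lam V₀ κ = l := by
    rw [cutLevel, hset, csSup_Ioc hlpos]
  rw [hcut]
  refine ⟨hlpos, by rw [hγ l hl0, hl], fun s hs hsl => ?_⟩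
  rw [hγ s hs]
  refine mul_le_mul_of_nonneg_right ?_ hs
  rw [← hl]
  rcases hsl.eq_or_lt with rfl | h'
  · exact le_rfl
  · exact (hrm s l hs h').le

theorem gammaBar_of_nonpos (h : Admissible N m q lam V₀ κ) {s : ℝ} (hs : s ≤ 0) :
    gammaBar N m q lam V₀ κ s = 0 := by
  rw [gammaBar, if_pos (hs.trans (cutLevel_spec h).1.le), gammaFun_of_nonpos hs]

theorem gammaBar_le (h : Admissible N m q lam V₀ κ) {s : ℝ} (hs : 0 ≤ s) :
    gammaBar N m q lam V₀ κ s ≤ V₀ / κ * s := by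
  rw [gammaBar]
  split_ifs with hl
  · exact (cutLevel_spec h).2.2 s hs hl
  · exact le_rfl

theorem gammaBar_nonneg (h : Admissible N m q lam V₀ κ) (s : ℝ) :
    0 ≤ gammaBar N m q lam V₀ κ s := by
  rw [gammaBar]
  split_ifs with hl
  · exact gammaFun_nonneg h s
  · exact mul_nonneg h.slope_pos.le ((cutLevel_spec h).1.le.trans (not_le.1 hl).le)

theorem continuous_gammaBar (h : Admissible N m q lam V₀ κ) :
    Continuous (gammaBar N m q lam V₀ κ) := by
  refine Continuous.if_le (continuous_gammaFun h) (continuous_const.mul continuous_id)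
    continuous_id continuous_const ?_
  rintro s rfl
  exact (cutLevel_spec h).2.1

/-- The primitive of `γ`. -/
def gammaPrim (N : ℕ) (m q lam s : ℝ) : ℝ := ∫ t in (0 : ℝ)..s, gammaFun N m q lam t

/-- The primitive of `γ̄`. -/
def gammaBarPrim (N : ℕ) (m q lam V₀ κ s : ℝ) : ℝ :=
  ∫ t in (0 : ℝ)..s, gammaBar N m q lam V₀ κ t

theorem hasDerivAt_gammaPrim (h : Admissible N m q lam V₀ κ) (s : ℝ) :
    HasDerivAt (gammaPrim N m q lam) (gammaFun N m q lam s) s :=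
  ((continuous_gammaFun h).integral_hasStrictDerivAt 0 s).hasDerivAt

theorem hasDerivAt_gammaBarPrim (h : Admissible N m q lam V₀ κ) (s : ℝ) :
    HasDerivAt (gammaBarPrim N m q lam V₀ κ) (gammaBar N m q lam V₀ κ s) s :=
  ((continuous_gammaBar h).integral_hasStrictDerivAt 0 s).hasDerivAt

theorem integral_eq_zero_of_nonpos {g : ℝ → ℝ} (hg : ∀ s ≤ 0, g s = 0) {s : ℝ} (hs : s ≤ 0) :
    ∫ t in (0 : ℝ)..s, g t = 0 := by
  have : ∫ t in (0 : ℝ)..s, g t = ∫ t in (0 : ℝ)..s, (0 : ℝ) := by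
    refine intervalIntegral.integral_congr fun t ht => ?_
    rw [Set.uIcc_of_ge hs] at ht
    exact hg t ht.2
  rw [this, intervalIntegral.integral_zero]

theorem gammaPrim_of_nonneg (h : Admissible N m q lam V₀ κ) {s : ℝ} (hs : 0 ≤ s) :
    gammaPrim N m q lam s = lam / q * s ^ q + (twoStar N * m)⁻¹ * s ^ (twoStar N * m) := by
  have h1 := h.two_lt_q
  have h2 := h.two_lt_crit
  rw [gammaPrim, intervalIntegral.integral_eq_sub_of_hasDerivAt
    (f := fun s => lam / q * s ^ q + (twoStar N * m)⁻¹ * s ^ (twoStar N * m))]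
  · simp [Real.zero_rpow (by linarith : q ≠ 0), Real.zero_rpow (by linarith : twoStar N * m ≠ 0)]
  · intro t ht
    rw [Set.uIcc_of_le hs] at ht
    have d1 := (Real.hasDerivAt_rpow_const (x := t) (p := q) (Or.inr (by linarith))).const_mul
      (lam / q)
    have d2 := (Real.hasDerivAt_rpow_const (x := t) (p := twoStar N * m)
      (Or.inr (by linarith))).const_mul (twoStar N * m)⁻¹
    refine (d1.add d2).congr_deriv ?_
    rw [gammaFun_of_nonneg h ht.1, ← mul_assoc, ← mul_assoc, div_mul_cancel₀ _ (by linarith),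
      inv_mul_cancel₀ (by linarith), one_mul]
  · exact (continuous_gammaFun h).intervalIntegrable _ _

theorem gammaPrim_of_nonpos {s : ℝ} (hs : s ≤ 0) : gammaPrim N m q lam s = 0 :=
  integral_eq_zero_of_nonpos (fun _ => gammaFun_of_nonpos) hs

theorem gammaBarPrim_le (h : Admissible N m q lam V₀ κ) (s : ℝ) :
    gammaBarPrim N m q lam V₀ κ s ≤ V₀ / κ / 2 * s ^ 2 := by
  have hν := h.slope_pos
  rcases le_total s 0 with hs | hs
  · rw [gammaBarPrim, integral_eq_zero_of_nonpos (fun _ => gammaBar_of_nonpos h) hs]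
    positivity
  · have h1 : gammaBarPrim N m q lam V₀ κ s ≤ ∫ t in (0 : ℝ)..s, V₀ / κ * t :=
      intervalIntegral.integral_mono_on hs ((continuous_gammaBar h).intervalIntegrable _ _)
        ((continuous_const.mul continuous_id).intervalIntegrable _ _)
        fun t ht => gammaBar_le h ht.1
    refine h1.trans (le_of_eq ?_)
    rw [intervalIntegral.integral_const_mul, integral_id]
    ring

/-! ### The nonlinearity inside and outside the ball -/

variable {R : ℝ}

theorem pFun_of_mem {x : Euc N} (hx : x ∈ Metric.ball (0 : Euc N) R) (s : ℝ) :
    pFun m q lam V₀ κ R x s = gammaFun N m q lam s := if_pos hx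

theorem pFun_of_notMem {x : Euc N} (hx : x ∉ Metric.ball (0 : Euc N) R) (s : ℝ) :
    pFun m q lam V₀ κ R x s = gammaBar N m q lam V₀ κ s := if_neg hx

theorem PFun_of_mem {x : Euc N} (hx : x ∈ Metric.ball (0 : Euc N) R) (s : ℝ) :
    PFun m q lam V₀ κ R x s = gammaPrim N m q lam s := by
  simp only [PFun, pFun_of_mem hx, gammaPrim]

theorem PFun_of_notMem {x : Euc N} (hx : x ∉ Metric.ball (0 : Euc N) R) (s : ℝ) :
    PFun m q lam V₀ κ R x s = gammaBarPrim N m q lam V₀ κ s := by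
  simp only [PFun, pFun_of_notMem hx, gammaBarPrim]

theorem hasDerivAt_PFun (h : Admissible N m q lam V₀ κ) (x : Euc N) (s : ℝ) :
    HasDerivAt (PFun m q lam V₀ κ R x) (pFun m q lam V₀ κ R x s) s := by
  by_cases hx : x ∈ Metric.ball (0 : Euc N) R
  · rw [funext (PFun_of_mem hx), pFun_of_mem hx]
    exact hasDerivAt_gammaPrim h s
  · rw [funext (PFun_of_notMem hx), pFun_of_notMem hx]
    exact hasDerivAt_gammaBarPrim h s

theorem pFun_nonneg (h : Admissible N m q lam V₀ κ) (x : Euc N) (s : ℝ) :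
    0 ≤ pFun m q lam V₀ κ R x s := by
  by_cases hx : x ∈ Metric.ball (0 : Euc N) R
  · rw [pFun_of_mem hx]; exact gammaFun_nonneg h s
  · rw [pFun_of_notMem hx]; exact gammaBar_nonneg h s

theorem aestronglyMeasurable_ball_ite {a b : Euc N → ℝ} (ha : AEStronglyMeasurable a)
    (hb : AEStronglyMeasurable b) {c : Euc N → ℝ}
    (hca : ∀ x ∈ Metric.ball (0 : Euc N) R, c x = a x)
    (hcb : ∀ x ∉ Metric.ball (0 : Euc N) R, c x = b x) : AEStronglyMeasurable c := by
  have : c = fun x => (Metric.ball (0 : Euc N) R).indicator a x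
      + (Metric.ball (0 : Euc N) R)ᶜ.indicator b x := by
    funext x
    by_cases hx : x ∈ Metric.ball (0 : Euc N) R
    · rw [Set.indicator_of_mem hx, Set.indicator_of_notMem (by simpa using hx), add_zero, hca x hx]
    · rw [Set.indicator_of_notMem hx, Set.indicator_of_mem (by simpa using hx), zero_add, hcb x hx]
  rw [this]
  exact (ha.indicator Metric.isOpen_ball.measurableSet).add
    (hb.indicator Metric.isOpen_ball.measurableSet.compl)

theorem aestronglyMeasurable_pFun (h : Admissible N m q lam V₀ κ) {s : Euc N → ℝ}
    (hs : AEStronglyMeasurable s) :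
    AEStronglyMeasurable fun x => pFun m q lam V₀ κ R x (s x) :=
  aestronglyMeasurable_ball_ite (R := R) ((continuous_gammaFun h).comp_aestronglyMeasurable hs)
    ((continuous_gammaBar h).comp_aestronglyMeasurable hs)
    (fun _ hx => pFun_of_mem hx _) fun _ hx => pFun_of_notMem hx _

theorem aestronglyMeasurable_PFun (h : Admissible N m q lam V₀ κ) {s : Euc N → ℝ}
    (hs : AEStronglyMeasurable s) :
    AEStronglyMeasurable fun x => PFun m q lam V₀ κ R x (s x) := by
  have c1 : Continuous (gammaPrim N m q lam) :=
    continuous_iff_continuousAt.2 fun s => (hasDerivAt_gammaPrim h s).continuousAt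
  have c2 : Continuous (gammaBarPrim N m q lam V₀ κ) :=
    continuous_iff_continuousAt.2 fun s => (hasDerivAt_gammaBarPrim h s).continuousAt
  exact aestronglyMeasurable_ball_ite (R := R) (c1.comp_aestronglyMeasurable hs)
    (c2.comp_aestronglyMeasurable hs) (fun _ hx => PFun_of_mem hx _) fun _ hx => PFun_of_notMem hx _

/-! ### Growth estimates after the change of variables -/

/-- The critical nonlinearity after the change of variables. -/
def critTerm (N : ℕ) (m q lam s : ℝ) : ℝ :=
  gammaFun N m q lam (changeVar m s) * changeVarDeriv m s

theorem critTerm_nonneg (h : Admissible N m q lam V₀ κ) (s : ℝ) : 0 ≤ critTerm N m q lam s :=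
  mul_nonneg (gammaFun_nonneg h _) (changeVarDeriv_pos h.one_lt s).le

theorem critTerm_of_nonpos (h : Admissible N m q lam V₀ κ) {s : ℝ} (hs : s ≤ 0) :
    critTerm N m q lam s = 0 := by
  rw [critTerm, gammaFun_of_nonpos (changeVar_nonpos h.one_lt hs), zero_mul]

theorem continuous_critTerm (h : Admissible N m q lam V₀ κ) : Continuous (critTerm N m q lam) :=
  ((continuous_gammaFun h).comp (continuous_changeVar h.one_lt)).mul
    (continuous_changeVarDeriv h.one_lt)

/-- The exponent q − 1 lies strictly between 1 and 2*m − 1, so it interpolates between them.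
Multiplication by f' then turns f^(2*m−1) into a multiple of s^(2*−1) by `changeVar_critical_le`. -/
theorem exists_subcritical_le (h : Admissible N m q lam V₀ κ) {η : ℝ} (hη : 0 < η) :
    ∃ C, 0 ≤ C ∧ ∀ s, 0 ≤ s → lam * changeVar m s ^ (q - 1) * changeVarDeriv m s ≤
      C * s + η * s ^ (twoStar N - 1) := by
  have hm := h.one_lt
  have h1 := h.two_lt_q
  have h2 := h.q_lt
  have hlam := h.lam_pos
  set a : ℝ := m ^ (twoStar N / 2 - 1) with ha
  have ha0 : 0 < a := Real.rpow_pos_of_pos (by linarith) _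
  obtain ⟨C, hC0, hC⟩ := exists_rpow_le_add (a := 1) (r := q - 1) (b := twoStar N * m - 1)
    zero_le_one (by linarith) (by linarith) (show 0 < η / (lam * a) by positivity)
  refine ⟨lam * C, by positivity, fun s hs => ?_⟩
  have hu := changeVar_nonneg hm hs
  have hd := changeVarDeriv_pos hm s
  have h3 : changeVar m s * changeVarDeriv m s ≤ s := by
    have := mul_le_mul (changeVar_le_self hm hs) (changeVarDeriv_le_one hm s) hd.le hs
    linarith
  have h4 := changeVar_critical_le hm h.two_lt hs
  have h5 := hC _ hu
  rw [Real.rpow_one] at h5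
  calc lam * changeVar m s ^ (q - 1) * changeVarDeriv m s
      ≤ lam * (C * changeVar m s + η / (lam * a) * changeVar m s ^ (twoStar N * m - 1))
        * changeVarDeriv m s := by gcongr
    _ = lam * C * (changeVar m s * changeVarDeriv m s)
        + η / a * (changeVar m s ^ (twoStar N * m - 1) * changeVarDeriv m s) := by
        field_simp
    _ ≤ lam * C * s + η / a * (a * s ^ (twoStar N - 1)) := by gcongr
    _ = _ := by field_simp

theorem exists_critTerm_le (h : Admissible N m q lam V₀ κ) {η : ℝ} (hη : 0 < η) :
    ∃ C, 0 ≤ C ∧ ∀ s, critTerm N m q lam s ≤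
      C * |s| + (m ^ (twoStar N / 2 - 1) + η) * |s| ^ (twoStar N - 1) := by
  have hm := h.one_lt
  obtain ⟨C, hC0, hC⟩ := exists_subcritical_le h hη
  refine ⟨C, hC0, fun s => ?_⟩
  rcases le_total s 0 with hs | hs
  · rw [critTerm_of_nonpos h hs]
    have := Real.rpow_nonneg (abs_nonneg s) (twoStar N - 1)
    have := Real.rpow_nonneg (by linarith : 0 ≤ m) (twoStar N / 2 - 1)
    positivity
  · have h1 := hC s hs
    have h2 := changeVar_critical_le hm h.two_lt hs
    rw [abs_of_nonneg hs, critTerm, gammaFun_of_nonneg h (changeVar_nonneg hm hs)]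
    linarith

/-- Fix τ > 0 with (1+τ)^(p−1) ≤ 1+η. If v ≤ τw then v + w ≤ (1+τ)w; otherwise w ≤ v/τ and the left
side is a multiple of v^p. The leading coefficient stays close to 1, so the sharp constant is not
spoiled. -/
theorem add_rpow_mul_le {p η : ℝ} (hp : 2 < p) (hη : 0 < η) :
    ∃ C, 0 ≤ C ∧ ∀ v w : ℝ, 0 ≤ v → 0 ≤ w → (v + w) ^ (p - 1) * w ≤ (1 + η) * w ^ p + C * v ^ p := by
  obtain ⟨τ, hτ, hτη⟩ : ∃ τ : ℝ, 0 < τ ∧ (1 + τ) ^ (p - 1) ≤ 1 + η := by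
    have hc : ContinuousAt (fun τ : ℝ => (1 + τ) ^ (p - 1)) 0 :=
      ((continuous_const.add continuous_id).rpow_const fun _ => Or.inr (by linarith)).continuousAt
    have h1 : ∀ᶠ τ in 𝓝[>] (0 : ℝ), (1 + τ) ^ (p - 1) < 1 + η :=
      (hc.eventually_lt_const (by simpa using hη)).filter_mono nhdsWithin_le_nhds
    obtain ⟨τ, h2, h3⟩ := (h1.and self_mem_nhdsWithin).exists
    exact ⟨τ, h3, h2.le⟩
  refine ⟨(1 + τ⁻¹) ^ (p - 1) * τ⁻¹, by positivity, fun v w hv hw => ?_⟩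
  have hpow : ∀ x : ℝ, 0 ≤ x → x ^ (p - 1) * x = x ^ p := by
    intro x hx
    rcases hx.eq_or_lt with rfl | hx'
    · rw [mul_zero, Real.zero_rpow (by linarith)]
    · rw [← Real.rpow_add_one hx'.ne', sub_add_cancel]
  have n1 := Real.rpow_nonneg hv p
  have n2 := Real.rpow_nonneg hw p
  rcases le_total v (τ * w) with h | h
  · have : (v + w) ^ (p - 1) * w ≤ (1 + η) * w ^ p := by
      calc (v + w) ^ (p - 1) * w ≤ ((1 + τ) * w) ^ (p - 1) * w := by
            refine mul_le_mul_of_nonneg_right (Real.rpow_le_rpow (by positivity) ?_ (by linarith)) hw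
            linarith
        _ = (1 + τ) ^ (p - 1) * w ^ p := by
            rw [Real.mul_rpow (by positivity) hw, mul_assoc, hpow w hw]
        _ ≤ _ := mul_le_mul_of_nonneg_right hτη n2
    have : 0 ≤ (1 + τ⁻¹) ^ (p - 1) * τ⁻¹ * v ^ p := by positivity
    linarith
  · have hw' : w ≤ τ⁻¹ * v := by rwa [← div_eq_inv_mul, le_div_iff₀ hτ, mul_comm]
    have : (v + w) ^ (p - 1) * w ≤ (1 + τ⁻¹) ^ (p - 1) * τ⁻¹ * v ^ p := by
      calc (v + w) ^ (p - 1) * w ≤ ((1 + τ⁻¹) * v) ^ (p - 1) * (τ⁻¹ * v) := by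
            refine mul_le_mul (Real.rpow_le_rpow (by positivity) ?_ (by linarith)) hw' hw
              (by positivity)
            linarith
        _ = (1 + τ⁻¹) ^ (p - 1) * τ⁻¹ * (v ^ (p - 1) * v) := by
            rw [Real.mul_rpow (by positivity) hv]
            ring
        _ = _ := by rw [hpow v hv]
    have : 0 ≤ (1 + η) * w ^ p := by positivity
    linarith

theorem exists_sq_le_add_rpow {p η : ℝ} (hp : 2 < p) (hη : 0 < η) :
    ∃ C, 0 ≤ C ∧ ∀ w : ℝ, w ^ 2 ≤ C + η * |w| ^ p := by
  obtain ⟨C, hC0, hC⟩ := exists_rpow_le_add (a := 0) (r := 2) (b := p) le_rfl zero_le_two hp hη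
  refine ⟨C, hC0, fun w => ?_⟩
  have := hC |w| (abs_nonneg w)
  simpa using this

/-- A one-sided pointwise substitute for a Brezis–Lieb splitting. The left side is nonpositive when
s ≤ 0 or s ≤ v; otherwise expand around v. The allowance η is spent in thirds: on the subcritical
power, on the expansion of (|v| + w)^(p−1) w, and on the quadratic term in w. -/
theorem exists_critTerm_mul_sub_le (h : Admissible N m q lam V₀ κ) {η : ℝ} (hη : 0 < η) :
    ∃ C, 0 ≤ C ∧ ∀ s v, critTerm N m q lam s * (s - v) ≤
      (m ^ (twoStar N / 2 - 1) + η) * |s - v| ^ twoStar N + C * (1 + v ^ 2 + |v| ^ twoStar N) := by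
  have hm := h.one_lt
  have hp := h.two_lt
  set p := twoStar N with hpdef
  set a : ℝ := m ^ (p / 2 - 1) with ha
  have ha0 : 0 < a := Real.rpow_pos_of_pos (by linarith) _
  obtain ⟨C₁, hC₁, h₁⟩ := exists_critTerm_le h (show 0 < η / 3 by positivity)
  obtain ⟨C₂, hC₂, h₂⟩ := add_rpow_mul_le hp (show 0 < η / (3 * (a + η / 3)) by positivity)
  obtain ⟨C₃, hC₃, h₃⟩ := exists_sq_le_add_rpow hp (show 0 < η / (6 * (C₁ + 1)) by positivity)
  refine ⟨2 * C₁ * C₃ + C₁ + (a + η / 3) * C₂, by positivity, fun s v => ?_⟩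
  have hvp := Real.rpow_nonneg (abs_nonneg v) p
  have hwp := Real.rpow_nonneg (abs_nonneg (s - v)) p
  have hR : 0 ≤ (a + η) * |s - v| ^ p
      + (2 * C₁ * C₃ + C₁ + (a + η / 3) * C₂) * (1 + v ^ 2 + |v| ^ p) := by positivity
  rcases le_total s 0 with hs | hs
  · rwa [critTerm_of_nonpos h hs, zero_mul]
  rcases le_total (s - v) 0 with hw | hw
  · exact (mul_nonpos_of_nonneg_of_nonpos (critTerm_nonneg h s) hw).trans hR
  set w := s - v with hwdef
  have hsv : |s| ≤ |v| + w := by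
    rw [abs_of_nonneg hs]
    linarith [le_abs_self v]
  rw [abs_of_nonneg hw] at hwp ⊢
  have hv0 := abs_nonneg v
  have e2 := h₂ |v| w hv0 hw
  have e3 := h₃ w
  rw [abs_of_nonneg hw] at e3
  have e1 : critTerm N m q lam s ≤ C₁ * (|v| + w) + (a + η / 3) * (|v| + w) ^ (p - 1) := by
    refine (h₁ s).trans ?_
    gcongr
    linarith
  have hvw : (|v| + w) * w ≤ v ^ 2 + 2 * w ^ 2 := by
    nlinarith [sq_nonneg (|v| - w), sq_abs v]
  calc critTerm N m q lam s * w
      ≤ (C₁ * (|v| + w) + (a + η / 3) * (|v| + w) ^ (p - 1)) * w :=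
        mul_le_mul_of_nonneg_right e1 hw
    _ = C₁ * ((|v| + w) * w) + (a + η / 3) * ((|v| + w) ^ (p - 1) * w) := by ring
    _ ≤ C₁ * (v ^ 2 + 2 * (C₃ + η / (6 * (C₁ + 1)) * w ^ p))
        + (a + η / 3) * ((1 + η / (3 * (a + η / 3))) * w ^ p + C₂ * |v| ^ p) := by
        refine add_le_add (mul_le_mul_of_nonneg_left (hvw.trans ?_) hC₁)
          (mul_le_mul_of_nonneg_left e2 (by positivity))
        linarith
    _ = C₁ * v ^ 2 + 2 * C₁ * C₃ + (a + η / 3) * C₂ * |v| ^ p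
        + (C₁ / (C₁ + 1) * (η / 3) + a + η / 3 + η / 3) * w ^ p := by
        field_simp
        ring
    _ ≤ C₁ * v ^ 2 + 2 * C₁ * C₃ + (a + η / 3) * C₂ * |v| ^ p
        + (1 * (η / 3) + a + η / 3 + η / 3) * w ^ p := by
        have : C₁ / (C₁ + 1) ≤ 1 := (div_le_one (by positivity)).2 (by linarith)
        gcongr
    _ ≤ _ := by
        have n1 : 0 ≤ (2 * C₁ * C₃ + (a + η / 3) * C₂) * v ^ 2 := by positivity
        have n2 : 0 ≤ (2 * C₁ * C₃ + C₁) * |v| ^ p := by positivity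
        have n3 : 0 ≤ C₁ + (a + η / 3) * C₂ := by positivity
        nlinarith [n1, n2, n3]

/-- The subcritical correction in the comparison of the critical terms. -/
def subTerm (m q lam p s : ℝ) : ℝ :=
  √m * (changeVar m (max s 0)) ^ (p * m - m + 1)
    + m * (lam * (changeVar m (max s 0)) ^ (q - 1) * changeVarDeriv m s * (max s 0))

theorem continuous_subTerm (h : Admissible N m q lam V₀ κ) :
    Continuous (subTerm m q lam (twoStar N)) := by
  have hm := h.one_lt
  have h1 := h.two_lt_q
  have h2 := h.two_lt
  have hc : Continuous fun s : ℝ => max s 0 := continuous_id.max continuous_const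
  have hf : Continuous fun s : ℝ => changeVar m (max s 0) := (continuous_changeVar hm).comp hc
  refine (continuous_const.mul (hf.rpow_const fun _ => Or.inr (by nlinarith))).add
    (continuous_const.mul (((continuous_const.mul (hf.rpow_const fun _ =>
      Or.inr (by linarith))).mul (continuous_changeVarDeriv hm)).mul hc))

theorem changeVar_rpow_mul_le (hm : 1 < m) {p : ℝ} (hp : 0 < p) {s : ℝ} (hs : 0 ≤ s) :
    changeVar m s ^ (p * m) ≤ √m ^ p * s ^ p := by
  have hu := changeVar_nonneg hm hs
  rw [mul_comm, Real.rpow_mul hu, ← Real.mul_rpow (Real.sqrt_nonneg _) hs]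
  exact Real.rpow_le_rpow (Real.rpow_nonneg hu _) (changeVar_rpow_le hm hs) hp.le

theorem subTerm_nonneg (h : Admissible N m q lam V₀ κ) (s : ℝ) :
    0 ≤ subTerm m q lam (twoStar N) s := by
  have hm := h.one_lt
  have hlam := h.lam_pos
  have hs := le_max_right s 0
  have hu := changeVar_nonneg hm hs
  have hd := changeVarDeriv_pos hm s
  rw [subTerm]
  positivity

/-- Both summands have order below 2*m in f, hence cost only a small multiple of |s|^(2*) plus a
constant. Constants are integrable on the ball, so there the integral of `subTerm` passes to the
limit. -/
theorem exists_subTerm_le (h : Admissible N m q lam V₀ κ) {η : ℝ} (hη : 0 < η) :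
    ∃ C, 0 ≤ C ∧ ∀ s, subTerm m q lam (twoStar N) s ≤ C + η * |s| ^ twoStar N := by
  have hm := h.one_lt
  have hp := h.two_lt
  set p := twoStar N with hpdef
  have hsm : 0 < √m := Real.sqrt_pos.2 (by linarith)
  have hsp : 0 < √m ^ p := Real.rpow_pos_of_pos hsm p
  obtain ⟨C₁, hC₁, h₁⟩ := exists_rpow_le_add (a := 0) (r := p * m - m + 1) (b := p * m)
    le_rfl (by nlinarith) (by linarith) (show 0 < η / (3 * √m * √m ^ p) by positivity)
  obtain ⟨C₂, hC₂, h₂⟩ := exists_subcritical_le h (show 0 < η / (3 * m) by positivity)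
  obtain ⟨C₃, hC₃, h₃⟩ := exists_sq_le_add_rpow hp (show 0 < η / (3 * m * (C₂ + 1)) by positivity)
  refine ⟨√m * C₁ + m * C₂ * C₃, by positivity, fun s => ?_⟩
  have hle : (max s 0) ^ p ≤ |s| ^ p :=
    Real.rpow_le_rpow (le_max_right _ _) (max_le (le_abs_self s) (abs_nonneg s)) (by linarith)
  refine le_trans ?_ (add_le_add_right (mul_le_mul_of_nonneg_left hle hη.le) _)
  have key : ∀ t, 0 ≤ t → √m * changeVar m t ^ (p * m - m + 1)
      + m * (lam * changeVar m t ^ (q - 1) * changeVarDeriv m t * t)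
      ≤ √m * C₁ + m * C₂ * C₃ + η * t ^ p := by
    intro t ht
    have e1 := h₁ _ (changeVar_nonneg hm ht)
    rw [Real.rpow_zero, mul_one] at e1
    have e2 := changeVar_rpow_mul_le hm (by linarith : 0 < p) ht
    have e3 := h₂ t ht
    have e4 := h₃ t
    rw [abs_of_nonneg ht] at e4
    have hpow : t ^ (p - 1) * t = t ^ p := by
      rcases ht.eq_or_lt with rfl | ht'
      · rw [mul_zero, Real.zero_rpow (by linarith)]
      · rw [← Real.rpow_add_one ht'.ne', sub_add_cancel]
    have htp := Real.rpow_nonneg ht p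
    calc _ ≤ √m * (C₁ + η / (3 * √m * √m ^ p) * (√m ^ p * t ^ p))
          + m * ((C₂ * t + η / (3 * m) * t ^ (p - 1)) * t) := by
          gcongr
          exact e1.trans (by gcongr)
      _ = √m * C₁ + η / 3 * t ^ p + m * C₂ * t ^ 2 + η / 3 * (t ^ (p - 1) * t) := by
          field_simp
          ring
      _ ≤ √m * C₁ + η / 3 * t ^ p + m * C₂ * (C₃ + η / (3 * m * (C₂ + 1)) * t ^ p)
          + η / 3 * (t ^ (p - 1) * t) := by gcongr
      _ = √m * C₁ + m * C₂ * C₃ + (η / 3 + C₂ / (C₂ + 1) * (η / 3) + η / 3) * t ^ p := by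
          rw [hpow]
          field_simp
          ring
      _ ≤ √m * C₁ + m * C₂ * C₃ + (η / 3 + 1 * (η / 3) + η / 3) * t ^ p := by
          have : C₂ / (C₂ + 1) ≤ 1 := (div_le_one (by positivity)).2 (by linarith)
          gcongr
      _ = _ := by ring
  rcases le_total s 0 with hs | hs
  · have := key 0 le_rfl
    rw [subTerm, max_eq_right hs]
    simpa using this
  · have := key s hs
    rwa [subTerm, max_eq_left hs]

/-- Comparison of `f^{2^* m}` with the critical term. -/
theorem critTerm_mul_le (h : Admissible N m q lam V₀ κ) (s : ℝ) :
    m * (critTerm N m q lam s * s) ≤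
      changeVar m (max s 0) ^ (twoStar N * m) + subTerm m q lam (twoStar N) s := by
  have hm := h.one_lt
  rcases le_total s 0 with hs | hs
  · rw [critTerm_of_nonpos h hs, zero_mul, mul_zero]
    exact add_nonneg (Real.rpow_nonneg (changeVar_nonneg hm (le_max_right _ _)) _)
      (subTerm_nonneg h s)
  · have := changeVar_critical_defect hm (twoStar N) hs
    rw [subTerm, max_eq_left hs, critTerm, gammaFun_of_nonneg h (changeVar_nonneg hm hs)]
    linarith

/-- The growth of the full nonlinearity. -/
theorem exists_pFun_growth (h : Admissible N m q lam V₀ κ) : ∃ C, 0 ≤ C ∧ ∀ (R : ℝ) (x : Euc N) s,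
    |pFun m q lam V₀ κ R x (changeVar m s) * changeVarDeriv m s| ≤
      C * (|s| + |s| ^ (twoStar N - 1)) := by
  have hm := h.one_lt
  have hν := h.slope_pos
  obtain ⟨C, hC0, hC⟩ := exists_critTerm_le h one_pos
  set a : ℝ := m ^ (twoStar N / 2 - 1) with ha
  have ha0 : 0 < a := Real.rpow_pos_of_pos (by linarith) _
  refine ⟨C + (a + 1) + V₀ / κ, by positivity, fun R x s => ?_⟩
  have hsp := Real.rpow_nonneg (abs_nonneg s) (twoStar N - 1)
  have hd := changeVarDeriv_pos hm s
  rw [abs_of_nonneg (mul_nonneg (pFun_nonneg h x _) hd.le)]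
  by_cases hx : x ∈ Metric.ball (0 : Euc N) R
  · rw [pFun_of_mem hx]
    refine (hC s).trans ?_
    have n1 : 0 ≤ (a + 1 + V₀ / κ) * |s| := by positivity
    have n2 : 0 ≤ (C + V₀ / κ) * |s| ^ (twoStar N - 1) := by positivity
    linarith
  · rw [pFun_of_notMem hx]
    have h1 : gammaBar N m q lam V₀ κ (changeVar m s) ≤ V₀ / κ * |s| := by
      rcases le_total s 0 with hs | hs
      · rw [gammaBar_of_nonpos h (changeVar_nonpos hm hs)]
        positivity
      · refine (gammaBar_le h (changeVar_nonneg hm hs)).trans ?_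
        rw [abs_of_nonneg hs]
        exact mul_le_mul_of_nonneg_left (changeVar_le_self hm hs) hν.le
    have h2 : gammaBar N m q lam V₀ κ (changeVar m s) * changeVarDeriv m s ≤ V₀ / κ * |s| * 1 :=
      mul_le_mul h1 (changeVarDeriv_le_one hm s) hd.le (by positivity)
    have n1 : 0 ≤ (C + (a + 1)) * |s| := by positivity
    have n2 : 0 ≤ (C + (a + 1) + V₀ / κ) * |s| ^ (twoStar N - 1) := by positivity
    linarith

/-- The Ambrosetti–Rabinowitz type inequality inside the ball. -/
theorem gammaFun_ar (h : Admissible N m q lam V₀ κ) {θ : ℝ} (hθ : 0 < θ) (hθq : θ ≤ q) (s : ℝ) :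
    (1 / θ - 1 / (twoStar N * m)) * changeVar m (max s 0) ^ (twoStar N * m) ≤
      1 / θ * (gammaFun N m q lam (changeVar m s) * changeVar m s)
        - gammaPrim N m q lam (changeVar m s) := by
  have hm := h.one_lt
  have h1 := h.two_lt_q
  have h2 := h.two_lt_crit
  rcases le_total s 0 with hs | hs
  · have hu := changeVar_nonpos hm hs
    rw [gammaFun_of_nonpos hu, gammaPrim_of_nonpos hu, max_eq_right hs, changeVar_zero m hm,
      Real.zero_rpow (by linarith)]
    simp
  · have hu := changeVar_nonneg hm hs
    rw [max_eq_left hs, gammaPrim_of_nonneg h hu, gammaFun_of_nonneg h hu]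
    set u := changeVar m s
    have hpow : ∀ r : ℝ, 2 < r → u ^ (r - 1) * u = u ^ r := by
      intro r hr
      rcases hu.eq_or_lt with h0 | h0
      · rw [← h0, mul_zero, Real.zero_rpow (by linarith)]
      · rw [← Real.rpow_add_one h0.ne', sub_add_cancel]
    have e1 := hpow q h1
    have e2 := hpow _ h2
    -- The contribution of the power q is nonnegative because θ ≤ q, and it is dropped; the critical
    -- power accounts exactly for the left side.
    have e3 : 0 ≤ lam * (1 / θ - 1 / q) * u ^ q := by
      have : 1 / q ≤ 1 / θ := one_div_le_one_div_of_le hθ hθq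
      have := h.lam_pos
      have := Real.rpow_nonneg hu q
      exact mul_nonneg (mul_nonneg h.lam_pos.le (by linarith)) this
    have e4 : (lam * u ^ (q - 1) + u ^ (twoStar N * m - 1)) * u
        = lam * u ^ q + u ^ (twoStar N * m) := by
      rw [add_mul, mul_assoc, e1, e2]
    rw [e4, ← one_div]
    have e5 : lam / q * u ^ q = lam * (1 / q) * u ^ q := by ring
    rw [e5]
    linarith

end Nonlinearity

/-! ### The space `X` and the derivative of the functional -/

section Space

variable {N : ℕ} {V u v : Euc N → ℝ} {G : Euc N → Euc N}

theorem LocallyHolder.continuous (h : LocallyHolder V) : Continuous V := by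
  refine continuous_iff_continuousAt.2 fun x => ?_
  obtain ⟨C, a, U, ha, -, hU, hH⟩ := h x
  exact (hH.continuousOn ha).continuousAt hU

/-- Near infinity V stays below V_∞ + 1, and on the remaining compact set continuity bounds it. With
both bounds the norm of X is equivalent to that of H¹. -/
theorem CondV.exists_bound {V₀ Vinf : ℝ} (h : CondV V V₀ Vinf) (hc : Continuous V) :
    (∀ x, V₀ ≤ V x) ∧ ∃ V₁, ∀ x, V x ≤ V₁ := by
  obtain ⟨-, -, hmin, hlim⟩ := h
  refine ⟨fun x => hmin.2 ⟨x, rfl⟩, ?_⟩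
  have h1 := hlim.eventually_lt_const (lt_add_one Vinf)
  obtain ⟨K, hK, hKV⟩ := mem_cocompact.1 h1
  obtain ⟨B, hB⟩ := (hK.image hc).bddAbove
  refine ⟨max B (Vinf + 1), fun x => ?_⟩
  by_cases hx : x ∈ K
  · exact (hB ⟨x, hx, rfl⟩).trans (le_max_left _ _)
  · exact (show V x < Vinf + 1 from hKV hx).le.trans (le_max_right _ _)

theorem IsWeakGrad.weakGrad_ae_eq (h : IsWeakGrad u G) : weakGrad u =ᵐ[volume] G := by
  have hex : ∃ G, IsWeakGrad u G := ⟨G, h⟩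
  rw [weakGrad, dif_pos hex]
  exact hex.choose_spec.ae_eq h

theorem MemH1.isWeakGrad (h : MemH1 u) : IsWeakGrad u (weakGrad u) := by
  obtain ⟨-, G, hG, -⟩ := h
  have hex : ∃ G, IsWeakGrad u G := ⟨G, hG⟩
  rw [weakGrad, dif_pos hex]
  exact hex.choose_spec

theorem MemH1.memLp_weakGrad (h : MemH1 u) : MemLp (weakGrad u) 2 volume := by
  obtain ⟨-, G, hG, hG2⟩ := h
  exact hG2.ae_eq hG.weakGrad_ae_eq.symm

/-- Bounds on a potential. -/
structure PotBounds (V : Euc N → ℝ) (V₀ V₁ : ℝ) : Prop where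
  cont : Continuous V
  pos : 0 < V₀
  lower : ∀ x, V₀ ≤ V x
  upper : ∀ x, V x ≤ V₁

theorem PotBounds.nonneg {V₀ V₁ : ℝ} (hV : PotBounds V V₀ V₁) (x : Euc N) : 0 ≤ V x :=
  hV.pos.le.trans (hV.lower x)

theorem PotBounds.upper_nonneg {V₀ V₁ : ℝ} (hV : PotBounds V V₀ V₁) : 0 ≤ V₁ :=
  (hV.nonneg 0).trans (hV.upper 0)

theorem PotBounds.integrable_mul {V₀ V₁ : ℝ} (hV : PotBounds V V₀ V₁) {a : Euc N → ℝ}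
    (ha : Integrable a) : Integrable fun x => V x * a x := by
  refine ha.bdd_mul (c := V₁) hV.cont.aestronglyMeasurable (Eventually.of_forall fun x => ?_)
  rw [Real.norm_of_nonneg (hV.nonneg x)]
  exact hV.upper x

theorem integrable_sq {α : Type*} [MeasurableSpace α] {μ : Measure α} {u : α → ℝ}
    (hu : MemLp u 2 μ) : Integrable (fun x => u x ^ 2) μ := by
  simpa using integrable_norm_sq hu

theorem IsWeakGrad.memX {V₀ V₁ : ℝ} (h : IsWeakGrad u G) (hu : MemLp u 2 volume)
    (hG : MemLp G 2 volume) (hV : PotBounds V V₀ V₁) : MemX V u :=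
  ⟨⟨hu, G, h, hG⟩, hV.integrable_mul (integrable_sq hu)⟩

theorem integral_norm_sq_congr {G H : Euc N → Euc N} (h : G =ᵐ[volume] H) :
    ∫ x, ‖G x‖ ^ 2 = ∫ x, ‖H x‖ ^ 2 := by
  refine integral_congr_ae ?_
  filter_upwards [h] with x hx
  rw [hx]

theorem MemX.integrable_rpow (hN : 3 ≤ N) (h : MemX V u) :
    Integrable (fun x => |u x| ^ twoStar N) ∧
      ∫ x, |u x| ^ twoStar N ≤ ((∫ x, ‖weakGrad u x‖ ^ 2) / sobolevConst N) ^ (twoStar N / 2) :=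
  h.1.isWeakGrad.sobolev hN h.1.1 h.1.memLp_weakGrad

theorem add_rpow_le_two_rpow {p : ℝ} (hp : 0 < p) {a b : ℝ} (ha : 0 ≤ a) (hb : 0 ≤ b) :
    (a + b) ^ p ≤ 2 ^ p * (a ^ p + b ^ p) := by
  have n1 := Real.rpow_nonneg ha p
  have n2 := Real.rpow_nonneg hb p
  have n3 : (0 : ℝ) < 2 ^ p := Real.rpow_pos_of_pos two_pos p
  rcases le_total a b with h | h
  · calc (a + b) ^ p ≤ (2 * b) ^ p := Real.rpow_le_rpow (by positivity) (by linarith) hp.le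
      _ = 2 ^ p * b ^ p := Real.mul_rpow zero_le_two hb
      _ ≤ _ := mul_le_mul_of_nonneg_left (by linarith) n3.le
  · calc (a + b) ^ p ≤ (2 * a) ^ p := Real.rpow_le_rpow (by positivity) (by linarith) hp.le
      _ = 2 ^ p * a ^ p := Real.mul_rpow zero_le_two ha
      _ ≤ _ := mul_le_mul_of_nonneg_left (by linarith) n3.le

theorem rpow_sub_one_mul_self {p : ℝ} (hp : p ≠ 0) {x : ℝ} (hx : 0 ≤ x) :
    x ^ (p - 1) * x = x ^ p := by
  rcases hx.eq_or_lt with rfl | hx'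
  · rw [mul_zero, Real.zero_rpow hp]
  · rw [← Real.rpow_add_one hx'.ne', sub_add_cancel]

/-- Directional differentiability of superposition functionals with critical growth. -/
theorem hasDerivAt_integral_superposition {F b : Euc N → ℝ → ℝ} {C p : ℝ} (hp : 2 < p) (hC : 0 ≤ C)
    (hF : ∀ x s, HasDerivAt (F x) (b x s) s) (hF0 : ∀ x, F x 0 = 0)
    (hb : ∀ x s, |b x s| ≤ C * (|s| + |s| ^ (p - 1)))
    (hFm : ∀ v : Euc N → ℝ, AEStronglyMeasurable v → AEStronglyMeasurable fun x => F x (v x))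
    (hbm : ∀ v : Euc N → ℝ, AEStronglyMeasurable v → AEStronglyMeasurable fun x => b x (v x))
    {v φ : Euc N → ℝ} (hv : MemLp v 2 volume) (hvp : Integrable fun x => |v x| ^ p)
    (hφ : MemLp φ 2 volume) (hφp : Integrable fun x => |φ x| ^ p) :
    Integrable (fun x => F x (v x)) ∧ Integrable (fun x => b x (v x) * φ x) ∧
      HasDerivAt (fun t : ℝ => ∫ x, F x (v x + t * φ x)) (∫ x, b x (v x) * φ x) 0 := by
  have hgrow : ∀ x s z w, |s| ≤ z → |w| ≤ z → |b x s * w| ≤ C * (z ^ 2 + z ^ p) := by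
    intro x s z w hs hw
    have hz : 0 ≤ z := (abs_nonneg s).trans hs
    have h1 : |b x s| ≤ C * (z + z ^ (p - 1)) := (hb x s).trans (by
      have := Real.rpow_le_rpow (abs_nonneg s) hs (by linarith : 0 ≤ p - 1)
      gcongr)
    have := Real.rpow_nonneg hz (p - 1)
    calc |b x s * w| = |b x s| * |w| := abs_mul _ _
      _ ≤ C * (z + z ^ (p - 1)) * z := mul_le_mul h1 hw (abs_nonneg _) (by positivity)
      _ = C * (z ^ 2 + z ^ (p - 1) * z) := by ring
      _ = _ := by rw [rpow_sub_one_mul_self (by linarith) hz]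
  have hFb : ∀ x s, |F x s| ≤ C * (s ^ 2 + |s| ^ p) := by
    intro x s
    have h1 : ∀ t ∈ Set.uIcc 0 s, ‖b x t‖ ≤ C * (|s| + |s| ^ (p - 1)) := by
      intro t ht
      have h2 : |t| ≤ |s| := by
        have := Set.abs_sub_left_of_mem_uIcc ht
        simpa using this
      refine (hb x t).trans ?_
      have := Real.rpow_le_rpow (abs_nonneg t) h2 (by linarith : 0 ≤ p - 1)
      gcongr
    have h3 := (convex_uIcc 0 s).norm_image_sub_le_of_norm_hasDerivWithin_le
      (fun t _ => (hF x t).hasDerivWithinAt) h1 Set.left_mem_uIcc Set.right_mem_uIcc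
    rw [hF0, sub_zero, sub_zero, Real.norm_eq_abs, Real.norm_eq_abs] at h3
    refine h3.trans (le_of_eq ?_)
    rw [mul_assoc, add_mul, rpow_sub_one_mul_self (by linarith) (abs_nonneg s), ← sq_abs, sq]
  have hFi : Integrable fun x => F x (v x) := by
    refine Integrable.mono' (((integrable_sq hv).add hvp).const_mul C) (hFm v hv.1) ?_
    exact Eventually.of_forall fun x => hFb x (v x)
  -- The function |v| + |φ| dominates |v + tφ| for |t| < 1 as well as |φ|, so this expression
  -- dominates the derivative of the integrand uniformly in t.
  have hz : Integrable fun x => C * ((|v x| + |φ x|) ^ 2 + (|v x| + |φ x|) ^ p) := by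
    refine ((integrable_sq (hv.abs.add hφ.abs)).add ?_).const_mul C
    refine Integrable.mono' ((hvp.add hφp).const_mul (2 ^ p)) ?_ (Eventually.of_forall fun x => ?_)
    · exact ((hv.1.norm.add hφ.1.norm).aemeasurable.pow_const p).aestronglyMeasurable
    · rw [Real.norm_of_nonneg (Real.rpow_nonneg (by positivity) _)]
      exact add_rpow_le_two_rpow (by linarith) (abs_nonneg _) (abs_nonneg _)
  have hmain := hasDerivAt_integral_of_dominated_loc_of_deriv_le (μ := volume) (𝕜 := ℝ)
    (F := fun t x => F x (v x + t * φ x)) (F' := fun t x => b x (v x + t * φ x) * φ x) (x₀ := 0)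
    (s := Metric.ball 0 1)
    (bound := fun x => C * ((|v x| + |φ x|) ^ 2 + (|v x| + |φ x|) ^ p))
    (Metric.ball_mem_nhds 0 one_pos)
    (Eventually.of_forall fun t => hFm _ (hv.1.add (hφ.1.const_mul t)))
    (by simpa using hFi) (by simp only [zero_mul, add_zero]; exact (hbm v hv.1).mul hφ.1) ?_ hz ?_
  · simp only [zero_mul, add_zero] at hmain
    exact ⟨hFi, hmain⟩
  · refine Eventually.of_forall fun x t ht => ?_
    rw [mem_ball_zero_iff, Real.norm_eq_abs] at ht
    refine hgrow x _ _ _ ?_ (by linarith [abs_nonneg (v x)])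
    refine (abs_add_le _ _).trans ?_
    rw [abs_mul]
    have := mul_le_of_le_one_left (abs_nonneg (φ x)) ht.le
    linarith
  · refine Eventually.of_forall fun x t _ => ?_
    have h1 : HasDerivAt (fun t : ℝ => v x + t * φ x) (φ x) t := by
      simpa using ((hasDerivAt_id t).mul_const (φ x)).const_add (v x)
    exact (hF x _).comp t h1

end Space

/-! ### Directional derivatives of the modified functional -/

section Derivative

variable {N : ℕ} {V : Euc N → ℝ} {V₀ V₁ m q lam κ R ε : ℝ}

theorem hasDerivAt_integral_potential (hm : 1 < m) (hN : 3 ≤ N) (hV : PotBounds V V₀ V₁)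
    {v φ : Euc N → ℝ} (hv : MemX V v) (hφ : MemX V φ) :
    Integrable (fun x => V x * changeVar m (v x) ^ 2) ∧
      Integrable (fun x => V x * changeVar m (v x) * changeVarDeriv m (v x) * φ x) ∧
      HasDerivAt (fun t : ℝ => ∫ x, V x * changeVar m (v x + t * φ x) ^ 2)
        (2 * ∫ x, V x * changeVar m (v x) * changeVarDeriv m (v x) * φ x) 0 := by
  have hp := (twoStar_eq hN).2
  have hV1 := hV.upper_nonneg
  have h := hasDerivAt_integral_superposition (F := fun x s => V x * changeVar m s ^ 2)
    (b := fun x s => 2 * (V x * changeVar m s * changeVarDeriv m s)) (C := 2 * V₁) hp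
    (by positivity) (fun x s => ?_) (fun x => by simp [changeVar_zero m hm]) (fun x s => ?_)
    (fun w hw => hV.cont.aestronglyMeasurable.mul
      (((continuous_changeVar hm).comp_aestronglyMeasurable hw).pow 2))
    (fun w hw => ((hV.cont.aestronglyMeasurable.mul
      ((continuous_changeVar hm).comp_aestronglyMeasurable hw)).mul
        ((continuous_changeVarDeriv hm).comp_aestronglyMeasurable hw)).const_mul 2)
    hv.1.1 (hv.integrable_rpow hN).1 hφ.1.1 (hφ.integrable_rpow hN).1
  · obtain ⟨h1, h2, h3⟩ := h
    refine ⟨h1, ?_, ?_⟩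
    · have := h2.const_mul 2⁻¹
      refine this.congr (Eventually.of_forall fun x => ?_)
      ring
    · convert! h3 using 1
      rw [← integral_const_mul]
      refine integral_congr_ae (Eventually.of_forall fun x => ?_)
      ring
  · have := ((hasDerivAt_changeVar' hm s).pow 2).const_mul (V x)
    convert! this using 1
    push_cast
    ring
  · have h1 := abs_changeVar_le hm s
    have h2 := changeVarDeriv_le_one hm s
    have h3 := (changeVarDeriv_pos hm s).le
    have h4 := Real.rpow_nonneg (abs_nonneg s) (twoStar N - 1)
    rw [abs_mul, abs_mul, abs_mul, abs_of_nonneg (hV.nonneg x), abs_of_nonneg h3, abs_two]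
    have h5 : V x * |changeVar m s| * changeVarDeriv m s ≤ V₁ * |s| * 1 := by
      have := hV.upper x
      have := hV.nonneg x
      gcongr
    have h6 : 0 ≤ 2 * V₁ * |s| ^ (twoStar N - 1) := by positivity
    linarith

theorem hasDerivAt_integral_PFun (h : Admissible N m q lam V₀ κ)
    {v φ : Euc N → ℝ} (hv : MemX V v) (hφ : MemX V φ) :
    Integrable (fun x => PFun m q lam V₀ κ R x (changeVar m (v x))) ∧
      Integrable (fun x => pFun m q lam V₀ κ R x (changeVar m (v x)) * changeVarDeriv m (v x) * φ x) ∧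
      HasDerivAt (fun t : ℝ => ∫ x, PFun m q lam V₀ κ R x (changeVar m (v x + t * φ x)))
        (∫ x, pFun m q lam V₀ κ R x (changeVar m (v x)) * changeVarDeriv m (v x) * φ x) 0 := by
  have hm := h.one_lt
  obtain ⟨C, hC0, hC⟩ := exists_pFun_growth h
  exact hasDerivAt_integral_superposition (F := fun x s => PFun m q lam V₀ κ R x (changeVar m s))
    (b := fun x s => pFun m q lam V₀ κ R x (changeVar m s) * changeVarDeriv m s) h.two_lt hC0
    (fun x s => (hasDerivAt_PFun h x _).comp s (hasDerivAt_changeVar' hm s))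
    (fun x => by simp [changeVar_zero m hm, PFun]) (hC R)
    (fun w hw => aestronglyMeasurable_PFun h ((continuous_changeVar hm).comp_aestronglyMeasurable hw))
    (fun w hw => (aestronglyMeasurable_pFun h
      ((continuous_changeVar hm).comp_aestronglyMeasurable hw)).mul
        ((continuous_changeVarDeriv hm).comp_aestronglyMeasurable hw))
    hv.1.1 (hv.integrable_rpow h.three_le).1 hφ.1.1 (hφ.integrable_rpow h.three_le).1

theorem integrable_inner_of_memLp {G H : Euc N → Euc N} (hG : MemLp G 2 volume)
    (hH : MemLp H 2 volume) : Integrable fun x => inner ℝ (G x) (H x) := by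
  refine (hG.norm.integrable_mul hH.norm).mono' (hG.1.inner hH.1)
    (Eventually.of_forall fun x => ?_)
  exact norm_inner_le_norm _ _

theorem hasDerivAt_integral_weakGrad {v φ : Euc N → ℝ} (hv : MemH1 v) (hφ : MemH1 φ) :
    HasDerivAt (fun t : ℝ => ∫ x, ‖weakGrad (v + t • φ) x‖ ^ 2)
      (2 * ∫ x, inner ℝ (weakGrad v x) (weakGrad φ x)) 0 := by
  have mv := hv.memLp_weakGrad
  have mφ := hφ.memLp_weakGrad
  have hi : Integrable fun x => inner ℝ (weakGrad v x) (weakGrad φ x) := integrable_inner_of_memLp mv mφ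
  have heq : ∀ t : ℝ, ∫ x, ‖weakGrad (v + t • φ) x‖ ^ 2 = (∫ x, ‖weakGrad v x‖ ^ 2)
      + (2 * ∫ x, inner ℝ (weakGrad v x) (weakGrad φ x)) * t + (∫ x, ‖weakGrad φ x‖ ^ 2) * t ^ 2 := by
    intro t
    rw [integral_norm_sq_congr (hv.isWeakGrad.add (hφ.isWeakGrad.const_smul t)).weakGrad_ae_eq]
    have i2 : Integrable fun x => ‖weakGrad v x‖ ^ 2
        + 2 * t * inner ℝ (weakGrad v x) (weakGrad φ x) :=
      (integrable_norm_sq mv).add (hi.const_mul _)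
    calc ∫ x, ‖(weakGrad v + t • weakGrad φ) x‖ ^ 2
        = ∫ x, (‖weakGrad v x‖ ^ 2 + 2 * t * inner ℝ (weakGrad v x) (weakGrad φ x)
          + t ^ 2 * ‖weakGrad φ x‖ ^ 2) := by
          refine integral_congr_ae (Eventually.of_forall fun x => ?_)
          simp only [Pi.add_apply, Pi.smul_apply]
          rw [norm_add_sq_real, inner_smul_right, norm_smul, mul_pow, Real.norm_eq_abs, sq_abs]
          ring
      _ = _ := by
          rw [integral_add i2 ((integrable_norm_sq mφ).const_mul _),
            integral_add (integrable_norm_sq mv) (hi.const_mul _), integral_const_mul,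
            integral_const_mul]
          ring
  simp only [heq]
  have h1 : HasDerivAt (fun t : ℝ => (∫ x, ‖weakGrad v x‖ ^ 2)
      + (2 * ∫ x, inner ℝ (weakGrad v x) (weakGrad φ x)) * t) _ 0 :=
    ((hasDerivAt_id (0 : ℝ)).const_mul (2 * ∫ x, inner ℝ (weakGrad v x) (weakGrad φ x))).const_add _
  have h2 := h1.add (((hasDerivAt_id (0 : ℝ)).pow 2).const_mul (∫ x, ‖weakGrad φ x‖ ^ 2))
  convert! h2 using 1
  simp

/-- The directional derivative of the modified functional. -/
def JbarDeriv (V : Euc N → ℝ) (ε m q lam V₀ κ R : ℝ) (v φ : Euc N → ℝ) : ℝ :=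
  ε ^ 2 * (∫ x, inner ℝ (weakGrad v x) (weakGrad φ x))
    + (∫ x, V x * changeVar m (v x) * changeVarDeriv m (v x) * φ x)
    - ∫ x, pFun m q lam V₀ κ R x (changeVar m (v x)) * changeVarDeriv m (v x) * φ x

theorem hasDerivAt_Jbar (h : Admissible N m q lam V₀ κ) (hV : PotBounds V V₀ V₁)
    {v φ : Euc N → ℝ} (hv : MemX V v) (hφ : MemX V φ) :
    HasDerivAt (fun t : ℝ => Jbar V ε m q lam V₀ κ R (v + t • φ))
      (JbarDeriv V ε m q lam V₀ κ R v φ) 0 := by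
  have h1 := (hasDerivAt_integral_weakGrad hv.1 hφ.1).const_mul (ε ^ 2 / 2)
  have h2 := (hasDerivAt_integral_potential h.one_lt h.three_le hV hv hφ).2.2.const_mul (1 / 2)
  have h3 := (hasDerivAt_integral_PFun (R := R) h hv hφ).2.2
  convert! (h1.add h2).sub h3 using 1
  rw [JbarDeriv]
  ring

end Derivative

/-! ### The energy estimate and boundedness of Palais–Smale sequences -/

section Energy

variable {N : ℕ} {V : Euc N → ℝ} {V₀ V₁ m q lam κ R ε θ : ℝ}

theorem normX_sq (hV : PotBounds V V₀ V₁) (u : Euc N → ℝ) :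
    normX V u ^ 2 = (∫ x, ‖weakGrad u x‖ ^ 2) + ∫ x, V x * u x ^ 2 :=
  Real.sq_sqrt (add_nonneg (integral_nonneg fun _ => sq_nonneg _)
    (integral_nonneg fun x => mul_nonneg (hV.nonneg x) (sq_nonneg _)))

/-- The derivative of f/f' lies in [1, m] and f/f' vanishes at 0, so the chain rule applies and the
norm grows by at most the factor m. This direction is used because multiplying it by f'(v) gives
f(v). -/
theorem MemX.changeVarQuot (hm : 1 < m) (hV : PotBounds V V₀ V₁) {v : Euc N → ℝ} (hv : MemX V v) :
    MemX V (fun x => changeVarQuot m (v x)) ∧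
      weakGrad (fun x => changeVarQuot m (v x)) =ᵐ[volume]
        (fun x => changeVarQuotDeriv m (v x) • weakGrad v x) ∧
      normX V (fun x => QuasiSchrodinger.changeVarQuot m (v x)) ≤ m * normX V v := by
  obtain ⟨h1, h2, h3⟩ := hv.1.isWeakGrad.comp hv.1.1 hv.1.memLp_weakGrad
    (hasDerivAt_changeVarQuot hm) (continuous_changeVarQuotDeriv hm) (C := m) (fun t => by
      rw [abs_of_nonneg (zero_le_one.trans (one_le_changeVarQuotDeriv hm t))]
      exact changeVarQuotDeriv_le hm t) (changeVarQuot_zero hm)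
  have hX := h1.memX h2 h3 hV
  refine ⟨hX, h1.weakGrad_ae_eq, ?_⟩
  have hn : 0 ≤ m * normX V v := mul_nonneg (by linarith) (Real.sqrt_nonneg _)
  refine le_of_sq_le_sq ?_ hn
  rw [mul_pow, normX_sq hV, normX_sq hV, mul_add, integral_norm_sq_congr h1.weakGrad_ae_eq,
    ← integral_const_mul, ← integral_const_mul]
  refine add_le_add (integral_mono (integrable_norm_sq h3)
    ((integrable_norm_sq hv.1.memLp_weakGrad).const_mul _) fun x => ?_)
    (integral_mono hX.2 (hv.2.const_mul _) fun x => ?_)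
  · beta_reduce
    rw [norm_smul, mul_pow, Real.norm_eq_abs, sq_abs]
    refine mul_le_mul_of_nonneg_right ?_ (sq_nonneg _)
    exact pow_le_pow_left₀ (zero_le_one.trans (one_le_changeVarQuotDeriv hm _))
      (changeVarQuotDeriv_le hm _) 2
  · have h4 := pow_le_pow_left₀ (abs_nonneg _) (abs_changeVarQuot_le hm (v x)) 2
    rw [sq_abs, mul_pow, sq_abs] at h4
    have := mul_le_mul_of_nonneg_left h4 (hV.nonneg x)
    beta_reduce
    linarith

theorem integrable_changeVar_crit (h : Admissible N m q lam V₀ κ) {v : Euc N → ℝ} (hv : MemX V v) :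
    Integrable fun x => changeVar m (max (v x) 0) ^ (twoStar N * m) := by
  have hm := h.one_lt
  have hp := h.two_lt
  have hc : Continuous fun s : ℝ => changeVar m (max s 0) ^ (twoStar N * m) :=
    ((continuous_changeVar hm).comp (continuous_id.max continuous_const)).rpow_const
      fun _ => Or.inr (by linarith [h.two_lt_crit])
  refine ((hv.integrable_rpow h.three_le).1.const_mul (√m ^ twoStar N)).mono'
    (hc.comp_aestronglyMeasurable hv.1.1.1) (Eventually.of_forall fun x => ?_)
  have h0 := le_max_right (v x) 0
  rw [Real.norm_of_nonneg (Real.rpow_nonneg (changeVar_nonneg hm h0) _)]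
  refine (changeVar_rpow_mul_le hm (by linarith) h0).trans ?_
  refine mul_le_mul_of_nonneg_left (Real.rpow_le_rpow h0 ?_ (by linarith))
    (Real.rpow_nonneg (Real.sqrt_nonneg _) _)
  exact max_le (le_abs_self _) (abs_nonneg _)

/-- The energy estimate. -/
theorem energy_estimate (h : Admissible N m q lam V₀ κ) (hV : PotBounds V V₀ V₁)
    (hθ : 2 * m < θ) (hθq : θ ≤ q) {v : Euc N → ℝ} (hv : MemX V v) :
    (1 / 2 - m / θ) * (ε ^ 2 * ∫ x, ‖weakGrad v x‖ ^ 2)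
      + (1 / 2 - 1 / θ - 1 / (2 * κ)) * (∫ x, V x * changeVar m (v x) ^ 2)
      + (1 / θ - 1 / (twoStar N * m)) *
        (∫ x in Metric.ball (0 : Euc N) R, changeVar m (max (v x) 0) ^ (twoStar N * m)) ≤
    Jbar V ε m q lam V₀ κ R v
      - 1 / θ * JbarDeriv V ε m q lam V₀ κ R v (fun x => changeVarQuot m (v x)) := by
  have hm := h.one_lt
  have hθ0 : 0 < θ := by linarith
  have hκ : 0 < κ := by
    have := h.slope_pos
    by_contra hneg
    have := div_nonpos_of_nonneg_of_nonpos hV.pos.le (not_lt.1 hneg)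
    linarith
  obtain ⟨hX, hgrad, -⟩ := hv.changeVarQuot hm hV
  obtain ⟨iV, iVd, -⟩ := hasDerivAt_integral_potential hm h.three_le hV hv hX
  obtain ⟨iP, ip, -⟩ := hasDerivAt_integral_PFun (R := R) h hv hX
  have iG := integrable_norm_sq hv.1.memLp_weakGrad
  have e1 : ∫ x, inner ℝ (weakGrad v x) (weakGrad (fun x => changeVarQuot m (v x)) x)
      ≤ m * ∫ x, ‖weakGrad v x‖ ^ 2 := by
    rw [← integral_const_mul]
    refine integral_mono_ae (integrable_inner_of_memLp hv.1.memLp_weakGrad hX.1.memLp_weakGrad)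
      (iG.const_mul m) ?_
    filter_upwards [hgrad] with x hx
    rw [hx, inner_smul_right, real_inner_self_eq_norm_sq]
    exact mul_le_mul_of_nonneg_right (changeVarQuotDeriv_le hm _) (sq_nonneg _)
  have e2 : ∫ x, V x * changeVar m (v x) * changeVarDeriv m (v x) * changeVarQuot m (v x)
      = ∫ x, V x * changeVar m (v x) ^ 2 := by
    refine integral_congr_ae (Eventually.of_forall fun x => ?_)
    simp only [mul_assoc, changeVarDeriv_mul_quot hm]
    ring
  have e3 : (fun x => pFun m q lam V₀ κ R x (changeVar m (v x)) * changeVarDeriv m (v x)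
      * changeVarQuot m (v x)) = fun x => pFun m q lam V₀ κ R x (changeVar m (v x)) * changeVar m (v x) := by
    funext x
    rw [mul_assoc, changeVarDeriv_mul_quot hm]
  rw [e3] at ip
  have icrit := integrable_changeVar_crit h hv
  -- Inside the ball this is `gammaFun_ar`, and the V term is given away so as to integrate over the
  -- whole space. Outside, p f/θ ≥ 0 is dropped and P ≤ (V₀/2κ) f² ≤ V f²/(2κ), whence the loss
  -- 1/(2κ) in the potential coefficient.
  have e4 : (1 / θ - 1 / (twoStar N * m)) *
        (∫ x in Metric.ball (0 : Euc N) R, changeVar m (max (v x) 0) ^ (twoStar N * m))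
        - 1 / (2 * κ) * ∫ x, V x * changeVar m (v x) ^ 2
      ≤ 1 / θ * (∫ x, pFun m q lam V₀ κ R x (changeVar m (v x)) * changeVar m (v x))
        - ∫ x, PFun m q lam V₀ κ R x (changeVar m (v x)) := by
    rw [← integral_indicator Metric.isOpen_ball.measurableSet, ← integral_const_mul,
      ← integral_const_mul, ← integral_const_mul, ← integral_sub _ (iV.const_mul _),
      ← integral_sub (ip.const_mul _) iP]
    · refine integral_mono (((icrit.indicator Metric.isOpen_ball.measurableSet).const_mul _).sub
        (iV.const_mul _)) ((ip.const_mul _).sub iP) fun x => ?_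
      beta_reduce
      have hVx := hV.lower x
      by_cases hx : x ∈ Metric.ball (0 : Euc N) R
      · rw [Set.indicator_of_mem hx, pFun_of_mem hx, PFun_of_mem hx]
        have := gammaFun_ar h hθ0 hθq (v x)
        have : 0 ≤ 1 / (2 * κ) * (V x * changeVar m (v x) ^ 2) := by
          have := hV.nonneg x
          positivity
        linarith
      · rw [Set.indicator_of_notMem hx, mul_zero, zero_sub, PFun_of_notMem hx]
        have h1 := gammaBarPrim_le h (changeVar m (v x))
        have h2 : 0 ≤ pFun m q lam V₀ κ R x (changeVar m (v x)) * changeVar m (v x) := by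
          rcases le_total (v x) 0 with hs | hs
          · rw [pFun_of_notMem hx, gammaBar_of_nonpos h (changeVar_nonpos hm hs), zero_mul]
          · exact mul_nonneg (pFun_nonneg h x _) (changeVar_nonneg hm hs)
        have h3 : 0 ≤ 1 / θ * (pFun m q lam V₀ κ R x (changeVar m (v x)) * changeVar m (v x)) :=
          mul_nonneg (by positivity) h2
        have h4 : V₀ / κ / 2 * changeVar m (v x) ^ 2 ≤ 1 / (2 * κ) * (V x * changeVar m (v x) ^ 2) := by
          have : V₀ / κ / 2 * changeVar m (v x) ^ 2 = 1 / (2 * κ) * (V₀ * changeVar m (v x) ^ 2) := by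
            field_simp
          rw [this]
          gcongr
        linarith
    · exact (icrit.indicator Metric.isOpen_ball.measurableSet).const_mul _
  rw [Jbar, JbarDeriv, e2, e3]
  have e5 : 1 / θ * (ε ^ 2 * ∫ x, inner ℝ (weakGrad v x) (weakGrad (fun x => changeVarQuot m (v x)) x))
      ≤ m / θ * (ε ^ 2 * ∫ x, ‖weakGrad v x‖ ^ 2) := by
    have := mul_le_mul_of_nonneg_left e1 (show 0 ≤ 1 / θ * ε ^ 2 by positivity)
    calc _ = 1 / θ * ε ^ 2 * ∫ x, inner ℝ (weakGrad v x)
          (weakGrad (fun x => changeVarQuot m (v x)) x) := by ring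
      _ ≤ _ := this
      _ = _ := by ring
  linarith

/-- Three ranges: |w| ≤ 1, 1 ≤ |w| ≤ K, and |w| ≥ K, where w² = |w|^(2−p) |w|^p. The level K is
free, and is adapted to the energy in `integral_sq_le`. -/
theorem sq_le_of_one_le {p K : ℝ} (hp : 2 < p) (hK : 1 ≤ K) (w : ℝ) :
    w ^ 2 ≤ K ^ 2 * min |w| 1 ^ 2 + K ^ (2 - p) * |w| ^ p := by
  have n1 : 0 ≤ K ^ (2 - p) * |w| ^ p :=
    mul_nonneg (Real.rpow_nonneg (by linarith) _) (Real.rpow_nonneg (abs_nonneg _) _)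
  rcases le_total |w| 1 with h1 | h1
  · rw [min_eq_left h1, sq_abs]
    have : w ^ 2 ≤ K ^ 2 * w ^ 2 := le_mul_of_one_le_left (sq_nonneg _) (one_le_pow₀ hK)
    linarith
  rw [min_eq_right h1, one_pow, mul_one]
  rcases le_total |w| K with h2 | h2
  · have := pow_le_pow_left₀ (abs_nonneg w) h2 2
    rw [sq_abs] at this
    linarith
  · have hw : 0 < |w| := by linarith
    have h3 : |w| ^ (2 - p) ≤ K ^ (2 - p) :=
      Real.rpow_le_rpow_of_nonpos (by linarith) h2 (by linarith)
    have h4 : |w| ^ (2 - p) * |w| ^ p = w ^ 2 := by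
      rw [← Real.rpow_add hw, sub_add_cancel]
      simp
    have := mul_le_mul_of_nonneg_right h3 (Real.rpow_nonneg hw.le p)
    nlinarith [sq_nonneg K]

/-- Sobolev bounds ∫|v|^p only by (D/S)^(p/2). Splitting at K = √D multiplies this by D^(1−p/2) and
leaves a term linear in D, at the price of a factor D on the small part. Quadratic growth in D makes
the norm of X at most linear in D, as the absorption in `eventually_bounded` requires. -/
theorem integral_sq_le (hm : 1 < m) (hN : 3 ≤ N) (hV : PotBounds V V₀ V₁) {v : Euc N → ℝ}
    (hv : MemX V v) {D : ℝ} (hD : 1 ≤ D) (h1 : ∫ x, ‖weakGrad v x‖ ^ 2 ≤ D)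
    (h2 : ∫ x, V x * changeVar m (v x) ^ 2 ≤ D) :
    ∫ x, v x ^ 2 ≤ (4 / V₀ + (sobolevConst N ^ (twoStar N / 2))⁻¹) * D ^ 2 := by
  have hp := (twoStar_eq hN).2
  have hS := sobolevConst_pos hN
  have hSp := Real.rpow_pos_of_pos hS (twoStar N / 2)
  set p := twoStar N with hpdef
  have hD0 : 0 < D := by linarith
  have hK : 1 ≤ √D := Real.one_le_sqrt.2 hD
  obtain ⟨iV, -, -⟩ := hasDerivAt_integral_potential hm hN hV hv hv
  obtain ⟨ip, hip⟩ := hv.integrable_rpow hN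
  have e1 : ∫ x, v x ^ 2 ≤ D * (4 / V₀) * (∫ x, V x * changeVar m (v x) ^ 2)
      + √D ^ (2 - p) * ∫ x, |v x| ^ p := by
    rw [← integral_const_mul, ← integral_const_mul, ← integral_add (iV.const_mul _) (ip.const_mul _)]
    refine integral_mono (integrable_sq hv.1.1) ((iV.const_mul _).add (ip.const_mul _)) fun x => ?_
    refine (sq_le_of_one_le hp hK (v x)).trans (add_le_add ?_ le_rfl)
    rw [Real.sq_sqrt hD0.le, mul_assoc]
    refine mul_le_mul_of_nonneg_left ?_ hD0.le
    have h3 := pow_le_pow_left₀ (le_min (abs_nonneg _) zero_le_one) (min_abs_one_le hm (v x)) 2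
    rw [mul_pow, sq_abs] at h3
    refine h3.trans ?_
    rw [div_mul_eq_mul_div, le_div_iff₀ hV.pos]
    have := mul_le_mul_of_nonneg_right (hV.lower x) (sq_nonneg (changeVar m (v x)))
    linarith
  have e2 : √D ^ (2 - p) * ∫ x, |v x| ^ p ≤ (sobolevConst N ^ (p / 2))⁻¹ * D := by
    have h3 : ∫ x, |v x| ^ p ≤ (D / sobolevConst N) ^ (p / 2) := by
      refine hip.trans (Real.rpow_le_rpow ?_ (by gcongr) (by positivity))
      exact div_nonneg (integral_nonneg fun x => sq_nonneg _) hS.le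
    calc √D ^ (2 - p) * ∫ x, |v x| ^ p ≤ √D ^ (2 - p) * (D / sobolevConst N) ^ (p / 2) :=
          mul_le_mul_of_nonneg_left h3 (Real.rpow_nonneg (Real.sqrt_nonneg _) _)
      _ = (D ^ ((1 / 2) * (2 - p)) * D ^ (p / 2)) * (sobolevConst N ^ (p / 2))⁻¹ := by
          rw [Real.div_rpow hD0.le hS.le, Real.sqrt_eq_rpow, ← Real.rpow_mul hD0.le]
          ring
      _ = _ := by
          rw [← Real.rpow_add hD0, show 1 / 2 * (2 - p) + p / 2 = 1 by ring, Real.rpow_one, mul_comm]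
  have e3 : D ≤ D ^ 2 := by nlinarith
  calc ∫ x, v x ^ 2 ≤ D * (4 / V₀) * D + (sobolevConst N ^ (p / 2))⁻¹ * D ^ 2 := by
        refine e1.trans (add_le_add ?_ (e2.trans ?_))
        · have := hV.pos
          gcongr
        · gcongr
    _ = _ := by ring

/-- The condition κ > θ/(θ−2) is exactly positivity of the potential coefficient of the energy
estimate, and θ > 2m that of the gradient coefficient. The consequence κ > 1 makes the outside term
coercive. -/
theorem slope_coeff_pos {κ : ℝ} (hm : 1 < m) (hθ : 2 * m < θ) (hκ : θ / (θ - 2) < κ) :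
    0 < κ ∧ 1 < κ ∧ 0 < 1 / 2 - m / θ ∧ 0 < 1 / 2 - 1 / θ - 1 / (2 * κ) := by
  have h2 : 0 < θ - 2 := by linarith
  have h3 : 1 < θ / (θ - 2) := by rw [one_lt_div h2]; linarith
  have hκ1 : 1 < κ := h3.trans hκ
  have hκ0 : 0 < κ := by linarith
  have hθ0 : 0 < θ := by linarith
  refine ⟨hκ0, hκ1, ?_, ?_⟩
  · rw [sub_pos, div_lt_div_iff₀ hθ0 two_pos]
    linarith
  · rw [div_lt_iff₀ h2] at hκ
    have : 1 / 2 - 1 / θ - 1 / (2 * κ) = (κ * (θ - 2) - θ) / (2 * θ * κ) := by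
      field_simp
    rw [this]
    exact div_pos (by linarith) (by positivity)

/-- Palais–Smale sequences are bounded. -/
theorem eventually_bounded (h : Admissible N m q lam V₀ κ) (hV : PotBounds V V₀ V₁)
    (hθ : 2 * m < θ) (hθq : θ ≤ q) (hκ : θ / (θ - 2) < κ) (hε : 0 < ε) {c : ℝ}
    {v : ℕ → Euc N → ℝ} (hv : ∀ n, MemX V (v n))
    (hJ : Tendsto (fun n => Jbar V ε m q lam V₀ κ R (v n)) atTop (𝓝 c))
    {δ : ℕ → ℝ} (hδ : Tendsto δ atTop (𝓝 0))
    (hL : ∀ n φ, MemX V φ → |JbarDeriv V ε m q lam V₀ κ R (v n) φ| ≤ δ n * normX V φ) :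
    ∃ M, ∀ᶠ n in atTop, normX V (v n) ≤ M := by
  have hm := h.one_lt
  obtain ⟨hκ0, -, c1, c2⟩ := slope_coeff_pos hm hθ hκ
  have hp := h.two_lt
  have hθ0 : 0 < θ := by linarith
  set C₀ : ℝ := 4 / V₀ + (sobolevConst N ^ (twoStar N / 2))⁻¹ with hC₀
  have hC₀pos : 0 < C₀ := by
    have := hV.pos
    have := Real.rpow_pos_of_pos (sobolevConst_pos h.three_le) (twoStar N / 2)
    positivity
  have hV1 := hV.upper_nonneg
  set B : ℝ := √(1 + V₁ * C₀) with hB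
  have hB0 : 0 < B := Real.sqrt_pos.2 (by positivity)
  set ρ : ℝ := min ((1 / 2 - m / θ) * ε ^ 2) (1 / 2 - 1 / θ - 1 / (2 * κ)) with hρ
  have hρ0 : 0 < ρ := lt_min (by positivity) c2
  -- The norm is at most B D, while the energy estimate bounds ρ(D − 1) by J̄ plus a multiple of |δ
  -- n| times the norm. Once δ n is small the remainder is at most (ρ/2) D, so (ρ/2) D ≤ c + 1 + ρ;
  -- this gives the final bound.
  have key : ∀ n, ∀ D, D = max 1 ((∫ x, ‖weakGrad (v n) x‖ ^ 2)
      + ∫ x, V x * changeVar m (v n x) ^ 2) → normX V (v n) ≤ B * D ∧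
      ρ * (D - 1) ≤ Jbar V ε m q lam V₀ κ R (v n) + 1 / θ * (|δ n| * (m * normX V (v n))) := by
    intro n D hD
    have hD1 : 1 ≤ D := by rw [hD]; exact le_max_left _ _
    have i1 : 0 ≤ ∫ x, ‖weakGrad (v n) x‖ ^ 2 := integral_nonneg fun x => sq_nonneg _
    have i2 : 0 ≤ ∫ x, V x * changeVar m (v n x) ^ 2 :=
      integral_nonneg fun x => mul_nonneg (hV.nonneg x) (sq_nonneg _)
    have hsum : (∫ x, ‖weakGrad (v n) x‖ ^ 2) + ∫ x, V x * changeVar m (v n x) ^ 2 ≤ D := by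
      rw [hD]; exact le_max_right _ _
    have hsq := integral_sq_le hm h.three_le hV (hv n) hD1 (by linarith) (by linarith)
    constructor
    · refine le_of_sq_le_sq ?_ (by positivity)
      rw [normX_sq hV, mul_pow, hB, Real.sq_sqrt (by positivity)]
      have h1 : ∫ x, V x * v n x ^ 2 ≤ V₁ * ∫ x, v n x ^ 2 := by
        rw [← integral_const_mul]
        refine integral_mono (hv n).2 ((integrable_sq (hv n).1.1).const_mul _) fun x => ?_
        exact mul_le_mul_of_nonneg_right (hV.upper x) (sq_nonneg _)
      have h2 := mul_le_mul_of_nonneg_left hsq hV1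
      nlinarith
    · have he := energy_estimate (R := R) (ε := ε) h hV hθ hθq (hv n)
      obtain ⟨hX, -, hXn⟩ := (hv n).changeVarQuot hm hV
      have h1 := (abs_le.1 (hL n _ hX)).1
      have h2 : δ n * normX V (fun x => changeVarQuot m (v n x)) ≤ |δ n| * (m * normX V (v n)) :=
        mul_le_mul (le_abs_self _) hXn (Real.sqrt_nonneg _) (abs_nonneg _)
      have h3 : 0 ≤ (1 / θ - 1 / (twoStar N * m)) * (∫ x in Metric.ball (0 : Euc N) R,
          changeVar m (max (v n x) 0) ^ (twoStar N * m)) := by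
        refine mul_nonneg (sub_nonneg.2 (one_div_le_one_div_of_le hθ0 (hθq.trans h.q_lt.le))) ?_
        exact integral_nonneg fun x => Real.rpow_nonneg (changeVar_nonneg hm (le_max_right _ _)) _
      have h4 : 1 / θ * (-(|δ n| * (m * normX V (v n))))
          ≤ 1 / θ * JbarDeriv V ε m q lam V₀ κ R (v n) (fun x => changeVarQuot m (v n x)) :=
        mul_le_mul_of_nonneg_left (by linarith) (by positivity)
      have h5 : ρ * (∫ x, ‖weakGrad (v n) x‖ ^ 2)
          ≤ (1 / 2 - m / θ) * (ε ^ 2 * ∫ x, ‖weakGrad (v n) x‖ ^ 2) := by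
        rw [← mul_assoc]
        exact mul_le_mul_of_nonneg_right (min_le_left _ _) i1
      have h6 : ρ * (∫ x, V x * changeVar m (v n x) ^ 2)
          ≤ (1 / 2 - 1 / θ - 1 / (2 * κ)) * ∫ x, V x * changeVar m (v n x) ^ 2 :=
        mul_le_mul_of_nonneg_right (min_le_right _ _) i2
      have h7 : D - 1 ≤ (∫ x, ‖weakGrad (v n) x‖ ^ 2) + ∫ x, V x * changeVar m (v n x) ^ 2 := by
        rw [hD, sub_le_iff_le_add]
        exact max_le (by linarith) (by linarith)
      have h8 := mul_le_mul_of_nonneg_left h7 hρ0.le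
      linarith
  have hδ' : Tendsto (fun n => 1 / θ * (|δ n| * (m * B))) atTop (𝓝 0) := by
    have := ((hδ.abs.mul_const (m * B)).const_mul (1 / θ))
    simpa using this
  refine ⟨B * ((c + 1 + ρ) / (ρ / 2)), ?_⟩
  filter_upwards [hδ'.eventually_lt_const (half_pos hρ0),
    hJ.eventually_lt_const (lt_add_one c)] with n hn hJn
  obtain ⟨k1, k2⟩ := key n _ rfl
  set D := max 1 ((∫ x, ‖weakGrad (v n) x‖ ^ 2) + ∫ x, V x * changeVar m (v n x) ^ 2) with hD
  have hD1 : 1 ≤ D := le_max_left _ _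
  refine k1.trans (mul_le_mul_of_nonneg_left ?_ hB0.le)
  rw [le_div_iff₀ (by positivity)]
  have h1 : 1 / θ * (|δ n| * (m * normX V (v n))) ≤ 1 / θ * (|δ n| * (m * B)) * D := by
    have : 1 / θ * (|δ n| * (m * normX V (v n))) ≤ 1 / θ * (|δ n| * (m * (B * D))) := by
      gcongr
    linarith
  have h2 : 1 / θ * (|δ n| * (m * B)) * D ≤ ρ / 2 * D :=
    mul_le_mul_of_nonneg_right hn.le (by linarith)
  linarith

end Energy

/-! ### Passage to the limit in the nonlinear terms -/

section Limits

instance {N : ℕ} (R : ℝ) :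
    IsFiniteMeasure ((volume : Measure (Euc N)).restrict (Metric.ball (0 : Euc N) R)) :=
  ⟨by rw [Measure.restrict_apply_univ]; exact measure_ball_lt_top⟩

variable {N : ℕ} {V : Euc N → ℝ} {V₀ V₁ m q lam κ R M : ℝ} {v : ℕ → Euc N → ℝ} {w : Euc N → ℝ}

/-- The zeroth order term of the derivative outside the ball. -/
def outTerm (V : Euc N → ℝ) (m q lam V₀ κ : ℝ) (x : Euc N) (s : ℝ) : ℝ :=
  (V x * changeVar m s - gammaBar N m q lam V₀ κ (changeVar m s)) * changeVarDeriv m s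

theorem abs_outTerm_le (h : Admissible N m q lam V₀ κ) (hV : PotBounds V V₀ V₁) (x : Euc N) (s : ℝ) :
    |outTerm V m q lam V₀ κ x s| ≤ (V₁ + V₀ / κ) * |s| := by
  have hm := h.one_lt
  have hν := h.slope_pos
  have hd := changeVarDeriv_pos hm s
  have h1 := abs_changeVar_le hm s
  have h2 : gammaBar N m q lam V₀ κ (changeVar m s) ≤ V₀ / κ * |s| := by
    rcases le_total s 0 with hs | hs
    · rw [gammaBar_of_nonpos h (changeVar_nonpos hm hs)]
      positivity
    · refine (gammaBar_le h (changeVar_nonneg hm hs)).trans ?_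
      exact mul_le_mul_of_nonneg_left ((le_abs_self _).trans h1) hν.le
  have h3 : |V x * changeVar m s| ≤ V₁ * |s| := by
    rw [abs_mul, abs_of_nonneg (hV.nonneg x)]
    exact mul_le_mul (hV.upper x) h1 (abs_nonneg _) hV.upper_nonneg
  rw [outTerm, abs_mul, abs_of_pos hd]
  have h4 : |V x * changeVar m s - gammaBar N m q lam V₀ κ (changeVar m s)| ≤ (V₁ + V₀ / κ) * |s| := by
    refine (abs_sub _ _).trans ?_
    rw [abs_of_nonneg (gammaBar_nonneg h _)]
    linarith
  exact (mul_le_of_le_one_right (abs_nonneg _) (changeVarDeriv_le_one hm s)).trans h4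

/-- For s ≥ 0, γ̄(f) ≤ (V₀/κ) f leaves at least V₀(1 − 1/κ) f, and f ≤ m s f' turns s f' into f/m.
For s ≤ 0, γ̄ vanishes and oddness of f reduces to the same estimate. This coercivity takes the
place of a tightness argument at infinity. -/
theorem le_outTerm_mul (h : Admissible N m q lam V₀ κ) (hV : PotBounds V V₀ V₁) (hκ : 1 < κ)
    (x : Euc N) (s : ℝ) :
    V₀ * (1 - 1 / κ) / m * changeVar m s ^ 2 ≤ outTerm V m q lam V₀ κ x s * s := by
  have hm := h.one_lt
  have hV0 := hV.pos
  have hκ1 : 0 < 1 - 1 / κ := by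
    rw [sub_pos, div_lt_one (by linarith)]
    exact hκ
  have key : ∀ t, 0 ≤ t → V₀ * (1 - 1 / κ) / m * changeVar m t ^ 2
      ≤ V₀ * (1 - 1 / κ) * changeVar m t * (changeVarDeriv m t * t) := by
    intro t ht
    have h1 := changeVar_le_mul_deriv hm ht
    have hu := changeVar_nonneg hm ht
    have h2 : changeVar m t / m ≤ changeVarDeriv m t * t := by
      rw [div_le_iff₀ (by linarith)]
      linarith
    calc _ = V₀ * (1 - 1 / κ) * changeVar m t * (changeVar m t / m) := by ring
      _ ≤ _ := mul_le_mul_of_nonneg_left h2 (by positivity)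
  rcases le_total s 0 with hs | hs
  · have h1 := key (-s) (by linarith)
    have hu := changeVar_nonneg hm (show 0 ≤ -s by linarith)
    have hd : changeVarDeriv m (-s) = changeVarDeriv m s := by
      rw [changeVarDeriv, changeVarDeriv, changeVar_neg hm, weight, weight, abs_neg]
    have hd0 := changeVarDeriv_pos hm s
    rw [hd] at h1
    have h3 : V₀ * (1 - 1 / κ) ≤ V x := by
      have : V₀ * (1 - 1 / κ) ≤ V₀ := mul_le_of_le_one_right hV0.le (by
        have : 0 < 1 / κ := by positivity
        linarith)
      exact this.trans (hV.lower x)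
    have h4 : V₀ * (1 - 1 / κ) * changeVar m (-s) * (changeVarDeriv m s * -s)
        ≤ V x * changeVar m (-s) * (changeVarDeriv m s * -s) := by
      have : 0 ≤ -s := by linarith
      gcongr
    rw [outTerm, gammaBar_of_nonpos h (changeVar_nonpos hm hs), sub_zero]
    rw [changeVar_neg hm] at h1 h4
    rw [neg_sq] at h1
    linarith
  · have h1 := key s hs
    have hu := changeVar_nonneg hm hs
    have hd0 := changeVarDeriv_pos hm s
    have h2 := gammaBar_le h hu
    have h3 : V₀ * (1 - 1 / κ) * changeVar m s
        ≤ V x * changeVar m s - gammaBar N m q lam V₀ κ (changeVar m s) := by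
      have := mul_le_mul_of_nonneg_right (hV.lower x) hu
      have e : V₀ * (1 - 1 / κ) * changeVar m s = V₀ * changeVar m s - V₀ / κ * changeVar m s := by
        ring
      linarith
    have h4 := mul_le_mul_of_nonneg_right h3 (mul_nonneg hd0.le hs)
    rw [outTerm]
    linarith

theorem outTerm_mul_nonneg (h : Admissible N m q lam V₀ κ) (hV : PotBounds V V₀ V₁) (hκ : 1 < κ)
    (x : Euc N) (s : ℝ) : 0 ≤ outTerm V m q lam V₀ κ x s * s := by
  refine le_trans ?_ (le_outTerm_mul h hV hκ x s)
  have hm := h.one_lt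
  have : 0 < 1 - 1 / κ := by
    rw [sub_pos, div_lt_one (by linarith)]
    exact hκ
  have := hV.pos
  positivity

theorem continuous_outTerm (h : Admissible N m q lam V₀ κ) (x : Euc N) :
    Continuous (outTerm V m q lam V₀ κ x) := by
  have hf := continuous_changeVar h.one_lt
  exact ((continuous_const.mul hf).sub ((continuous_gammaBar h).comp hf)).mul
    (continuous_changeVarDeriv h.one_lt)

theorem aestronglyMeasurable_outTerm (h : Admissible N m q lam V₀ κ) (hV : PotBounds V V₀ V₁)
    {u : Euc N → ℝ} {μ : Measure (Euc N)} (hu : AEStronglyMeasurable u μ) :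
    AEStronglyMeasurable (fun x => outTerm V m q lam V₀ κ x (u x)) μ := by
  have hf := continuous_changeVar h.one_lt
  exact ((hV.cont.aestronglyMeasurable.mul (hf.comp_aestronglyMeasurable hu)).sub
    (((continuous_gammaBar h).comp hf).comp_aestronglyMeasurable hu)).mul
      ((continuous_changeVarDeriv h.one_lt).comp_aestronglyMeasurable hu)

/-- A bounded sequence in `X` converging almost everywhere, with weakly convergent gradients. -/
structure BoundedConv (V : Euc N → ℝ) (v : ℕ → Euc N → ℝ) (w : Euc N → ℝ) (M : ℝ) : Prop where
  memX : ∀ n, MemX V (v n)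
  memX_lim : MemX V w
  sq_le : ∀ n, ∫ x, v n x ^ 2 ≤ M
  rpow_le : ∀ n, ∫ x, |v n x| ^ twoStar N ≤ M
  grad_sub_le : ∀ n, ∫ x, ‖weakGrad (v n - w) x‖ ^ 2 ≤ M
  rpow_sub_le : ∀ n, ∫ x, |v n x - w x| ^ twoStar N ≤ M
  ae_lim : ∀ᵐ x, Tendsto (fun n => v n x) atTop (𝓝 (w x))
  weak_lim : ∀ K : Euc N → Euc N, MemLp K 2 volume →
    Tendsto (fun n => ∫ x, inner ℝ (weakGrad (v n) x) (K x)) atTop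
      (𝓝 (∫ x, inner ℝ (weakGrad w x) (K x)))

theorem BoundedConv.subseq (hb : BoundedConv V v w M) {σ : ℕ → ℕ} (hσ : StrictMono σ) :
    BoundedConv V (fun n => v (σ n)) w M where
  memX n := hb.memX _
  memX_lim := hb.memX_lim
  sq_le n := hb.sq_le _
  rpow_le n := hb.rpow_le _
  grad_sub_le n := hb.grad_sub_le _
  rpow_sub_le n := hb.rpow_sub_le _
  ae_lim := by
    filter_upwards [hb.ae_lim] with x hx using hx.comp hσ.tendsto_atTop
  weak_lim K hK := (hb.weak_lim K hK).comp hσ.tendsto_atTop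

theorem MemX.sub (hV : PotBounds V V₀ V₁) {u₁ u₂ : Euc N → ℝ} (h₁ : MemX V u₁) (h₂ : MemX V u₂) :
    MemX V (u₁ - u₂) :=
  (h₁.1.isWeakGrad.sub h₂.1.isWeakGrad).memX (h₁.1.1.sub h₂.1.1)
    (h₁.1.memLp_weakGrad.sub h₂.1.memLp_weakGrad) hV

theorem BoundedConv.memX_sub (hb : BoundedConv V v w M) (hV : PotBounds V V₀ V₁) (n : ℕ) :
    MemX V (v n - w) := (hb.memX n).sub hV hb.memX_lim

theorem BoundedConv.tendsto_sub (hb : BoundedConv V v w M) :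
    ∀ᵐ x, Tendsto (fun n => v n x - w x) atTop (𝓝 0) := by
  filter_upwards [hb.ae_lim] with x hx
  simpa using hx.sub_const (w x)

theorem rpow_sub_one_mul_le {p η : ℝ} (hp : 2 < p) (hη : 0 < η) {s w : ℝ} (hs : 0 ≤ s) (hw : 0 ≤ w) :
    s ^ (p - 1) * w ≤ η * s ^ p + (η⁻¹) ^ (p - 1) * w ^ p := by
  have n1 : 0 ≤ η * s ^ p := mul_nonneg hη.le (Real.rpow_nonneg hs _)
  have n2 : 0 ≤ (η⁻¹) ^ (p - 1) * w ^ p :=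
    mul_nonneg (Real.rpow_nonneg (inv_pos.2 hη).le _) (Real.rpow_nonneg hw _)
  rcases le_total w (η * s) with h | h
  · have : s ^ (p - 1) * w ≤ s ^ (p - 1) * (η * s) :=
      mul_le_mul_of_nonneg_left h (Real.rpow_nonneg hs _)
    have e := rpow_sub_one_mul_self (by linarith : p ≠ 0) hs
    nlinarith
  · have h1 : s ≤ η⁻¹ * w := by rwa [← div_eq_inv_mul, le_div_iff₀ hη, mul_comm]
    have h2 := mul_le_mul_of_nonneg_right (Real.rpow_le_rpow hs h1 (by linarith : 0 ≤ p - 1)) hw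
    rw [Real.mul_rpow (inv_pos.2 hη).le hw, mul_assoc,
      rpow_sub_one_mul_self (by linarith : p ≠ 0) hw] at h2
    linarith

theorem integral_restrict_le {f : Euc N → ℝ} (hf : Integrable f) (h0 : ∀ x, 0 ≤ f x) (s : Set (Euc N)) :
    ∫ x in s, f x ≤ ∫ x, f x :=
  setIntegral_le_integral hf (Eventually.of_forall h0)

/-- Linear growth keeps `outTerm` along v_n bounded in L², and it converges almost everywhere, so
its pairing with the fixed function w converges on any set. -/
theorem BoundedConv.tendsto_outTerm_mul (hb : BoundedConv V v w M) (h : Admissible N m q lam V₀ κ)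
    (hV : PotBounds V V₀ V₁) (s : Set (Euc N)) :
    Tendsto (fun n => ∫ x in s, outTerm V m q lam V₀ κ x (v n x) * w x) atTop
      (𝓝 (∫ x in s, outTerm V m q lam V₀ κ x (w x) * w x)) := by
  have mem : ∀ u : Euc N → ℝ, MemX V u →
      MemLp (fun x => outTerm V m q lam V₀ κ x (u x)) 2 (volume.restrict s) := by
    intro u hu
    exact MemLp.two_of_abs_le (hu.1.1.restrict s)
      (aestronglyMeasurable_outTerm h hV hu.1.1.1.restrict) fun x => abs_outTerm_le h hV x _
  have hν := h.slope_pos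
  have hV1 := hV.upper_nonneg
  refine tendsto_integral_mul_of_bounded (M := (V₁ + V₀ / κ) ^ 2 * M) (fun n => mem _ (hb.memX n))
    (mem _ hb.memX_lim) (hb.memX_lim.1.1.restrict s) (fun n => ?_) ?_
  · have i := integrable_sq (hb.memX n).1.1
    calc ∫ x in s, outTerm V m q lam V₀ κ x (v n x) ^ 2
        ≤ ∫ x in s, (V₁ + V₀ / κ) ^ 2 * v n x ^ 2 := by
          refine integral_mono (integrable_sq (mem _ (hb.memX n))) (i.restrict.const_mul _)
            fun x => ?_
          have := pow_le_pow_left₀ (abs_nonneg _) (abs_outTerm_le h hV x (v n x)) 2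
          simpa only [mul_pow, sq_abs] using this
      _ = (V₁ + V₀ / κ) ^ 2 * ∫ x in s, v n x ^ 2 := integral_const_mul _ _
      _ ≤ (V₁ + V₀ / κ) ^ 2 * M := by
          refine mul_le_mul_of_nonneg_left ?_ (sq_nonneg _)
          exact (integral_restrict_le i (fun x => sq_nonneg _) s).trans (hb.sq_le n)
  · refine ae_restrict_of_ae ?_
    filter_upwards [hb.ae_lim] with x hx
    exact ((continuous_outTerm h x).tendsto _).comp hx

/-- On a ball a product of order |s||z| is at most a constant plus a small multiple of |s|^(2*) +
|z|^(2*), and constants are integrable there. This is local compactness in L² in a form that needs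
only almost everywhere convergence. -/
theorem BoundedConv.tendsto_potential (hb : BoundedConv V v w M) (h : Admissible N m q lam V₀ κ)
    (hV : PotBounds V V₀ V₁) :
    Tendsto (fun n => ∫ x in Metric.ball (0 : Euc N) R,
      V x * changeVar m (v n x) * changeVarDeriv m (v n x) * (v n x - w x)) atTop (𝓝 0) := by
  have hm := h.one_lt
  have hp := h.two_lt
  have hV1 := hV.upper_nonneg
  have hz : ∀ n, Integrable fun x => |v n x - w x| ^ twoStar N := fun n =>
    ((hb.memX_sub hV n).integrable_rpow h.three_le).1
  have hvp : ∀ n, Integrable fun x => |v n x| ^ twoStar N := fun n =>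
    ((hb.memX n).integrable_rpow h.three_le).1
  have key := tendsto_integral_abs_of_almost_dominated
    (μ := volume.restrict (Metric.ball (0 : Euc N) R))
    (F := fun n x => V x * changeVar m (v n x) * changeVarDeriv m (v n x) * (v n x - w x))
    (D := fun n x => |v n x| ^ twoStar N + |v n x - w x| ^ twoStar N) (M := M + M)
    (fun n => ?_) (fun n => ((hvp n).add (hz n)).restrict) (fun n x => ?_) (fun n => ?_) ?_ ?_
  · refine squeeze_zero_norm (fun n => ?_) key
    exact norm_integral_le_integral_norm _
  · have hvm := (hb.memX n).1.1.1
    exact (((hV.cont.aestronglyMeasurable.mul ((continuous_changeVar hm).comp_aestronglyMeasurable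
      hvm)).mul ((continuous_changeVarDeriv hm).comp_aestronglyMeasurable hvm)).mul
        (hvm.sub hb.memX_lim.1.1.1)).restrict
  · exact add_nonneg (Real.rpow_nonneg (abs_nonneg _) _) (Real.rpow_nonneg (abs_nonneg _) _)
  · refine (integral_restrict_le ((hvp n).add (hz n)) (fun x => ?_) _).trans ?_
    · exact add_nonneg (Real.rpow_nonneg (abs_nonneg _) _) (Real.rpow_nonneg (abs_nonneg _) _)
    · rw [integral_add' (hvp n) (hz n)]
      exact add_le_add (hb.rpow_le n) (hb.rpow_sub_le n)
  · refine ae_restrict_of_ae ?_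
    filter_upwards [hb.ae_lim, hb.tendsto_sub] with x hx hx0
    have := ((((continuous_changeVar hm).tendsto _).comp hx).const_mul (V x)).mul
      (((continuous_changeVarDeriv hm).tendsto _).comp hx) |>.mul hx0
    simpa using this
  · intro η hη
    obtain ⟨C, hC0, hC⟩ := exists_sq_le_add_rpow hp (show 0 < η / (V₁ + 1) by positivity)
    refine ⟨fun _ => V₁ * (2 * C), integrable_const _, fun n => Eventually.of_forall fun x => ?_⟩
    set s := v n x
    set z := v n x - w x
    have h1 := abs_changeVar_le hm s
    have hd := changeVarDeriv_pos hm s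
    have h2 : |V x * changeVar m s * changeVarDeriv m s * z| ≤ V₁ * |s| * 1 * |z| := by
      rw [abs_mul, abs_mul, abs_mul, abs_of_nonneg (hV.nonneg x), abs_of_pos hd]
      have := hV.upper x
      have := hV.nonneg x
      have := changeVarDeriv_le_one hm s
      gcongr
    have h3 : |s| * |z| ≤ s ^ 2 + z ^ 2 := by
      nlinarith [sq_nonneg (|s| - |z|), sq_abs s, sq_abs z, mul_nonneg (abs_nonneg s) (abs_nonneg z)]
    have n1 := Real.rpow_nonneg (abs_nonneg s) (twoStar N)
    have n2 := Real.rpow_nonneg (abs_nonneg z) (twoStar N)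
    calc _ ≤ V₁ * |s| * 1 * |z| := h2
      _ = V₁ * (|s| * |z|) := by ring
      _ ≤ V₁ * ((C + η / (V₁ + 1) * |s| ^ twoStar N) + (C + η / (V₁ + 1) * |z| ^ twoStar N)) :=
          mul_le_mul_of_nonneg_left (h3.trans (add_le_add (hC s) (hC z))) hV1
      _ = V₁ * (2 * C) + V₁ / (V₁ + 1) * η * (|s| ^ twoStar N + |z| ^ twoStar N) := by
          field_simp
          ring
      _ ≤ V₁ * (2 * C) + 1 * η * (|s| ^ twoStar N + |z| ^ twoStar N) := by
          have : V₁ / (V₁ + 1) ≤ 1 := (div_le_one (by positivity)).2 (by linarith)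
          gcongr
      _ = _ := by ring

theorem integrable_critTerm_mul (h : Admissible N m q lam V₀ κ) {u a : Euc N → ℝ} (hu : MemX V u)
    (ha : MemX V a) : Integrable fun x => critTerm N m q lam (u x) * a x := by
  have hp := h.two_lt
  obtain ⟨C, hC0, hC⟩ := exists_critTerm_le h one_pos
  set b : ℝ := m ^ (twoStar N / 2 - 1) + 1 with hb
  have hb0 : 0 < b := by
    have := Real.rpow_pos_of_pos (by linarith [h.one_lt] : 0 < m) (twoStar N / 2 - 1)
    linarith
  have i1 := integrable_sq hu.1.1
  have i2 := integrable_sq ha.1.1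
  have i3 := (hu.integrable_rpow h.three_le).1
  have i4 := (ha.integrable_rpow h.three_le).1
  refine (((i1.add i2).const_mul C).add ((i3.add i4).const_mul b)).mono'
    (((continuous_critTerm h).comp_aestronglyMeasurable hu.1.1.1).mul ha.1.1.1)
    (Eventually.of_forall fun x => ?_)
  rw [norm_mul, Real.norm_of_nonneg (critTerm_nonneg h _), Real.norm_eq_abs]
  have e1 := mul_le_mul_of_nonneg_right (hC (u x)) (abs_nonneg (a x))
  have e2 := rpow_sub_one_mul_le hp one_pos (abs_nonneg (u x)) (abs_nonneg (a x))
  rw [inv_one, Real.one_rpow, one_mul, one_mul] at e2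
  have e3 : |u x| * |a x| ≤ u x ^ 2 + a x ^ 2 := by
    nlinarith [sq_nonneg (|u x| - |a x|), sq_abs (u x), sq_abs (a x),
      mul_nonneg (abs_nonneg (u x)) (abs_nonneg (a x))]
  have e4 := mul_le_mul_of_nonneg_left e3 hC0
  have e5 := mul_le_mul_of_nonneg_left e2 hb0.le
  simp only [Pi.add_apply]
  linarith

/-- Against a fixed w critical growth is harmless: Young's inequality puts a small coefficient on
v_n² + |v_n|^(2*) and the large one on integrable powers of w. -/
theorem BoundedConv.tendsto_critTerm_mul (hb : BoundedConv V v w M) (h : Admissible N m q lam V₀ κ) :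
    Tendsto (fun n => ∫ x in Metric.ball (0 : Euc N) R, critTerm N m q lam (v n x) * w x) atTop
      (𝓝 (∫ x in Metric.ball (0 : Euc N) R, critTerm N m q lam (w x) * w x)) := by
  have hp := h.two_lt
  have hvp : ∀ n, Integrable fun x => |v n x| ^ twoStar N := fun n =>
    ((hb.memX n).integrable_rpow h.three_le).1
  have hv2 : ∀ n, Integrable fun x => v n x ^ 2 := fun n => integrable_sq (hb.memX n).1.1
  obtain ⟨C, hC0, hC⟩ := exists_critTerm_le h one_pos
  set b : ℝ := m ^ (twoStar N / 2 - 1) + 1 with hbdef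
  have hb0 : 0 < b := by
    have := Real.rpow_pos_of_pos (by linarith [h.one_lt] : 0 < m) (twoStar N / 2 - 1)
    linarith
  have nn : ∀ n x, 0 ≤ v n x ^ 2 + |v n x| ^ twoStar N := fun n x =>
    add_nonneg (sq_nonneg _) (Real.rpow_nonneg (abs_nonneg _) _)
  refine tendsto_integral_of_almost_dominated
    (D := fun n x => v n x ^ 2 + |v n x| ^ twoStar N) (M := M + M)
    (fun n => (integrable_critTerm_mul h (hb.memX n) hb.memX_lim).restrict.aestronglyMeasurable)
    (integrable_critTerm_mul h hb.memX_lim hb.memX_lim).restrict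
    (fun n => ((hv2 n).add (hvp n)).restrict) nn (fun n => ?_) ?_ ?_
  · refine (integral_restrict_le ((hv2 n).add (hvp n)) (nn n) _).trans ?_
    rw [integral_add' (hv2 n) (hvp n)]
    exact add_le_add (hb.sq_le n) (hb.rpow_le n)
  · refine ae_restrict_of_ae ?_
    filter_upwards [hb.ae_lim] with x hx
    exact (((continuous_critTerm h).tendsto _).comp hx).mul_const _
  · intro η hη
    set η' := η / (C + b) with hη'
    have hη'0 : 0 < η' := by positivity
    refine ⟨fun x => C * η'⁻¹ * w x ^ 2 + b * (η'⁻¹) ^ (twoStar N - 1) * |w x| ^ twoStar N,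
      (((integrable_sq hb.memX_lim.1.1).const_mul _).add
        ((hb.memX_lim.integrable_rpow h.three_le).1.const_mul _)).restrict,
      fun n => Eventually.of_forall fun x => ?_⟩
    rw [abs_mul, abs_of_nonneg (critTerm_nonneg h _)]
    have e1 := mul_le_mul_of_nonneg_right (hC (v n x)) (abs_nonneg (w x))
    have e2 := rpow_sub_one_mul_le hp hη'0 (abs_nonneg (v n x)) (abs_nonneg (w x))
    have e3 := young_mul_le (v n x) (w x) hη'0
    rw [abs_mul] at e3
    have e4 := mul_le_mul_of_nonneg_left e3 hC0
    have e5 := mul_le_mul_of_nonneg_left e2 hb0.le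
    have n1 := sq_nonneg (v n x)
    have n2 := Real.rpow_nonneg (abs_nonneg (v n x)) (twoStar N)
    have hηe : η = (C + b) * η' := by rw [hη']; field_simp
    have n3 : 0 ≤ b * η' * v n x ^ 2 := by positivity
    have n4 : 0 ≤ C * η' * |v n x| ^ twoStar N := by positivity
    rw [hηe]
    nlinarith [e1, e4, e5, n3, n4]

theorem BoundedConv.tendsto_subTerm (hb : BoundedConv V v w M) (h : Admissible N m q lam V₀ κ) :
    Integrable (fun x => subTerm m q lam (twoStar N) (w x))
      (volume.restrict (Metric.ball (0 : Euc N) R)) ∧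
    (∀ n, Integrable (fun x => subTerm m q lam (twoStar N) (v n x))
      (volume.restrict (Metric.ball (0 : Euc N) R))) ∧
    Tendsto (fun n => ∫ x in Metric.ball (0 : Euc N) R, subTerm m q lam (twoStar N) (v n x)) atTop
      (𝓝 (∫ x in Metric.ball (0 : Euc N) R, subTerm m q lam (twoStar N) (w x))) := by
  have hvp : ∀ n, Integrable fun x => |v n x| ^ twoStar N := fun n =>
    ((hb.memX n).integrable_rpow h.three_le).1
  have hi : ∀ u : Euc N → ℝ, MemX V u → Integrable (fun x => subTerm m q lam (twoStar N) (u x))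
      (volume.restrict (Metric.ball (0 : Euc N) R)) := by
    intro u hu
    obtain ⟨C, -, hC⟩ := exists_subTerm_le h one_pos
    refine ((integrable_const C).add ((hu.integrable_rpow h.three_le).1.restrict.const_mul 1)).mono'
      ((continuous_subTerm h).comp_aestronglyMeasurable hu.1.1.1.restrict)
      (Eventually.of_forall fun x => ?_)
    rw [Real.norm_of_nonneg (subTerm_nonneg h _)]
    exact hC _
  refine ⟨hi w hb.memX_lim, fun n => hi _ (hb.memX n), ?_⟩
  refine tendsto_integral_of_almost_dominated (D := fun n x => |v n x| ^ twoStar N) (M := M)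
    (fun n => (hi _ (hb.memX n)).aestronglyMeasurable) (hi w hb.memX_lim)
    (fun n => (hvp n).restrict) (fun n x => Real.rpow_nonneg (abs_nonneg _) _) (fun n => ?_) ?_ ?_
  · exact (integral_restrict_le (hvp n) (fun x => Real.rpow_nonneg (abs_nonneg _) _) _).trans
      (hb.rpow_le n)
  · refine ae_restrict_of_ae ?_
    filter_upwards [hb.ae_lim] with x hx
    exact ((continuous_subTerm h).tendsto _).comp hx
  · intro η hη
    obtain ⟨C, -, hC⟩ := exists_subTerm_le h hη
    refine ⟨fun _ => C, integrable_const _, fun n => Eventually.of_forall fun x => ?_⟩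
    rw [abs_of_nonneg (subTerm_nonneg h _)]
    exact hC _

/-- The critical term is controlled by the critical norm of the difference. -/
theorem BoundedConv.exists_critTerm_sub_le (hb : BoundedConv V v w M)
    (h : Admissible N m q lam V₀ κ) (hV : PotBounds V V₀ V₁) :
    ∃ r : ℕ → ℝ, Tendsto r atTop (𝓝 0) ∧ ∀ n,
      ∫ x in Metric.ball (0 : Euc N) R, critTerm N m q lam (v n x) * (v n x - w x) ≤
        m ^ (twoStar N / 2 - 1) * (∫ x, |v n x - w x| ^ twoStar N) + r n := by
  have hp := h.two_lt
  have hz : ∀ n, Integrable fun x => |v n x - w x| ^ twoStar N := fun n =>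
    ((hb.memX_sub hV n).integrable_rpow h.three_le).1
  set a : ℝ := m ^ (twoStar N / 2 - 1) with ha
  have ha0 : 0 < a := Real.rpow_pos_of_pos (by linarith [h.one_lt]) _
  have hc : ∀ n, Integrable fun x => critTerm N m q lam (v n x) * (v n x - w x) := fun n =>
    integrable_critTerm_mul h (hb.memX n) (hb.memX_sub hV n)
  -- Only the positive part of the excess over a |v_n − w|^(2*) has to vanish in the limit. It tends
  -- to 0 almost everywhere, and `exists_critTerm_mul_sub_le` dominates it up to η |v_n − w|^(2*).
  set F : ℕ → Euc N → ℝ := fun n x =>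
    max (critTerm N m q lam (v n x) * (v n x - w x) - a * |v n x - w x| ^ twoStar N) 0 with hF
  have hFi : ∀ n, Integrable (F n) := fun n => ((hc n).sub ((hz n).const_mul a)).pos_part
  have key := tendsto_integral_abs_of_almost_dominated
    (μ := volume.restrict (Metric.ball (0 : Euc N) R)) (F := F)
    (D := fun n x => |v n x - w x| ^ twoStar N) (M := M)
    (fun n => (hFi n).restrict.aestronglyMeasurable) (fun n => (hz n).restrict)
    (fun n x => Real.rpow_nonneg (abs_nonneg _) _) (fun n => ?_) ?_ ?_
  · refine ⟨_, key, fun n => ?_⟩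
    have e1 : ∫ x in Metric.ball (0 : Euc N) R, critTerm N m q lam (v n x) * (v n x - w x)
        ≤ ∫ x in Metric.ball (0 : Euc N) R, (a * |v n x - w x| ^ twoStar N + |F n x|) := by
      refine integral_mono (hc n).restrict
        (((hz n).const_mul a).restrict.add (hFi n).abs.restrict) fun x => ?_
      have := (le_max_left (critTerm N m q lam (v n x) * (v n x - w x)
        - a * |v n x - w x| ^ twoStar N) 0).trans (le_abs_self _)
      simp only [hF]
      linarith
    rw [integral_add ((hz n).const_mul a).restrict (hFi n).abs.restrict, integral_const_mul] at e1
    refine e1.trans (add_le_add (mul_le_mul_of_nonneg_left ?_ ha0.le) le_rfl)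
    exact integral_restrict_le (hz n) (fun x => Real.rpow_nonneg (abs_nonneg _) _) _
  · exact (integral_restrict_le (hz n) (fun x => Real.rpow_nonneg (abs_nonneg _) _) _).trans
      (hb.rpow_sub_le n)
  · refine ae_restrict_of_ae ?_
    filter_upwards [hb.ae_lim, hb.tendsto_sub] with x hx hx0
    have h1 := (((continuous_critTerm h).tendsto _).comp hx).mul hx0
    have h2 : Tendsto (fun n => a * |v n x - w x| ^ twoStar N) atTop (𝓝 0) := by
      have := (hx0.abs.rpow_const (p := twoStar N) (Or.inr (by linarith))).const_mul a
      simpa [Real.zero_rpow (by linarith : twoStar N ≠ 0)] using this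
    have h3 := (h1.sub h2).max (tendsto_const_nhds (x := (0 : ℝ)))
    simpa using h3
  · intro η hη
    obtain ⟨C, hC0, hC⟩ := exists_critTerm_mul_sub_le h hη
    refine ⟨fun x => C * (1 + w x ^ 2 + |w x| ^ twoStar N), ?_, fun n =>
      Eventually.of_forall fun x => ?_⟩
    · exact (((integrable_const 1).add (integrable_sq hb.memX_lim.1.1).restrict).add
        (hb.memX_lim.integrable_rpow h.three_le).1.restrict).const_mul C
    · have h1 := hC (v n x) (w x)
      have n1 := Real.rpow_nonneg (abs_nonneg (w x)) (twoStar N)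
      have n2 := Real.rpow_nonneg (abs_nonneg (v n x - w x)) (twoStar N)
      have n3 : 0 ≤ C * (1 + w x ^ 2 + |w x| ^ twoStar N) := by positivity
      have n4 : 0 ≤ η * |v n x - w x| ^ twoStar N := by positivity
      simp only [hF]
      rw [abs_of_nonneg (le_max_right _ _)]
      refine max_le ?_ (by linarith)
      linarith

/-- Everything follows from ∇v_n = ∇(v_n − w) + ∇w and the weak convergence of ∇(v_n − w) to 0. The
last part is only an inequality because ∫|∇w|² is dropped. -/
theorem BoundedConv.tendsto_inner_grad (hb : BoundedConv V v w M) (hV : PotBounds V V₀ V₁) :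
    Tendsto (fun n => ∫ x, inner ℝ (weakGrad w x) (weakGrad (v n - w) x)) atTop (𝓝 0) ∧
    (∀ n, ∫ x, inner ℝ (weakGrad (v n) x) (weakGrad (v n - w) x) =
      (∫ x, ‖weakGrad (v n - w) x‖ ^ 2)
        + ∫ x, inner ℝ (weakGrad w x) (weakGrad (v n - w) x)) ∧
    ∀ n, (∫ x, ‖weakGrad (v n - w) x‖ ^ 2)
        + 2 * (∫ x, inner ℝ (weakGrad w x) (weakGrad (v n - w) x)) ≤ ∫ x, ‖weakGrad (v n) x‖ ^ 2 := by
  have hw := hb.memX_lim.1.memLp_weakGrad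
  have hg : ∀ n, weakGrad (v n - w) =ᵐ[volume] weakGrad (v n) - weakGrad w := fun n =>
    ((hb.memX n).1.isWeakGrad.sub hb.memX_lim.1.isWeakGrad).weakGrad_ae_eq
  have mz : ∀ n, MemLp (weakGrad (v n - w)) 2 volume := fun n =>
    (hb.memX_sub hV n).1.memLp_weakGrad
  refine ⟨?_, fun n => ?_, fun n => ?_⟩
  · have h1 := (hb.weak_lim _ hw).sub_const (∫ x, inner ℝ (weakGrad w x) (weakGrad w x))
    rw [sub_self] at h1
    refine h1.congr fun n => ?_
    rw [← integral_sub (integrable_inner_of_memLp (hb.memX n).1.memLp_weakGrad hw)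
      (integrable_inner_of_memLp hw hw)]
    refine integral_congr_ae ?_
    filter_upwards [hg n] with x hx
    rw [hx, Pi.sub_apply, inner_sub_right, real_inner_comm]
  · rw [← integral_add (integrable_norm_sq (mz n)) (integrable_inner_of_memLp hw (mz n))]
    refine integral_congr_ae ?_
    filter_upwards [hg n] with x hx
    rw [← real_inner_self_eq_norm_sq, ← inner_add_left]
    congr 1
    rw [hx, Pi.sub_apply, sub_add_cancel]
  · have i := integrable_inner_of_memLp hw (mz n)
    rw [← integral_const_mul, ← integral_add (integrable_norm_sq (mz n)) (i.const_mul 2)]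
    refine integral_mono_ae ((integrable_norm_sq (mz n)).add (i.const_mul 2))
      (integrable_norm_sq (hb.memX n).1.memLp_weakGrad) ?_
    filter_upwards [hg n] with x hx
    have e : weakGrad (v n) x = weakGrad (v n - w) x + weakGrad w x := by
      rw [hx, Pi.sub_apply, sub_add_cancel]
    rw [e, norm_add_sq_real, real_inner_comm]
    have := sq_nonneg ‖weakGrad w x‖
    linarith

end Limits

/-! ### Strong convergence below the critical level -/

section Compactness

variable {N : ℕ} {V : Euc N → ℝ} {V₀ V₁ m q lam κ R M ε θ : ℝ} {v : ℕ → Euc N → ℝ} {w : Euc N → ℝ}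

theorem integrable_outTerm_mul (h : Admissible N m q lam V₀ κ) (hV : PotBounds V V₀ V₁)
    {u a : Euc N → ℝ} (hu : MemX V u) (ha : MemX V a) :
    Integrable fun x => outTerm V m q lam V₀ κ x (u x) * a x :=
  (MemLp.two_of_abs_le hu.1.1 (aestronglyMeasurable_outTerm h hV hu.1.1.1)
    fun x => abs_outTerm_le h hV x _).integrable_mul ha.1.1

/-- Outside the ball the potential is kept together with the nonlinearity, because it is their
difference, multiplied by u, that is nonnegative. -/
theorem JbarDeriv_eq_ball_add_compl (h : Admissible N m q lam V₀ κ) (hV : PotBounds V V₀ V₁)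
    {u φ : Euc N → ℝ} (hu : MemX V u) (hφ : MemX V φ) :
    JbarDeriv V ε m q lam V₀ κ R u φ =
      ε ^ 2 * (∫ x, inner ℝ (weakGrad u x) (weakGrad φ x))
      + (∫ x in Metric.ball (0 : Euc N) R,
          V x * changeVar m (u x) * changeVarDeriv m (u x) * φ x)
      - (∫ x in Metric.ball (0 : Euc N) R, critTerm N m q lam (u x) * φ x)
      + ∫ x in (Metric.ball (0 : Euc N) R)ᶜ, outTerm V m q lam V₀ κ x (u x) * φ x := by
  have hB : MeasurableSet (Metric.ball (0 : Euc N) R) := Metric.isOpen_ball.measurableSet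
  obtain ⟨-, iV, -⟩ := hasDerivAt_integral_potential h.one_lt h.three_le hV hu hφ
  obtain ⟨-, ip, -⟩ := hasDerivAt_integral_PFun (R := R) h hu hφ
  have e1 : ∫ x in Metric.ball (0 : Euc N) R,
      pFun m q lam V₀ κ R x (changeVar m (u x)) * changeVarDeriv m (u x) * φ x
      = ∫ x in Metric.ball (0 : Euc N) R, critTerm N m q lam (u x) * φ x := by
    refine setIntegral_congr_fun hB fun x hx => ?_
    simp only [pFun_of_mem hx, critTerm]
  have e2 : ∫ x in (Metric.ball (0 : Euc N) R)ᶜ, outTerm V m q lam V₀ κ x (u x) * φ x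
      = (∫ x in (Metric.ball (0 : Euc N) R)ᶜ,
          V x * changeVar m (u x) * changeVarDeriv m (u x) * φ x)
        - ∫ x in (Metric.ball (0 : Euc N) R)ᶜ,
          pFun m q lam V₀ κ R x (changeVar m (u x)) * changeVarDeriv m (u x) * φ x := by
    rw [← integral_sub iV.restrict ip.restrict]
    refine setIntegral_congr_fun hB.compl fun x hx => ?_
    simp only [pFun_of_notMem hx, outTerm]
    ring
  rw [JbarDeriv, ← integral_add_compl hB iV, ← integral_add_compl hB ip, e1, e2]
  ring

/-- Test J̄' with v_n − w itself. The gradients contribute ε²a, the potential on the ball vanishes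
in the limit, and the outside part tends to X minus its value at w. The critical term must balance
what is left. -/
theorem BoundedConv.tendsto_critTerm_sub (hb : BoundedConv V v w M)
    (h : Admissible N m q lam V₀ κ) (hV : PotBounds V V₀ V₁)
    (hJ : Tendsto (fun n => JbarDeriv V ε m q lam V₀ κ R (v n) (v n - w)) atTop (𝓝 0))
    {a X : ℝ} (ha : Tendsto (fun n => ∫ x, ‖weakGrad (v n - w) x‖ ^ 2) atTop (𝓝 a))
    (hX : Tendsto (fun n => ∫ x in (Metric.ball (0 : Euc N) R)ᶜ,
      outTerm V m q lam V₀ κ x (v n x) * v n x) atTop (𝓝 X)) :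
    Tendsto (fun n => ∫ x in Metric.ball (0 : Euc N) R,
      critTerm N m q lam (v n x) * (v n x - w x)) atTop
      (𝓝 (ε ^ 2 * a + (X - ∫ x in (Metric.ball (0 : Euc N) R)ᶜ,
        outTerm V m q lam V₀ κ x (w x) * w x))) := by
  obtain ⟨t1, t2, -⟩ := hb.tendsto_inner_grad hV
  have t3 := hb.tendsto_potential (R := R) h hV
  have t4 := hb.tendsto_outTerm_mul h hV (Metric.ball (0 : Euc N) R)ᶜ
  have t5 := ((((ha.add t1).const_mul (ε ^ 2)).add t3).add (hX.sub t4)).sub hJ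
  simp only [add_zero, sub_zero] at t5
  refine t5.congr fun n => ?_
  rw [JbarDeriv_eq_ball_add_compl h hV (hb.memX n) (hb.memX_sub hV n), t2 n]
  have e : ∫ x in (Metric.ball (0 : Euc N) R)ᶜ, outTerm V m q lam V₀ κ x (v n x) * (v n - w) x
      = (∫ x in (Metric.ball (0 : Euc N) R)ᶜ, outTerm V m q lam V₀ κ x (v n x) * v n x)
        - ∫ x in (Metric.ball (0 : Euc N) R)ᶜ, outTerm V m q lam V₀ κ x (v n x) * w x := by
    rw [← integral_sub (integrable_outTerm_mul h hV (hb.memX n) (hb.memX n)).restrict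
      (integrable_outTerm_mul h hV (hb.memX n) hb.memX_lim).restrict]
    refine integral_congr_ae (Eventually.of_forall fun x => ?_)
    simp only [Pi.sub_apply]
    ring
  rw [e]
  simp only [Pi.sub_apply]
  ring

/-- Fatou is applied on the ball to f(v⁺)^(2*m) + `subTerm` − m `critTerm` v, nonnegative by
`critTerm_mul_le`. The integrals of `subTerm` and of `critTerm`(v_n) w converge to their values at w
and cancel, so the lower limit of the integral of f(v_n⁺)^(2*m) is at least mZ plus the same
integral for w, which is dropped. -/
theorem BoundedConv.energy_limit (hb : BoundedConv V v w M)
    (h : Admissible N m q lam V₀ κ) (hV : PotBounds V V₀ V₁) (hθ : 2 * m < θ) (hθq : θ ≤ q)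
    (hκ : θ / (θ - 2) < κ) {c a Z : ℝ}
    (hc : Tendsto (fun n => Jbar V ε m q lam V₀ κ R (v n) - 1 / θ *
      JbarDeriv V ε m q lam V₀ κ R (v n) (fun x => changeVarQuot m (v n x))) atTop (𝓝 c))
    (ha : Tendsto (fun n => ∫ x, ‖weakGrad (v n - w) x‖ ^ 2) atTop (𝓝 a))
    (hZ : Tendsto (fun n => ∫ x in Metric.ball (0 : Euc N) R,
      critTerm N m q lam (v n x) * (v n x - w x)) atTop (𝓝 Z)) :
    (1 / 2 - m / θ) * (ε ^ 2 * a) + (1 / θ - 1 / (twoStar N * m)) * (m * Z) ≤ c := by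
  have hm := h.one_lt
  obtain ⟨-, -, c1, c2⟩ := slope_coeff_pos hm hθ hκ
  have hθ0 : 0 < θ := by linarith
  set μ : ℝ := 1 / θ - 1 / (twoStar N * m) with hμ
  have hμ0 : 0 ≤ μ := sub_nonneg.2 (one_div_le_one_div_of_le hθ0 (hθq.trans h.q_lt.le))
  set B := Metric.ball (0 : Euc N) R
  obtain ⟨t1, -, t2⟩ := hb.tendsto_inner_grad hV
  obtain ⟨s1, s2, s3⟩ := hb.tendsto_subTerm (R := R) h
  have t3 := hb.tendsto_critTerm_mul (R := R) h
  have int : ∀ u : Euc N → ℝ, MemX V u → Integrable (fun x => subTerm m q lam (twoStar N) (u x))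
      (volume.restrict B) →
      Integrable (fun x => μ * (changeVar m (max (u x) 0) ^ (twoStar N * m)
        + subTerm m q lam (twoStar N) (u x) - m * (critTerm N m q lam (u x) * u x)))
        (volume.restrict B) ∧
      ∫ x in B, μ * (changeVar m (max (u x) 0) ^ (twoStar N * m)
        + subTerm m q lam (twoStar N) (u x) - m * (critTerm N m q lam (u x) * u x)) =
      μ * ((∫ x in B, changeVar m (max (u x) 0) ^ (twoStar N * m))
        + (∫ x in B, subTerm m q lam (twoStar N) (u x))
        - m * ∫ x in B, critTerm N m q lam (u x) * u x) := by
    intro u hu hs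
    have i1 := (integrable_changeVar_crit h hu).restrict (s := B)
    have i2 := (integrable_critTerm_mul h hu hu).restrict (s := B)
    have i12 : Integrable (fun x => changeVar m (max (u x) 0) ^ (twoStar N * m)
        + subTerm m q lam (twoStar N) (u x)) (volume.restrict B) := i1.add hs
    refine ⟨(i12.sub (i2.const_mul m)).const_mul μ, ?_⟩
    rw [integral_const_mul, integral_sub i12 (i2.const_mul m), integral_add i1 hs,
      integral_const_mul]
  have fatou := integrable_and_integral_le_of_tendsto (μ := volume.restrict B)
    (F := fun n x => μ * (changeVar m (max (v n x) 0) ^ (twoStar N * m)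
        + subTerm m q lam (twoStar N) (v n x) - m * (critTerm N m q lam (v n x) * v n x)))
    (f := fun x => μ * (changeVar m (max (w x) 0) ^ (twoStar N * m)
        + subTerm m q lam (twoStar N) (w x) - m * (critTerm N m q lam (w x) * w x)))
    (a := fun n => (Jbar V ε m q lam V₀ κ R (v n) - 1 / θ *
      JbarDeriv V ε m q lam V₀ κ R (v n) (fun x => changeVarQuot m (v n x)))
      - (1 / 2 - m / θ) * (ε ^ 2 * ((∫ x, ‖weakGrad (v n - w) x‖ ^ 2)
        + 2 * ∫ x, inner ℝ (weakGrad w x) (weakGrad (v n - w) x)))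
      + μ * ((∫ x in B, subTerm m q lam (twoStar N) (v n x))
        - m * ((∫ x in B, critTerm N m q lam (v n x) * (v n x - w x))
          + ∫ x in B, critTerm N m q lam (v n x) * w x)))
    (fun n => (int _ (hb.memX n) (s2 n)).1)
    (fun n => Eventually.of_forall fun x =>
      mul_nonneg hμ0 (sub_nonneg.2 (critTerm_mul_le h (v n x)))) ?_ ?_
    ((hc.sub (((ha.add (t1.const_mul 2)).const_mul (ε ^ 2)).const_mul (1 / 2 - m / θ))).add
      ((s3.sub ((hZ.add t3).const_mul m)).const_mul μ))
  · have f2 := fatou.2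
    rw [(int w hb.memX_lim s1).2] at f2
    have f3 : 0 ≤ μ * ∫ x in B, changeVar m (max (w x) 0) ^ (twoStar N * m) :=
      mul_nonneg hμ0 (integral_nonneg fun x =>
        Real.rpow_nonneg (changeVar_nonneg hm (le_max_right _ _)) _)
    linarith
  · refine ae_restrict_of_ae ?_
    filter_upwards [hb.ae_lim] with x hx
    have k1 : Continuous fun s : ℝ => changeVar m (max s 0) ^ (twoStar N * m) :=
      ((continuous_changeVar hm).comp (continuous_id.max continuous_const)).rpow_const
        fun _ => Or.inr (by linarith [h.two_lt_crit])
    have k2 := ((k1.add (continuous_subTerm h)).sub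
      (((continuous_critTerm h).mul continuous_id).const_mul m)).const_mul μ
    exact (k2.tendsto (w x)).comp hx
  · intro n
    beta_reduce
    rw [(int _ (hb.memX n) (s2 n)).2]
    have e1 : ∫ x in B, critTerm N m q lam (v n x) * v n x
        = (∫ x in B, critTerm N m q lam (v n x) * (v n x - w x))
          + ∫ x in B, critTerm N m q lam (v n x) * w x := by
      have i1 : Integrable (fun x => critTerm N m q lam (v n x) * (v n x - w x)) :=
        integrable_critTerm_mul h (hb.memX n) (hb.memX_sub hV n)
      rw [← integral_add i1.restrict
        (integrable_critTerm_mul h (hb.memX n) hb.memX_lim).restrict]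
      refine integral_congr_ae (Eventually.of_forall fun x => ?_)
      beta_reduce
      ring
    have e2 := energy_estimate (R := R) (ε := ε) h hV hθ hθq (hb.memX n)
    have e3 := mul_le_mul_of_nonneg_left (mul_le_mul_of_nonneg_left (t2 n) (sq_nonneg ε)) c1.le
    have e4 : 0 ≤ (1 / 2 - 1 / θ - 1 / (2 * κ)) * (∫ x, V x * changeVar m (v n x) ^ 2) :=
      mul_nonneg c2.le (integral_nonneg fun x => mul_nonneg (hV.nonneg x) (sq_nonneg _))
    rw [e1]
    linarith

/-- If a > 0, divide ε²a ≤ m^(p/2−1) (a/S)^(p/2) by a/S, where p = 2*. Since p/2 − 1 = 2/(N−2),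
raising to the power (N−2)/2 gives m ε²a ≥ (ε²S)^(N/2). Inserting Z ≥ ε²a in the energy, the
coefficients add to (1/2 − m/θ) + (m/θ − 1/p) = 1/N, so c ≥ ε²a/N reaches the critical level. -/
theorem gradient_loss_eq_zero (hN : 3 ≤ N) (hm : 1 < m) (hθ : 2 * m < θ)
    (hθq : θ ≤ twoStar N * m) (hε : 0 < ε) {S a Z c : ℝ}
    (hS : 0 < S) (ha : 0 ≤ a) (haZ : ε ^ 2 * a ≤ Z)
    (hZ : Z ≤ m ^ (twoStar N / 2 - 1) * (a / S) ^ (twoStar N / 2))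
    (hcZ : (1 / 2 - m / θ) * (ε ^ 2 * a) + (1 / θ - 1 / (twoStar N * m)) * (m * Z) ≤ c)
    (hc : c < 1 / (N * m) * ε ^ N * S ^ ((N : ℝ) / 2)) : a = 0 := by
  by_contra hne
  have ha0 : 0 < a := lt_of_le_of_ne ha (Ne.symm hne)
  have hm0 : 0 < m := by linarith
  have hθ0 : 0 < θ := by linarith
  have hN3 : (3 : ℝ) ≤ N := by exact_mod_cast hN
  obtain ⟨hp1, hp⟩ := twoStar_eq hN
  set p := twoStar N with hpdef
  have hp2 : p / 2 = N / (N - 2) := by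
    rw [hpdef, twoStar]
    ring
  have hN2 : (0 : ℝ) < N - 2 := by linarith
  have h1 : ε ^ 2 * a ≤ m ^ (p / 2 - 1) * (a / S) ^ (p / 2) := haZ.trans hZ
  have h2 : ε ^ 2 * S * (a / S) ≤ m ^ (p / 2 - 1) * (a / S) ^ (p / 2 - 1) * (a / S) := by
    rw [mul_assoc (m ^ _), ← Real.rpow_add_one (by positivity)]
    rw [sub_add_cancel]
    calc _ = ε ^ 2 * a := by field_simp
      _ ≤ _ := h1
  have h3 : ε ^ 2 * S ≤ (m * (a / S)) ^ (p / 2 - 1) := by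
    rw [Real.mul_rpow hm0.le (by positivity)]
    exact le_of_mul_le_mul_right h2 (by positivity)
  have h4 : (ε ^ 2 * S) ^ (((N : ℝ) - 2) / 2) ≤ m * (a / S) := by
    refine (Real.rpow_le_rpow (by positivity) h3 (by positivity)).trans_eq ?_
    rw [← Real.rpow_mul (by positivity)]
    have : (p / 2 - 1) * (((N : ℝ) - 2) / 2) = 1 := by
      rw [hp2]
      field_simp
      ring
    rw [this, Real.rpow_one]
  have h5 : (ε ^ 2 * S) ^ ((N : ℝ) / 2) ≤ m * (ε ^ 2 * a) := by
    have e : (ε ^ 2 * S) ^ ((N : ℝ) / 2) = (ε ^ 2 * S) ^ (((N : ℝ) - 2) / 2) * (ε ^ 2 * S) := by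
      rw [← Real.rpow_add_one (by positivity)]
      congr 1
      ring
    rw [e]
    calc _ ≤ m * (a / S) * (ε ^ 2 * S) := mul_le_mul_of_nonneg_right h4 (by positivity)
      _ = _ := by field_simp
  have h6 : (ε ^ 2 * S) ^ ((N : ℝ) / 2) = ε ^ N * S ^ ((N : ℝ) / 2) := by
    rw [Real.mul_rpow (by positivity) hS.le, ← Real.rpow_natCast_mul hε.le]
    congr 1
    rw [← Real.rpow_natCast]
    congr 1
    push_cast
    ring
  have hμ0 : 0 ≤ 1 / θ - 1 / (p * m) := sub_nonneg.2 (one_div_le_one_div_of_le hθ0 hθq)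
  have h7 : (1 / θ - 1 / (p * m)) * (m * (ε ^ 2 * a)) ≤ (1 / θ - 1 / (p * m)) * (m * Z) := by
    gcongr
  have h8 : (1 / 2 - m / θ) * (ε ^ 2 * a) + (1 / θ - 1 / (p * m)) * (m * (ε ^ 2 * a))
      = ε ^ 2 * a / N := by
    have hp0 : p ≠ 0 := by linarith
    have : (1 / θ - 1 / (p * m)) * (m * (ε ^ 2 * a)) = (m / θ - p⁻¹) * (ε ^ 2 * a) := by
      field_simp
    rw [this, hp1]
    field_simp
    ring
  have h9 : 1 / (N * m) * ε ^ N * S ^ ((N : ℝ) / 2) ≤ ε ^ 2 * a / N := by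
    rw [h6] at h5
    calc _ = 1 / (N * m) * (ε ^ N * S ^ ((N : ℝ) / 2)) := by ring
      _ ≤ 1 / (N * m) * (m * (ε ^ 2 * a)) := mul_le_mul_of_nonneg_left h5 (by positivity)
      _ = _ := by field_simp
  linarith

/-- Vanishing of the gradients gives convergence in L^(2*) by Sobolev, so for L² only min(|v_n − w|,
1)² has to be controlled. On the ball it is bounded by 1. Outside it is dominated by the coercive
terms of v_n and w, whose integrals converge by hypothesis, so domination by a convergent sequence
suffices. -/
theorem tendsto_normX_sub (hb : BoundedConv V v w M)
    (h : Admissible N m q lam V₀ κ) (hV : PotBounds V V₀ V₁) (hκ : 1 < κ)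
    (ha : Tendsto (fun n => ∫ x, ‖weakGrad (v n - w) x‖ ^ 2) atTop (𝓝 0))
    (hX : Tendsto (fun n => ∫ x in (Metric.ball (0 : Euc N) R)ᶜ,
      outTerm V m q lam V₀ κ x (v n x) * v n x) atTop
      (𝓝 (∫ x in (Metric.ball (0 : Euc N) R)ᶜ, outTerm V m q lam V₀ κ x (w x) * w x))) :
    Tendsto (fun n => normX V (v n - w)) atTop (𝓝 0) := by
  have hm := h.one_lt
  have hp := h.two_lt
  have hV0 := hV.pos
  have hV1 := hV.upper_nonneg
  have hS := sobolevConst_pos h.three_le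
  have hκ1 : 0 < 1 - 1 / κ := by
    rw [sub_pos, div_lt_one (by linarith)]
    exact hκ
  have hz := hb.memX_sub hV
  have tp : Tendsto (fun n => ∫ x, |v n x - w x| ^ twoStar N) atTop (𝓝 0) := by
    refine squeeze_zero (fun n => integral_nonneg fun x => Real.rpow_nonneg (abs_nonneg _) _)
      (fun n => ((hz n).integrable_rpow h.three_le).2) ?_
    have := (ha.div_const (sobolevConst N)).rpow_const (p := twoStar N / 2) (Or.inr (by linarith))
    rwa [zero_div, Real.zero_rpow (by linarith)] at this
  have hmin : Continuous fun s : ℝ => min |s| 1 ^ 2 := (continuous_abs.min continuous_const).pow 2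
  have mlim : ∀ᵐ x, Tendsto (fun n => min |v n x - w x| 1 ^ 2) atTop (𝓝 0) := by
    filter_upwards [hb.tendsto_sub] with x hx
    simpa [Function.comp_def] using (hmin.tendsto 0).comp hx
  have mmeas : ∀ n, AEStronglyMeasurable (fun x => min |v n x - w x| 1 ^ 2) volume := fun n =>
    hmin.comp_aestronglyMeasurable (hz n).1.1.1
  have mint : ∀ n, Integrable fun x => min |v n x - w x| 1 ^ 2 := fun n => by
    refine (integrable_sq (hz n).1.1).mono' (mmeas n) (Eventually.of_forall fun x => ?_)
    rw [Real.norm_of_nonneg (sq_nonneg _), ← sq_abs ((v n - w) x)]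
    exact pow_le_pow_left₀ (le_min (abs_nonneg _) zero_le_one) (min_le_left _ _) 2
  have tin : Tendsto (fun n => ∫ x in Metric.ball (0 : Euc N) R, min |v n x - w x| 1 ^ 2)
      atTop (𝓝 0) := by
    have := tendsto_integral_of_dominated_convergence
      (μ := volume.restrict (Metric.ball (0 : Euc N) R))
      (F := fun n x => min |v n x - w x| 1 ^ 2) (f := fun _ => 0) (fun _ => 1)
      (fun n => (mmeas n).restrict) (integrable_const 1) (fun n => Eventually.of_forall fun x => ?_)
      (ae_restrict_of_ae mlim)
    · simpa using this
    · rw [Real.norm_of_nonneg (sq_nonneg _)]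
      exact pow_le_one₀ (le_min (abs_nonneg _) zero_le_one) (min_le_right _ _)
  -- The 8 comes from (2a + 2b)² ≤ 8(a² + b²); the other factor inverts the coercivity constant of
  -- `le_outTerm_mul`.
  set C : ℝ := 8 * (m / (V₀ * (1 - 1 / κ))) with hC
  have iO : ∀ u, MemX V u → Integrable (fun x => outTerm V m q lam V₀ κ x (u x) * u x)
      (volume.restrict (Metric.ball (0 : Euc N) R)ᶜ) := fun u hu =>
    (integrable_outTerm_mul h hV hu hu).restrict
  have tout : Tendsto (fun n => ∫ x in (Metric.ball (0 : Euc N) R)ᶜ, min |v n x - w x| 1 ^ 2)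
      atTop (𝓝 0) := by
    refine tendsto_integral_zero_of_tendsto_dominating
      (D := fun n x => C * (outTerm V m q lam V₀ κ x (v n x) * v n x
        + outTerm V m q lam V₀ κ x (w x) * w x))
      (d := fun x => C * (outTerm V m q lam V₀ κ x (w x) * w x
        + outTerm V m q lam V₀ κ x (w x) * w x))
      (fun n => (mmeas n).restrict) (fun n => Eventually.of_forall fun x => sq_nonneg _)
      (fun n => Eventually.of_forall fun x => ?_)
      (fun n => ((iO _ (hb.memX n)).add (iO _ hb.memX_lim)).const_mul C)
      (((iO _ hb.memX_lim).add (iO _ hb.memX_lim)).const_mul C) (ae_restrict_of_ae mlim) ?_ ?_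
    · have k1 : ∀ s, changeVar m s ^ 2
          ≤ m / (V₀ * (1 - 1 / κ)) * (outTerm V m q lam V₀ κ x s * s) := by
        intro s
        have := le_outTerm_mul h hV hκ x s
        calc _ = m / (V₀ * (1 - 1 / κ)) * (V₀ * (1 - 1 / κ) / m * changeVar m s ^ 2) := by
              have : (1 : ℝ) - 1 / κ ≠ 0 := hκ1.ne'
              generalize (1 : ℝ) - 1 / κ = t at this
              field_simp
          _ ≤ _ := mul_le_mul_of_nonneg_left this (by positivity)
      have k2 : min |v n x - w x| 1 ≤ min |v n x| 1 + min |w x| 1 := by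
        have := abs_sub (v n x) (w x)
        have a1 := abs_nonneg (v n x)
        have a2 := abs_nonneg (w x)
        rcases le_total |v n x| 1 with l1 | l1 <;> rcases le_total |w x| 1 with l2 | l2 <;>
          simp only [min_eq_left, min_eq_right, l1, l2]
        · exact (min_le_left _ _).trans this
        · exact (min_le_right _ _).trans (by linarith)
        · exact (min_le_right _ _).trans (by linarith)
        · exact (min_le_right _ _).trans (by linarith)
      have k3 := min_abs_one_le hm (v n x)
      have k4 := min_abs_one_le hm (w x)
      have k5 : min |v n x - w x| 1 ^ 2 ≤ (2 * |changeVar m (v n x)| + 2 * |changeVar m (w x)|) ^ 2 :=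
        pow_le_pow_left₀ (le_min (abs_nonneg _) zero_le_one) (by linarith) 2
      have k6 := k1 (v n x)
      have k7 := k1 (w x)
      have k8 := sq_nonneg (|changeVar m (v n x)| - |changeVar m (w x)|)
      have k9 := sq_abs (changeVar m (v n x))
      have k10 := sq_abs (changeVar m (w x))
      rw [hC]
      nlinarith
    · refine ae_restrict_of_ae ?_
      filter_upwards [hb.ae_lim] with x hx
      exact (((((continuous_outTerm h x).tendsto _).comp hx).mul hx).add_const _).const_mul C
    · have t := (hX.add_const (∫ x in (Metric.ball (0 : Euc N) R)ᶜ,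
        outTerm V m q lam V₀ κ x (w x) * w x)).const_mul C
      rw [integral_const_mul, integral_add (iO _ hb.memX_lim) (iO _ hb.memX_lim)]
      refine t.congr fun n => ?_
      rw [integral_const_mul, integral_add (iO _ (hb.memX n)) (iO _ hb.memX_lim)]
  have t2 : Tendsto (fun n => ∫ x, (v n - w) x ^ 2) atTop (𝓝 0) := by
    refine squeeze_zero (fun n => integral_nonneg fun x => sq_nonneg _) (fun n => ?_)
      (by simpa using (tin.add tout).add tp)
    have ip : Integrable fun x => |v n x - w x| ^ twoStar N := ((hz n).integrable_rpow h.three_le).1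
    rw [integral_add_compl Metric.isOpen_ball.measurableSet (mint n), ← integral_add (mint n) ip]
    refine integral_mono (integrable_sq (hz n).1.1) ((mint n).add ip) fun x => ?_
    simpa using sq_le_of_one_le hp le_rfl (v n x - w x)
  have t3 : Tendsto (fun n => ∫ x, V x * (v n - w) x ^ 2) atTop (𝓝 0) := by
    refine squeeze_zero (fun n => integral_nonneg fun x => mul_nonneg (hV.nonneg x) (sq_nonneg _))
      (fun n => ?_) (by simpa using t2.const_mul V₁)
    rw [← integral_const_mul]
    exact integral_mono (hz n).2 ((integrable_sq (hz n).1.1).const_mul V₁) fun x =>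
      mul_le_mul_of_nonneg_right (hV.upper x) (sq_nonneg _)
  have := (ha.add t3).sqrt
  simpa [normX] using this

theorem BoundedConv.exists_tendsto_normX (hb : BoundedConv V v w M)
    (h : Admissible N m q lam V₀ κ) (hV : PotBounds V V₀ V₁) (hθ : 2 * m < θ) (hθq : θ ≤ q)
    (hκ : θ / (θ - 2) < κ) (hε : 0 < ε) {c : ℝ}
    (hc : c < 1 / (N * m) * ε ^ N * sobolevConst N ^ ((N : ℝ) / 2))
    (hJ : Tendsto (fun n => JbarDeriv V ε m q lam V₀ κ R (v n) (v n - w)) atTop (𝓝 0))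
    (hE : Tendsto (fun n => Jbar V ε m q lam V₀ κ R (v n) - 1 / θ *
      JbarDeriv V ε m q lam V₀ κ R (v n) (fun x => changeVarQuot m (v n x))) atTop (𝓝 c)) :
    ∃ σ : ℕ → ℕ, StrictMono σ ∧ Tendsto (fun n => normX V (v (σ n) - w)) atTop (𝓝 0) := by
  have hm := h.one_lt
  have hp := h.two_lt
  have hS := sobolevConst_pos h.three_le
  obtain ⟨-, hκ1, -, -⟩ := slope_coeff_pos hm hθ hκ
  have hX0 : ∀ n, 0 ≤ ∫ x in (Metric.ball (0 : Euc N) R)ᶜ,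
      outTerm V m q lam V₀ κ x (v n x) * v n x := fun n =>
    integral_nonneg fun x => outTerm_mul_nonneg h hV hκ1 x _
  have hXM : ∀ n, ∫ x in (Metric.ball (0 : Euc N) R)ᶜ,
      outTerm V m q lam V₀ κ x (v n x) * v n x ≤ (V₁ + V₀ / κ) * M := by
    intro n
    have i := integrable_outTerm_mul h hV (hb.memX n) (hb.memX n)
    have hν := h.slope_pos
    have hV1 := hV.upper_nonneg
    refine (integral_restrict_le i (fun x => outTerm_mul_nonneg h hV hκ1 x _) _).trans ?_
    refine le_trans ?_ (mul_le_mul_of_nonneg_left (hb.sq_le n) (by positivity))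
    rw [← integral_const_mul]
    refine integral_mono i ((integrable_sq (hb.memX n).1.1).const_mul _) fun x => ?_
    refine (le_abs_self _).trans ?_
    rw [abs_mul, ← sq_abs, sq, ← mul_assoc]
    exact mul_le_mul_of_nonneg_right (abs_outTerm_le h hV x _) (abs_nonneg _)
  obtain ⟨a, ha, σ₁, hσ₁, ta⟩ := isCompact_Icc.tendsto_subseq
    (x := fun n => ∫ x, ‖weakGrad (v n - w) x‖ ^ 2) (s := Set.Icc 0 M)
    fun n => ⟨integral_nonneg fun x => sq_nonneg _, hb.grad_sub_le n⟩
  obtain ⟨X, -, σ₂, hσ₂, tX⟩ := isCompact_Icc.tendsto_subseq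
    (x := fun n => ∫ x in (Metric.ball (0 : Euc N) R)ᶜ,
      outTerm V m q lam V₀ κ x (v (σ₁ n) x) * v (σ₁ n) x) (s := Set.Icc 0 ((V₁ + V₀ / κ) * M))
    fun n => ⟨hX0 _, hXM _⟩
  have hσ : StrictMono (σ₁ ∘ σ₂) := hσ₁.comp hσ₂
  refine ⟨σ₁ ∘ σ₂, hσ, ?_⟩
  have hb' := hb.subseq hσ
  have ta' := ta.comp hσ₂.tendsto_atTop
  have hJ' := hJ.comp hσ.tendsto_atTop
  have hE' := hE.comp hσ.tendsto_atTop
  have tZ := hb'.tendsto_critTerm_sub (ε := ε) h hV hJ' ta' tX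
  have hen := hb'.energy_limit (ε := ε) (R := R) h hV hθ hθq hκ hE' ta' tZ
  set Y := ∫ x in (Metric.ball (0 : Euc N) R)ᶜ, outTerm V m q lam V₀ κ x (w x) * w x
  -- Fatou for the nonnegative outside integrand. Through the balance of
  -- `BoundedConv.tendsto_critTerm_sub` it becomes the lower bound ε²a ≤ Z.
  have hYX : Y ≤ X := by
    refine (integrable_and_integral_le_of_tendsto
      (F := fun n x => outTerm V m q lam V₀ κ x (v (σ₁ (σ₂ n)) x) * v (σ₁ (σ₂ n)) x)
      (fun n => (integrable_outTerm_mul h hV (hb'.memX n) (hb'.memX n)).restrict)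
      (fun n => Eventually.of_forall fun x => outTerm_mul_nonneg h hV hκ1 x _)
      (ae_restrict_of_ae ?_) (fun n => le_rfl) tX).2
    filter_upwards [hb'.ae_lim] with x hx
    exact (((continuous_outTerm h x).tendsto _).comp hx).mul hx
  obtain ⟨r, hr, hZr⟩ := hb'.exists_critTerm_sub_le (R := R) h hV
  have hmp : 0 ≤ m ^ (twoStar N / 2 - 1) := Real.rpow_nonneg (by linarith) _
  have hZ : ε ^ 2 * a + (X - Y) ≤ m ^ (twoStar N / 2 - 1) * (a / sobolevConst N) ^ (twoStar N / 2) := by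
    have t := (((ta'.div_const (sobolevConst N)).rpow_const (p := twoStar N / 2)
      (Or.inr (by linarith))).const_mul (m ^ (twoStar N / 2 - 1))).add hr
    rw [add_zero] at t
    refine le_of_tendsto_of_tendsto' tZ t fun n => (hZr n).trans ?_
    exact add_le_add (mul_le_mul_of_nonneg_left
      ((hb'.memX_sub hV n).integrable_rpow h.three_le).2 hmp) le_rfl
  have ha0 : a = 0 := gradient_loss_eq_zero h.three_le hm hθ (hθq.trans h.q_lt.le) hε hS ha.1
    (by linarith) hZ hen hc
  subst ha0
  -- With a = 0 the upper bound for Z reads X − Y ≤ 0, so no mass is lost outside the ball either.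
  rw [zero_div, Real.zero_rpow (by linarith), mul_zero, mul_zero, zero_add] at hZ
  have hXY : X = Y := by linarith
  rw [hXY] at tX
  exact tendsto_normX_sub hb' h hV hκ1 ta' tX

theorem exists_boundedConv_subseq (hN : 3 ≤ N) (hV : PotBounds V V₀ V₁) (hv : ∀ n, MemX V (v n))
    (hM : ∀ n, normX V (v n) ≤ M) :
    ∃ (w : Euc N → ℝ) (σ : ℕ → ℕ) (M' : ℝ), StrictMono σ ∧
      BoundedConv V (fun n => v (σ n)) w M' := by
  have hV0 := hV.pos
  have hS := sobolevConst_pos hN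
  have hp := (twoStar_eq hN).2
  have hsq : ∀ n, (∫ x, ‖weakGrad (v n) x‖ ^ 2) + ∫ x, V x * v n x ^ 2 ≤ M ^ 2 := fun n => by
    rw [← normX_sq hV]
    exact pow_le_pow_left₀ (Real.sqrt_nonneg _) (hM n) 2
  have hG : ∀ n, ∫ x, ‖weakGrad (v n) x‖ ^ 2 ≤ M ^ 2 := fun n =>
    (le_add_of_nonneg_right (integral_nonneg fun x =>
      mul_nonneg (hV.nonneg x) (sq_nonneg _))).trans (hsq n)
  have h2 : ∀ n, ∫ x, v n x ^ 2 ≤ M ^ 2 / V₀ := fun n => by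
    rw [le_div_iff₀ hV0, mul_comm, ← integral_const_mul]
    refine le_trans ?_ ((le_add_of_nonneg_left (integral_nonneg fun x => sq_nonneg _)).trans (hsq n))
    exact integral_mono ((integrable_sq (hv n).1.1).const_mul _) (hv n).2 fun x =>
      mul_le_mul_of_nonneg_right (hV.lower x) (sq_nonneg _)
  obtain ⟨w, H, σ, hσ, hwH, hw2, hH2, hae, hweak⟩ := exists_H1_convergent_subseq
    (M := max (M ^ 2) (M ^ 2 / V₀)) (fun n => (hv n).1.isWeakGrad) (fun n => (hv n).1.1)
    (fun n => (hv n).1.memLp_weakGrad) (fun n => (h2 n).trans (le_max_right _ _))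
    (fun n => (hG n).trans (le_max_left _ _))
  have hwX : MemX V w := hwH.memX hw2 hH2 hV
  have hz : ∀ n, MemX V (v (σ n) - w) := fun n => (hv _).sub hV hwX
  set A := 2 * M ^ 2 + 2 * ∫ x, ‖weakGrad w x‖ ^ 2 with hA
  have hzA : ∀ n, ∫ x, ‖weakGrad (v (σ n) - w) x‖ ^ 2 ≤ A := by
    intro n
    have i1 := (integrable_norm_sq (hv (σ n)).1.memLp_weakGrad).const_mul 2
    have i2 := (integrable_norm_sq hwX.1.memLp_weakGrad).const_mul 2
    have e : ∫ x, ‖weakGrad (v (σ n) - w) x‖ ^ 2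
        ≤ ∫ x, (2 * ‖weakGrad (v (σ n)) x‖ ^ 2 + 2 * ‖weakGrad w x‖ ^ 2) := by
      refine integral_mono_ae (integrable_norm_sq (hz n).1.memLp_weakGrad) (i1.add i2) ?_
      filter_upwards [((hv (σ n)).1.isWeakGrad.sub hwX.1.isWeakGrad).weakGrad_ae_eq] with x hx
      rw [hx, Pi.sub_apply]
      have k1 := pow_le_pow_left₀ (norm_nonneg _) (norm_sub_le (weakGrad (v (σ n)) x) (weakGrad w x)) 2
      have k2 := sq_nonneg (‖weakGrad (v (σ n)) x‖ - ‖weakGrad w x‖)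
      linarith
    rw [integral_add i1 i2, integral_const_mul, integral_const_mul] at e
    linarith [hG (σ n)]
  have sob : ∀ u, MemX V u → ∀ b, ∫ x, ‖weakGrad u x‖ ^ 2 ≤ b →
      ∫ x, |u x| ^ twoStar N ≤ (b / sobolevConst N) ^ (twoStar N / 2) := fun u hu b hbu => by
    refine (hu.integrable_rpow hN).2.trans (Real.rpow_le_rpow
      (div_nonneg (integral_nonneg fun x => sq_nonneg _) hS.le) ?_ (by linarith))
    exact div_le_div_of_nonneg_right hbu hS.le
  refine ⟨w, σ, max (max (M ^ 2 / V₀) ((M ^ 2 / sobolevConst N) ^ (twoStar N / 2)))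
    (max A ((A / sobolevConst N) ^ (twoStar N / 2))), hσ, fun n => hv _, hwX,
    fun n => (h2 _).trans ((le_max_left _ _).trans (le_max_left _ _)),
    fun n => (sob _ (hv _) _ (hG _)).trans ((le_max_right _ _).trans (le_max_left _ _)),
    fun n => (hzA n).trans ((le_max_left _ _).trans (le_max_right _ _)),
    fun n => (sob _ (hz n) _ (hzA n)).trans ((le_max_right _ _).trans (le_max_right _ _)),
    hae, fun K hK => ?_⟩
  have e : ∫ x, inner ℝ (weakGrad w x) (K x) = ∫ x, inner ℝ (H x) (K x) := by
    refine integral_congr_ae ?_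
    filter_upwards [hwH.weakGrad_ae_eq] with x hx
    rw [hx]
  rw [e]
  exact hweak K hK

/-- The modified functional satisfies the Palais–Smale condition below the critical level. -/
theorem satisfiesPS_Jbar (h : Admissible N m q lam V₀ κ) (hV : PotBounds V V₀ V₁)
    (hθ : 2 * m < θ) (hθq : θ ≤ q) (hκ : θ / (θ - 2) < κ) (hε : 0 < ε) {c : ℝ}
    (hc : c < 1 / (N * m) * ε ^ N * sobolevConst N ^ ((N : ℝ) / 2)) :
    SatisfiesPS V (Jbar V ε m q lam V₀ κ R) c := by
  rintro u ⟨hu, hJ, L, δ, hδ, hL⟩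
  have hm := h.one_lt
  have hD : ∀ n φ, MemX V φ → |JbarDeriv V ε m q lam V₀ κ R (u n) φ| ≤ δ n * normX V φ := by
    intro n φ hφ
    -- The functionals of a Palais–Smale sequence are given only as directional derivatives;
    -- uniqueness of the derivative identifies them with the explicit formula.
    rw [(hasDerivAt_Jbar (R := R) h hV (hu n) hφ).unique (hL n φ hφ).1]
    exact (hL n φ hφ).2
  obtain ⟨M, hM⟩ := eventually_bounded h hV hθ hθq hκ hε hu hJ hδ hD
  obtain ⟨n₀, hn₀⟩ := eventually_atTop.1 hM
  -- The norm bound holds from the index n₀ on, so the sequence is shifted by n₀ to make it hold for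
  -- all indices before a subsequence is extracted.
  have hshift : StrictMono fun n => n + n₀ := fun a b hab => Nat.add_lt_add_right hab n₀
  obtain ⟨w, σ, M', hσ, hb⟩ := exists_boundedConv_subseq (v := fun n => u (n + n₀)) h.three_le hV
    (fun n => hu _) (fun n => hn₀ _ (Nat.le_add_left _ _))
  have hτ : StrictMono fun n => σ n + n₀ := hshift.comp hσ
  have small : ∀ φ : ℕ → Euc N → ℝ, (∀ n, MemX V (φ n)) → ∀ b, (∀ n, normX V (φ n) ≤ b) →
      Tendsto (fun n => JbarDeriv V ε m q lam V₀ κ R (u (σ n + n₀)) (φ n)) atTop (𝓝 0) := by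
    intro φ hφ b hφb
    have t : Tendsto (fun n => |δ (σ n + n₀)| * b) atTop (𝓝 0) := by
      simpa using ((hδ.comp hτ.tendsto_atTop).abs).mul_const b
    refine squeeze_zero_norm (fun n => ?_) t
    exact (hD _ _ (hφ n)).trans
      (mul_le_mul (le_abs_self _) (hφb n) (Real.sqrt_nonneg _) (abs_nonneg _))
  have hzb : ∀ n, normX V (u (σ n + n₀) - w) ≤ √(M' + V₁ * (2 * M' + 2 * ∫ x, w x ^ 2)) := by
    intro n
    refine Real.sqrt_le_sqrt (add_le_add (hb.grad_sub_le n) ?_)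
    have i1 := (integrable_sq (hb.memX n).1.1).const_mul 2
    have i2 := (integrable_sq hb.memX_lim.1.1).const_mul 2
    calc ∫ x, V x * (u (σ n + n₀) - w) x ^ 2
        ≤ ∫ x, V₁ * (2 * u (σ n + n₀) x ^ 2 + 2 * w x ^ 2) := by
          refine integral_mono (hb.memX_sub hV n).2 ((i1.add i2).const_mul V₁) fun x => ?_
          refine mul_le_mul (hV.upper x) ?_ (sq_nonneg _) hV.upper_nonneg
          simp only [Pi.sub_apply]
          linarith [sq_nonneg (u (σ n + n₀) x + w x)]
      _ = V₁ * (2 * (∫ x, u (σ n + n₀) x ^ 2) + 2 * ∫ x, w x ^ 2) := by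
          rw [integral_const_mul, integral_add i1 i2, integral_const_mul, integral_const_mul]
      _ ≤ _ := by
          refine mul_le_mul_of_nonneg_left ?_ hV.upper_nonneg
          linarith [hb.sq_le n]
  obtain ⟨τ, hτ', ht⟩ := hb.exists_tendsto_normX (R := R) h hV hθ hθq hκ hε hc
    (small _ (hb.memX_sub hV) _ hzb) (by
      have t1 := small (fun n x => changeVarQuot m (u (σ n + n₀) x))
        (fun n => ((hu _).changeVarQuot hm hV).1) (m * M) fun n =>
        ((hu _).changeVarQuot hm hV).2.2.trans (mul_le_mul_of_nonneg_left
          (hn₀ _ (Nat.le_add_left _ _)) (by linarith))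
      simpa using (hJ.comp hτ.tendsto_atTop).sub (t1.const_mul (1 / θ)))
  exact ⟨w, fun n => σ (τ n) + n₀, hb.memX_lim, hτ.comp hτ', ht⟩

end Compactness

end QuasiSchrodinger

end

theorem lemma3p1 {N : ℕ} (hN : 3 ≤ N)
    (V : QuasiSchrodinger.Euc N → ℝ) (V₀ Vinf : ℝ)
    (hVH : QuasiSchrodinger.LocallyHolder V) (hV : QuasiSchrodinger.CondV V V₀ Vinf)
    (m q lam : ℝ) (hm : 1 < m) (hlam : 0 < lam)
    (hq : q ∈ Set.Ioo (2 * m) (QuasiSchrodinger.twoStar N * m))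
    (θ κ R : ℝ) (hθ : θ ∈ Set.Ioc (2 * m) q) (hκ : θ / (θ - 2) < κ) (hR : 0 < R)
    (ε c : ℝ) (hε : 0 < ε)
    (hc : c < 1 / (N * m) * ε ^ N * QuasiSchrodinger.sobolevConst N ^ ((N : ℝ) / 2)) :
    QuasiSchrodinger.SatisfiesPS V (QuasiSchrodinger.Jbar V ε m q lam V₀ κ R) c := by
  obtain ⟨hlow, V₁, hup⟩ := hV.exists_bound hVH.continuous
  obtain ⟨hκ0, -⟩ := QuasiSchrodinger.slope_coeff_pos hm hθ.1 hκ
  exact QuasiSchrodinger.satisfiesPS_Jbar ⟨hN, hm, hlam, hq.1, hq.2, div_pos hV.1 hκ0⟩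
    ⟨hVH.continuous, hV.1, hlow, hup⟩ hθ.1 hθ.2 hκ hε hc
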